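/- Let $K$ be a field, $q\in K^\times$, and put $[j]_q=q^{j-1}+q^{j-3}+\dots+q^{1-j}$; assume $q$ is generic, i.e. $[j]_q\ne 0$ for all $j\ge 1$ ($q=1$ is allowed if $\operatorname{char}K=0$). Let $V$ be a space with basis $x_1,\dots,x_n$ and let $R:V^{\otimes2}\to V^{\otimes 2}$, $R(x_i\otimes x_j)=\sum R_{ij}^{kl}\,x_k\otimes x_l$, be a Hecke symmetry, i.e. $R_{12}R_{23}R_{12}=R_{23}R_{12}R_{23}$ and $(q-R)(q^{-1}+R)=0$. Let $\Lambda_-(V)=T(V)/\langle \mathrm{Im}(q^{-1}+R)\rangle$ and suppose $R$ is even of rank $2$, i.e. $\dim\Lambda_-^2(V)=1$ and $\Lambda_-^N(V)=0$ for $N>2$. Let $v=\sum v^{ij}x_i\otimes x_j\neq0$ span the eigenspace $\{R=-q^{-1}\}\cong\Lambda^2_-(V)$, and suppose $R$ is admissible: there is $a\neq 0$ in $K$ such that extending $R$ to $V\otimes V^{\otimes2}\to V^{\otimes 2}\otimes V$ and $V^{\otimes2}\otimes V\to V\otimes V^{\otimes 2}$ one has $x\otimes v\mapsto a\,v\otimes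 x$ and $v\otimes x\mapsto a\,x\otimes v$ for all $x\in V$. Notation. Summation over repeated indices is understood. * $Q$ is defined by $R_{ia}^{jb}Q_{bk}^{al}=\delta_i^l\delta_k^j$, and $B_i^j=Q_{ai}^{aj}$, $C_i^j=Q_{ia}^{ja}$. * $P_+^m$ is the $q$-symmetrizer of $V^{\otimes m}$, given by $P_+^1=1$ and $[m+1]_qP_+^{m+1}=P_+^m\,(q^{-m}+[m]_qR_{m,m+1})\,P_+^m$, where $P_+^m$ acts on the first $m$ factors. Put $V_{(m)}=P_+^mV^{\otimes m}$. * $\mathrm{End}_l(V_{(m)})$ consists of operators acting from the left, with categorical trace $\mathrm{tr}_R Y=\mathrm{tr}\big((q^2C)^{\otimes m}Y\big)$; $\mathrm{End}_r(V_{(m)})$ consists of operators acting from the right, with $\mathrm{tr}_R Y=\mathrm{tr}\big((q^2B)^{\otimes m}Y\big)$ (ordinary traces over $V_{(m)}$). Put $\dim_R V_{(m)}=\mathrm{tr}_R\,\mathrm{id}_{V_{(m)}}$ (computed in $\mathrm{End}_l$). * For $X\in\mathrm{End}(V)$, $X_{(m)}=q^{1-m}[m]_q\,P_+^m(X\otimes\mathrm{id}^{\otimes(m-1)})|_{V_{(m)}}$.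 Let $h_i^j(x_k)=\delta_k^jx_i$ and $\ell_i^j(x_k)=B_k^jx_i$; put $\pi_m(h_i^j)=(h_i^j)_{(m)}$. * For $\hbar\neq0$, $\mathcal L_{\hbar,q}$ is the algebra with generators $l_i^j$, $L=\|l_i^j\|$, and relations $RL_1RL_1-L_1RL_1R-\hbar(RL_1-L_1R)=0$, $L_1=L\otimes\mathrm{id}$; and $\mathcal{SL}_{\hbar,q}=\mathcal L_{\hbar,q}/\langle C_i^jl_j^i\rangle$. * $V_{(k)}$ carries the bilinear form induced by $\langle x_i,x_j\rangle=(v^{-1})_{ij}$ on $V$, extended to $V^{\otimes k}$ by $\langle y_1\otimes\dots\otimes y_k,\,z_1\otimes\dots\otimes z_k\rangle=\prod_s\langle y_{k+1-s},z_s\rangle$. The right representation $\bar\pi_k$ of $A=\mathcal L_{\hbar,q}$ in $\mathrm{End}_r(V_{(k)})$ sends $l_i^j$ to the adjoint, for this form, of $\hbar\,(\ell_i^j)_{(k)}$. The $\mathfrak{sl}$-representation $\bar\pi_k$ of $A=\mathcal{SL}_{\hbar,q}$ sends $l_i^j$ to the adjoint of $t\,(f_i^j)_{(k)}$, where $f_i^j=\ell_i^j-\frac{\mathrm{tr}(C\ell_i^j)}{\mathrm{tr}\,C}\,\mathrm{id}$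 is the traceless part of $\ell_i^j$ and $t\neq0$ is a renormalisation constant. * $A^{\chi}$ is the quotient of $A$ by the elements $z-\chi(z)$ for central $z$ with $\bar\pi_k(z)=\chi(z)\,\mathrm{id}$; $\bar\pi_k$ descends to $A^\chi$. Put $L_{(m)}=\sum l_i^j\otimes\pi_m(h_j^i)$, with entries in $A^\chi$, and $L_{(k,m)}=\sum\bar\pi_k(l_i^j)\otimes\pi_m(h_j^i)$. Powers are formed by $(l\otimes\pi_m(h))(l'\otimes \pi_m(h'))=ll'\otimes\pi_m(h')\pi_m(h)$. $L_{(k,m)}$ is also an operator on $V_{(k)}\otimes V_{(m)}$. * For $0\le i\le m\leq k$ the component $V_{(k+m-2i)}$ of $V_{(k)}\otimes V_{(m)}$ is the image of the map $V_{(k+m-2i)}\to V_{(k)}\otimes V_{(m)}$ that inserts $i$ nested copies of $v$ between the first $k-i$ and the last $m-i$ tensor factors and then applies $P_+^k\otimes P_+^m$. $\mu_i(k,m)$ denotes the eigenvalue of $L_{(k,m)}$ on this component. * If the $\mu_i=\mu_i(k,m)$ are distinct, put $e_i(m)=\prod_{j\ne i}(L_{(m)}-\mu_j)/(\mu_i-\mu_j)$,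 and define the $q$-index $\mathrm{Ind}(e_i(m),\bar\pi_k)=(\mathrm{tr}_R\otimes\mathrm{tr}_R)\big((\bar\pi_k\otimes\mathrm{id})(e_i(m))\big)$, with $\mathrm{tr}_R$ on $\mathrm{End}_r(V_{(k)})$ and on $\mathrm{End}_l(V_{(m)})$. **Proposition.** Let $k\ge m\ge1$ and $\hbar\ne0$. The representation $\bar\pi_k$ of $\mathcal L_{\hbar,q}$ exists, and so does the $\mathfrak{sl}$-representation $\bar\pi_k$ of $\mathcal{SL}_{\hbar,q}$ for some $t\ne0$. For each such $\bar\pi_k$ the operator $L_{(k,m)}$ is scalar on every component $V_{(k+m-2i)}$ of $V_{(k)}\otimes V_{(m)}$, $0\le i\le m$, so that the eigenvalues $\mu_i(k,m)$ exist. If they are all distinct, then $\prod_{i=0}^m(L_{(k,m)}-\mu_i(k,m))=0$, the braided multiplicities are the categorical dimensions of the components, $$(\mathrm{tr}_R\otimes\mathrm{tr}_R)\,L_{(k,m)}^N=\sum_{i=0}^m\mu_i(k,m)^N\,\dim_RV_{(k+m-2i)}\qquad(N\ge0),$$ and $$\mathrm{Ind}(e_i(m),\bar\pi_k)=\dim_R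 V_{(k+m-2i)}=[m+k-2i+1]_q,\qquad 0\le i\le m .$$ -/

import Mathlib

namespace BraidedIndex

noncomputable section

open scoped TensorProduct
open MulOpposite (op unop)

/-! ### Tensor powers and Hecke symmetries

`V` is the space with basis `x_0, …, x_{n-1}`.  An element of the `N`-th tensor power is given by
its coefficients `w : (Fin N → Fin n) → K`.  An operator on `V` is given by its matrix `X` with
`x_k ↦ ∑ l, X k l • x_l` (the lower index, i.e. the input, numbers the rows), and the braiding by
its matrix with `x_i ⊗ x_j ↦ ∑ k l, R (i, j) (k, l) • x_k ⊗ x_l`. -/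

/-- Coefficient model of the tensor power `V^{⊗ N}`. -/
abbrev Tens (K : Type*) (n N : ℕ) : Type _ := (Fin N → Fin n) → K

/-- Matrices of operators on `V ⊗ V`. -/
abbrev PairMat (K : Type*) (n : ℕ) : Type _ := Matrix (Fin n × Fin n) (Fin n × Fin n) K

variable {K : Type*} [Field K] {n : ℕ}

/-- The `q`-integer `[m]_q = q^{m-1} + q^{m-3} + ⋯ + q^{1-m}`, which is
`(q^m - q^{-m}) / (q - q^{-1})` when `q ≠ q⁻¹`. -/
def qInt (q : K) (m : ℕ) : K :=
  ∑ j ∈ Finset.range m, q ^ ((m : ℤ) - 1 - 2 * (j : ℤ))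

/-- The operator `R` acting on the tensor factors `s` and `s + 1` (counted from `0`) of `V^{⊗ N}`
(the identity if there are no such factors). -/
def braidAt (R : PairMat K n) (N s : ℕ) : Module.End K (Tens K n N) :=
  if h : s + 1 < N then
    { toFun := fun w b => ∑ i : Fin n, ∑ j : Fin n,
        w (Function.update (Function.update b ⟨s, by omega⟩ i) ⟨s + 1, h⟩ j) *
          R (i, j) (b ⟨s, by omega⟩, b ⟨s + 1, h⟩)
      map_add' := fun w w' => by
        funext b
        simp only [Pi.add_apply, add_mul, Finset.sum_add_distrib]
      map_smul' := fun c w => by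
        funext b
        simp only [Pi.smul_apply, smul_eq_mul, RingHom.id_apply, Finset.mul_sum, mul_assoc] }
  else 1

/-- The operator `X` acting on the first tensor factor of `V^{⊗ N}`. -/
def firstSite (N : ℕ) (X : Matrix (Fin n) (Fin n) K) : Module.End K (Tens K n N) :=
  if h : 0 < N then
    { toFun := fun w b => ∑ i : Fin n, w (Function.update b ⟨0, h⟩ i) * X i (b ⟨0, h⟩)
      map_add' := fun w w' => by
        funext b
        simp only [Pi.add_apply, add_mul, Finset.sum_add_distrib]
      map_smul' := fun c w => by
        funext b
        simp only [Pi.smul_apply, smul_eq_mul, RingHom.id_apply, Finset.mul_sum, mul_assoc] }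
  else 1

/-- The operator `X ⊗ X ⊗ ⋯ ⊗ X` on `V^{⊗ N}`. -/
def tensPow (N : ℕ) (X : Matrix (Fin n) (Fin n) K) : Module.End K (Tens K n N) where
  toFun := fun w b => ∑ a : Fin N → Fin n, w a * ∏ s, X (a s) (b s)
  map_add' := fun w w' => by
    funext b
    simp only [Pi.add_apply, add_mul, Finset.sum_add_distrib]
  map_smul' := fun c w => by
    funext b
    simp only [Pi.smul_apply, smul_eq_mul, RingHom.id_apply, Finset.mul_sum, mul_assoc]

/-- `R` is a Hecke symmetry: a solution of the Yang--Baxter equation with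
`(q - R)(q⁻¹ + R) = 0`. -/
structure IsHeckeSymmetry (q : K) (R : PairMat K n) : Prop where
  ne_zero : q ≠ 0
  yangBaxter :
    braidAt R 3 0 * braidAt R 3 1 * braidAt R 3 0 = braidAt R 3 1 * braidAt R 3 0 * braidAt R 3 1
  hecke : (q • 1 - braidAt R 2 0) * (q⁻¹ • 1 + braidAt R 2 0) = 0

/-- The degree-`N` component `Λ₋^N(V)` of the algebra `T(V) / ⟨Im (q⁻¹ + R)⟩`. -/
abbrev SkewPower (q : K) (R : PairMat K n) (N : ℕ) : Type _ :=
  Tens K n N ⧸ (⨆ s : Fin (N - 1), LinearMap.range (q⁻¹ • 1 + braidAt R N (s : ℕ)))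

/-- `R` is even of rank `p`. -/
def IsEvenOfRank (q : K) (R : PairMat K n) (p : ℕ) : Prop :=
  Module.finrank K (SkewPower q R p) = 1 ∧ ∀ N, p < N → Subsingleton (SkewPower q R N)

/-- The tensor `∑ i j, v i j • x_i ⊗ x_j` generates `Λ₋²(V)`, realised inside `V ⊗ V` as the
`(-q⁻¹)`-eigenspace of `R`: for a symmetry of rank two it is the associated determinant. -/
def IsDeterminant (q : K) (R : PairMat K n) (v : Matrix (Fin n) (Fin n) K) : Prop :=
  v ≠ 0 ∧ braidAt R 2 0 (fun b => v (b 0) (b 1)) = -(q⁻¹ • fun b : Fin 2 → Fin n => v (b 0) (b 1))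

/-- A Hecke symmetry of rank two is admissible: moving any vector `x` through the associated
determinant `v`, from the left to the right and from the right to the left, is multiplication by
one and the same nonzero scalar `a`. -/
def IsAdmissible (q : K) (R : PairMat K n) : Prop :=
  ∃ a : K, a ≠ 0 ∧ ∀ v : Matrix (Fin n) (Fin n) K, IsDeterminant q R v → ∀ x : Fin n → K,
    braidAt R 3 1 (braidAt R 3 0 (fun b => x (b 0) * v (b 1) (b 2)))
        = (a • fun b : Fin 3 → Fin n => v (b 0) (b 1) * x (b 2)) ∧
    braidAt R 3 0 (braidAt R 3 1 (fun b => v (b 0) (b 1) * x (b 2)))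
        = (a • fun b : Fin 3 → Fin n => x (b 0) * v (b 1) (b 2))

/-! ### The matrices `B` and `C` -/

/-- The inverse `Q` of `R` by column:
`∑ a b, R (i, a) (j, b) * Q (b, k) (a, l) = δ_{i l} δ_{j k}`. -/
def columnInverse (R : PairMat K n) : PairMat K n :=
  Matrix.of fun s t =>
    (Matrix.of fun c d : Fin n × Fin n => R (c.1, d.2) (c.2, d.1))⁻¹ (s.1, t.1) (t.2, s.2)

/-- `B_i^j = ∑ a, Q_{a i}^{a j}`. -/
def matB (R : PairMat K n) : Matrix (Fin n) (Fin n) K :=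
  Matrix.of fun i j => ∑ a, columnInverse R (a, i) (a, j)

/-- `C_i^j = ∑ a, Q_{i a}^{j a}`. -/
def matC (R : PairMat K n) : Matrix (Fin n) (Fin n) K :=
  Matrix.of fun i j => ∑ a, columnInverse R (i, a) (j, a)

/-! ### The simple objects `V_(m)` and the categorical traces -/

/-- The `q`-symmetrizer of the first `a` tensor factors of `V^{⊗ N}` (for `a ≤ N`):
`P⁰ = 1` and `[a+1]_q P^{a+1} = P^a (q^{-a} + [a]_q R_{a,a+1}) P^a`. -/
def symmetrizer (q : K) (R : PairMat K n) (N : ℕ) : ℕ → Module.End K (Tens K n N)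
  | 0 => 1
  | a + 1 => (qInt q (a + 1))⁻¹ •
      (symmetrizer q R N a * (q ^ (-(a : ℤ)) • 1 + qInt q a • braidAt R N (a - 1)) *
        symmetrizer q R N a)

/-- The projector `P₊^m` of `V^{⊗ m}`. -/
abbrev symProj (q : K) (R : PairMat K n) (m : ℕ) : Module.End K (Tens K n m) :=
  symmetrizer q R m m

/-- The object `V_(m)`, the image of `P₊^m`. -/
abbrev SymPower (q : K) (R : PairMat K n) (m : ℕ) : Submodule K (Tens K n m) :=
  LinearMap.range (symProj q R m)

/-- The operator `P₊^m T` on `V_(m)`, for an operator `T` on `V^{⊗ m}`. -/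
def compress (q : K) (R : PairMat K n) (m : ℕ) (T : Module.End K (Tens K n m)) :
    Module.End K (SymPower q R m) :=
  (symProj q R m).rangeRestrict ∘ₗ T ∘ₗ (SymPower q R m).subtype

/-- The categorical trace on `End_l(V_(m))`: `Y ↦ tr (C_(m) Y)`, where `C_(m)` is the restriction
of `(q² C)^{⊗ m}` to `V_(m)`.  The factor `q²` is the normalisation for which the trace of the
identity of `V` is `[2]_q`. -/
def traceL (q : K) (R : PairMat K n) (m : ℕ) : Module.End K (SymPower q R m) →ₗ[K] K :=
  LinearMap.trace K (SymPower q R m) ∘ₗ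
    LinearMap.mulLeft K (compress q R m (tensPow m (q ^ 2 • matC R)))

/-- The categorical trace on `End_r(V_(m))`: `Y ↦ tr (B_(m) Y)`, where `B_(m)` is the restriction
of `(q² B)^{⊗ m}` to `V_(m)`. -/
def traceR (q : K) (R : PairMat K n) (m : ℕ) : Module.End K (SymPower q R m) →ₗ[K] K :=
  LinearMap.trace K (SymPower q R m) ∘ₗ
    LinearMap.mulLeft K (compress q R m (tensPow m (q ^ 2 • matB R)))

/-- The categorical dimension of `V_(m)`. -/
def catDim (q : K) (R : PairMat K n) (m : ℕ) : K := traceL q R m 1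

/-! ### Operators on `V` and the truncated coproduct -/

/-- The element `h_i^j` of `End_l(V)`: `x_k ↦ δ_k^j x_i`. -/
def hMat (i j : Fin n) : Matrix (Fin n) (Fin n) K := Matrix.single j i 1

/-- The element `l_i^j = ∑ a, h_i^a B_a^j` of `End_l(V)`: `x_k ↦ B_k^j x_i`. -/
def lMat (R : PairMat K n) (i j : Fin n) : Matrix (Fin n) (Fin n) K :=
  ∑ a, matB R a j • hMat i a

/-- The component of `X` in the traceless part `sl_R(V)` of
`End_l(V) = K · id ⊕ sl_R(V)`, `sl_R(V) = {X | tr (C X) = 0}`. -/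
def slPart (R : PairMat K n) (X : Matrix (Fin n) (Fin n) K) : Matrix (Fin n) (Fin n) K :=
  X - ((matC R * X).trace / (matC R).trace) • 1

/-- The truncated coproduct `X ↦ X_(m)`: `X_(m) g = q^{1-m} [m]_q P₊^m (X ⊗ id) g` on `V_(m)`. -/
def truncCoprod (q : K) (R : PairMat K n) (m : ℕ) (X : Matrix (Fin n) (Fin n) K) :
    Module.End K (SymPower q R m) :=
  (q ^ (1 - (m : ℤ)) * qInt q m) • compress q R m (firstSite m X)

/-- The bilinear form on `V_(k)` induced by the form `<x_i, x_j> = (v⁻¹)_{i j}` on `V`: on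
`V^{⊗ k}` the last factor on the left is paired with the first factor on the right, and so on. -/
def form (q : K) (R : PairMat K n) (v : Matrix (Fin n) (Fin n) K) (k : ℕ)
    (g f : SymPower q R k) : K :=
  ∑ a : Fin k → Fin n, ∑ b : Fin k → Fin n,
    (g : Tens K n k) a * (f : Tens K n k) b * ∏ s : Fin k, v⁻¹ (a s.rev) (b s)

/-! ### The modified reflection equation algebras -/

/-- The matrix `L ⊗ id` over the free algebra on the `l_i^j`. -/
def freeL (K : Type*) [Field K] (n : ℕ) :
    Matrix (Fin n × Fin n) (Fin n × Fin n) (FreeAlgebra K (Fin n × Fin n)) :=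
  Matrix.of fun s t => if s.2 = t.2 then FreeAlgebra.ι K (s.1, t.1) else 0

/-- The matrix `R` over the free algebra. -/
def freeR (R : PairMat K n) :
    Matrix (Fin n × Fin n) (Fin n × Fin n) (FreeAlgebra K (Fin n × Fin n)) :=
  R.map (algebraMap K (FreeAlgebra K (Fin n × Fin n)))

/-- The relations `R L₁ R L₁ - L₁ R L₁ R - ħ (R L₁ - L₁ R) = 0`, entry by entry. -/
inductive mreRel (R : PairMat K n) (ħ : K) :
    FreeAlgebra K (Fin n × Fin n) → FreeAlgebra K (Fin n × Fin n) → Prop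
  | entry (s t : Fin n × Fin n) :
      mreRel R ħ
        ((freeR R * freeL K n * freeR R * freeL K n - freeL K n * freeR R * freeL K n * freeR R
          - ħ • (freeR R * freeL K n - freeL K n * freeR R)) s t) 0

/-- The modified reflection equation algebra `𝓛_{ħ,q}`. -/
def MREA (R : PairMat K n) (ħ : K) : Type _ := RingQuot (mreRel R ħ)

instance (R : PairMat K n) (ħ : K) : Ring (MREA R ħ) :=
  inferInstanceAs (Ring (RingQuot (mreRel R ħ)))

instance (R : PairMat K n) (ħ : K) : Algebra K (MREA R ħ) :=
  inferInstanceAs (Algebra K (RingQuot (mreRel R ħ)))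

/-- The generator `l_i^j` of `𝓛_{ħ,q}`. -/
def genL (R : PairMat K n) (ħ : K) (i j : Fin n) : MREA R ħ :=
  RingQuot.mkAlgHom K (mreRel R ħ) (FreeAlgebra.ι K (i, j))

/-- The relation `𝐥 = ∑ i j, C_i^j l_j^i = 0`. -/
inductive slRel (R : PairMat K n) (ħ : K) : MREA R ħ → MREA R ħ → Prop
  | ell : slRel R ħ (∑ i, ∑ j, matC R i j • genL R ħ j i) 0

/-- The algebra `𝓢𝓛_{ħ,q} = 𝓛_{ħ,q} / ⟨𝐥⟩`. -/
def SMREA (R : PairMat K n) (ħ : K) : Type _ := RingQuot (slRel R ħ)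

instance (R : PairMat K n) (ħ : K) : Ring (SMREA R ħ) :=
  inferInstanceAs (Ring (RingQuot (slRel R ħ)))

instance (R : PairMat K n) (ħ : K) : Algebra K (SMREA R ħ) :=
  inferInstanceAs (Algebra K (RingQuot (slRel R ħ)))

/-- The image of `l_i^j` in `𝓢𝓛_{ħ,q}`. -/
def genSL (R : PairMat K n) (ħ : K) (i j : Fin n) : SMREA R ħ :=
  RingQuot.mkAlgHom K (slRel R ħ) (genL R ħ i j)

/-! ### The representations `π̄_k`

`End_r(V_(k))` consists of operators acting from the right, so that its product is opposite to
composition. -/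

/-- The algebra of right internal endomorphisms of `V_(k)`; also the algebra in which powers of the
extended matrices `L_(m)` are taken (matrices multiply as transposed operators). -/
abbrev EndOp (q : K) (R : PairMat K n) (k : ℕ) : Type _ := (Module.End K (SymPower q R k))ᵐᵒᵖ

/-- `ρ` is the representation `π̄_k` of `𝓛_{ħ,q}`: the generator `l_i^j` acts by the adjoint, with
respect to the form on `V_(k)`, of `ħ π_k(l_i^j)`, where `π_k(l_i^j) = (l_i^j)_(k)` is the
representation for `ħ = 1`. -/
def IsPiBar (q : K) (R : PairMat K n) (v : Matrix (Fin n) (Fin n) K) (ħ : K) (k : ℕ)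
    (ρ : MREA R ħ →ₐ[K] EndOp q R k) : Prop :=
  ∀ (i j : Fin n) (g f : SymPower q R k),
    form q R v k (unop (ρ (genL R ħ i j)) g) f =
      form q R v k g (ħ • truncCoprod q R k (lMat R i j) f)

/-- `ρ` is the `sl`-representation `π̄_k` of `𝓢𝓛_{ħ,q}`: up to a nonzero renormalisation `t` of the
generators, `l_i^j` acts by the adjoint of `X_(k)` for the traceless component `X` of `l_i^j`. -/
def IsSlPiBar (q : K) (R : PairMat K n) (v : Matrix (Fin n) (Fin n) K) (ħ : K) (k : ℕ)
    (ρ : SMREA R ħ →ₐ[K] EndOp q R k) : Prop :=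
  ∃ t : K, t ≠ 0 ∧ ∀ (i j : Fin n) (g f : SymPower q R k),
    form q R v k (unop (ρ (genSL R ħ i j)) g) f =
      form q R v k g (t • truncCoprod q R k (slPart R (lMat R i j)) f)

/-! ### The quotient by the central character, the extended matrices, the idempotents -/

section CentralQuotient

variable {A E : Type*} [Ring A] [Algebra K A] [Semiring E] [Algebra K E]

/-- The relations `z = χ(z)` for central `z`, where `χ` is the central character of the
representation `ρ`: `ρ z = χ(z) id`. -/
inductive centralRel (ρ : A →ₐ[K] E) : A → A → Prop
  | mk (z : A) (c : K) (hz : z ∈ Subalgebra.center K A) (hc : ρ z = algebraMap K E c) :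
      centralRel ρ z (algebraMap K A c)

/-- The quotient `A^χ` of `A` for the central character `χ` of `ρ`. -/
def CentralQuot (ρ : A →ₐ[K] E) : Type _ := RingQuot (centralRel ρ)

instance (ρ : A →ₐ[K] E) : Ring (CentralQuot ρ) :=
  inferInstanceAs (Ring (RingQuot (centralRel ρ)))

instance (ρ : A →ₐ[K] E) : Algebra K (CentralQuot ρ) :=
  inferInstanceAs (Algebra K (RingQuot (centralRel ρ)))

/-- The canonical projection `A → A^χ`. -/
def toCentralQuot (ρ : A →ₐ[K] E) : A →ₐ[K] CentralQuot ρ :=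
  RingQuot.mkAlgHom K (centralRel ρ)

/-- The representation of `A^χ` induced by `ρ`. -/
def descend (ρ : A →ₐ[K] E) : CentralQuot ρ →ₐ[K] E :=
  RingQuot.liftAlgHom K ⟨ρ, by
    intro x y h
    induction h with
    | mk c hz hc => exact hc.trans (ρ.commutes c).symm⟩

end CentralQuotient

/-- The extended matrix `L_(m) = ∑ i j, l_i^j ⊗ π_m(h_j^i)` with entries in an algebra `A`, as an
element of `A ⊗ End(V_(m))ᵒᵖ`: the product there is
`(∑ l ⊗ π_m(h)) (∑ l' ⊗ π_m(h')) = ∑ l l' ⊗ π_m(h') π_m(h)`. -/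
def extL (q : K) (R : PairMat K n) (m : ℕ) {A : Type*} [Ring A] [Algebra K A]
    (l : Fin n → Fin n → A) : A ⊗[K] EndOp q R m :=
  ∑ i, ∑ j, l i j ⊗ₜ[K] op (truncCoprod q R m (hMat j i))

/-- The element `e_i(m) = ∏_{j ≠ i} (L_(m) - μ_j) / (μ_i - μ_j)` with entries in `A^χ`, where `χ`
is the central character of the representation `ρ` of `A`. -/
def idem (q : K) (R : PairMat K n) (m : ℕ) {A E : Type*} [Ring A] [Algebra K A] [Semiring E]
    [Algebra K E] (ρ : A →ₐ[K] E) (l : Fin n → Fin n → A) (μ : Fin (m + 1) → K)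
    (i : Fin (m + 1)) : CentralQuot ρ ⊗[K] EndOp q R m :=
  Polynomial.aeval (extL q R m fun a b => toCentralQuot ρ (l a b))
    (Lagrange.basis Finset.univ μ i)

/-- The trace `𝐭𝐫 = tr_R ⊗ tr_R` on `End_r(V_(k)) ⊗ End_l(V_(m))`. -/
def boldTrace (q : K) (R : PairMat K n) (k m : ℕ) : EndOp q R k ⊗[K] EndOp q R m →ₗ[K] K :=
  LinearMap.mul' K K ∘ₗ TensorProduct.map
    (traceR q R k ∘ₗ (MulOpposite.opLinearEquiv K).symm.toLinearMap)
    (traceL q R m ∘ₗ (MulOpposite.opLinearEquiv K).symm.toLinearMap)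

/-- The `q`-index `Ind(e, ρ)`: apply the representation to the entries of `e`, then take the
trace. -/
def qIndex (q : K) (R : PairMat K n) (k m : ℕ) {A : Type*} [Ring A] [Algebra K A]
    (ρ : A →ₐ[K] EndOp q R k) (e : CentralQuot ρ ⊗[K] EndOp q R m) : K :=
  boldTrace q R k m
    (Algebra.TensorProduct.map (descend ρ) (AlgHom.id K (EndOp q R m)) e)

/-- The matrix `L_(k,m) = ∑ i j, π̄_k(l_i^j) ⊗ π_m(h_j^i)`, as an element of
`End_r(V_(k)) ⊗ End(V_(m))ᵒᵖ`. -/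
def extLkm (q : K) (R : PairMat K n) (k m : ℕ) {A : Type*} [Ring A] [Algebra K A]
    (ρ : A →ₐ[K] EndOp q R k) (l : Fin n → Fin n → A) : EndOp q R k ⊗[K] EndOp q R m :=
  extL q R m fun i j => ρ (l i j)

/-! ### The eigenvalues of `L_(k,m)`, labelled by the components of `V_(k) ⊗ V_(m)` -/

/-- The same element as an operator on `V_(k) ⊗ V_(m)`: the braided Casimir operator
`Cas_(k,m)`. -/
def casOp (q : K) (R : PairMat K n) (k m : ℕ) {A : Type*} [Ring A] [Algebra K A]
    (ρ : A →ₐ[K] EndOp q R k) (l : Fin n → Fin n → A) :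
    Module.End K (SymPower q R k ⊗[K] SymPower q R m) :=
  ∑ i, ∑ j, TensorProduct.map (unop (ρ (l i j))) (truncCoprod q R m (hMat j i))

/-- The first `k - i` letters of `a` followed by the last `m - i` letters of `b`. -/
def joinWord {k m i : ℕ} (hik : i ≤ k) (him : i ≤ m) (a : Fin k → Fin n) (b : Fin m → Fin n) :
    Fin (k + m - 2 * i) → Fin n := fun s =>
  if h : (s : ℕ) < k - i then a ⟨s, by omega⟩
  else b ⟨(s : ℕ) + 2 * i - k, by have := s.2; omega⟩

/-- The categorical morphism `V_(k+m-2i) → V_(k) ⊗ V_(m)`: insert `i` nested copies of the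
determinant `v` between the factors `k - i` and `k - i + 1` of a tensor in
`V_(k+m-2i) ⊆ V^{⊗ (k+m-2i)}`, and apply `P₊^k ⊗ P₊^m`. -/
def embed (q : K) (R : PairMat K n) (v : Matrix (Fin n) (Fin n) K) {k m i : ℕ} (hik : i ≤ k)
    (him : i ≤ m) :
    SymPower q R (k + m - 2 * i) →ₗ[K] SymPower q R k ⊗[K] SymPower q R m where
  toFun := fun w => ∑ a : Fin k → Fin n, ∑ b : Fin m → Fin n,
    ((w : Tens K n (k + m - 2 * i)) (joinWord hik him a b) *
        ∏ t : Fin i, v (a ⟨k - 1 - t, by have := t.2; omega⟩) (b ⟨t, by have := t.2; omega⟩)) •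
      ((symProj q R k).rangeRestrict (Pi.single a 1) ⊗ₜ[K]
        (symProj q R m).rangeRestrict (Pi.single b 1))
  map_add' := fun w w' => by
    simp only [Submodule.coe_add, Pi.add_apply, add_mul, add_smul, Finset.sum_add_distrib]
  map_smul' := fun c w => by
    simp only [Submodule.coe_smul, Pi.smul_apply, smul_eq_mul, RingHom.id_apply, Finset.smul_sum,
      mul_assoc, mul_smul]

/-- The component `V_(k+m-2i)` of `V_(k) ⊗ V_(m)`. -/
def component (q : K) (R : PairMat K n) (v : Matrix (Fin n) (Fin n) K) {k m i : ℕ} (hik : i ≤ k)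
    (him : i ≤ m) : Submodule K (SymPower q R k ⊗[K] SymPower q R m) :=
  LinearMap.range (embed q R v hik him)

/-- `μ i = μ_i(k,m)` is the eigenvalue of `L_(k,m)` on the component `V_(k+m-2i)` of
`V_(k) ⊗ V_(m)`, for `0 ≤ i ≤ m`. -/
def AreEigenvalues (q : K) (R : PairMat K n) (v : Matrix (Fin n) (Fin n) K) {k m : ℕ}
    (hmk : m ≤ k) {A : Type*} [Ring A] [Algebra K A] (ρ : A →ₐ[K] EndOp q R k)
    (l : Fin n → Fin n → A) (μ : Fin (m + 1) → K) : Prop :=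
  ∀ i : Fin (m + 1), ∀ x ∈ component q R v ((Nat.lt_succ_iff.mp i.2).trans hmk)
    (Nat.lt_succ_iff.mp i.2), casOp q R k m ρ l x = μ i • x

end

end BraidedIndex

open BraidedIndex

namespace BraidedIndex

/-! ### `q`-integers -/

section QInt

variable {K : Type*} [Field K] {q : K}

/-! Everything reduces to Temperley--Lieb calculus. Since `Λ₋²(V)` is a line, the Hecke relation
forces the image of `q - R` into `K v`. So `R = q - e`, where `e` is a cap `u` followed by the cup
`v`, with loop value `[2]_q` (`exists_isTLBraiding`). The Yang--Baxter equation and `Λ₋³(V) = 0`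
give `e₁e₂e₁ = e₁`, and admissibility makes both zigzags equal to one scalar `ε` with `ε² = 1`
(`exists_isSnake`). Then `P₊^m` is the Jones--Wenzl projector, `q²C = u vᵀ`, `q²B = uᵀ v`, and
`tr_R` on `End_l(V_(m))` is the closure of `m` strands by nested caps and cups. Hence `dim_R V_(m) =
[m+1]_q` (`catDim_eq`).

The bilinear form is a multiple of nested caps, so adjoints are found by sliding operators along
caps. The adjoint of `l_i^j` acts on the last factor of `V_(k)` by a rank-one matrix made of `u` and
`v`; paired with `h_j^i` on the next factor and summed over `i, j`, it becomes `e`. Hence `L_(k,m)`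
is a combination of `P e P` and `P`, where `P = P₊^k ⊗ P₊^m` and `e` sits at the junction
(`stableOp_extLkm`). The same rank-one matrices give a quadratic relation and a scalar quantum
trace, which together imply the reflection equation. The representation of the `sl` algebra differs
by a shift and a rescaling of the generators.

Single clasp expansions compute `e` at the junction on `P` applied to `i` nested cups; the factor is
`[i]_q [k+m+1-i]_q / ([k]_q [m]_q)` (`IsNested.e_smul`, `twoJW_center`). Its being nonzero for `i ≥
1` also makes the embeddings of the components injective, and the components span because an
unsymmetrized tensor between cups differs from a symmetrized one by tensors with one more cup
(`twoJW_nest_mem`).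

The index mixes a `B`-trace on `V_(k)` with a `C`-trace on `V_(m)`. A polynomial in `L_(k,m)` is a
Temperley--Lieb element, so its partial trace over `V_(m)` is a scalar on `V_(k)`, where the two
traces agree (`boldTrace_eq_trace`). What remains is an ordinary trace against `(q²C)^{⊗(k+m)}`.
This operator fixes `v`, so it restricts to the corresponding operator on each component
(`embed_compress`). Distinct eigenvalues make the sum of components direct, and `p(L_(k,m))` has
trace `∑ p(μ_i) dim_R V_(k+m-2i)`; powers and Lagrange polynomials for `p` give the two formulas.

The diagrams act on functions of infinite words, so that cups and caps are endomorphisms of a single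
space. -/

@[simp] lemma qInt_zero : qInt q 0 = 0 := by simp [qInt]

@[simp] lemma qInt_one : qInt q 1 = 1 := by simp [qInt]

lemma qInt_two : qInt q 2 = q + q⁻¹ := by
  simp [qInt, Finset.sum_range_succ, zpow_neg]

lemma qInt_succ (h0 : q ≠ 0) (a : ℕ) : qInt q (a + 1) = q * qInt q a + q ^ (-(a : ℤ)) := by
  unfold qInt
  rw [Finset.sum_range_succ, Finset.mul_sum]
  congr 1
  · refine Finset.sum_congr rfl fun j _ => ?_
    rw [← zpow_one_add₀ h0]
    congr 1
    push_cast
    ring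
  · congr 1
    push_cast
    ring

lemma qInt_succ' (h0 : q ≠ 0) (a : ℕ) : qInt q (a + 1) = q⁻¹ * qInt q a + q ^ (a : ℤ) := by
  unfold qInt
  rw [Finset.sum_range_succ', Finset.mul_sum]
  congr 1
  · refine Finset.sum_congr rfl fun j _ => ?_
    rw [← zpow_neg_one, ← zpow_add₀ h0]
    congr 1
    push_cast
    ring
  · congr 1
    push_cast
    ring

lemma qInt_add (h0 : q ≠ 0) (a b : ℕ) :
    qInt q (a + b) = q ^ (b : ℤ) * qInt q a + q ^ (-(a : ℤ)) * qInt q b := by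
  induction b with
  | zero => simp
  | succ b ih =>
    rw [← add_assoc, qInt_succ h0, ih, qInt_succ h0 b]
    have h1 : q ^ (-((a + b : ℕ) : ℤ)) = q ^ (-(a : ℤ)) * q ^ (-(b : ℤ)) := by
      rw [← zpow_add₀ h0]; congr 1; push_cast; ring
    have h2 : q ^ ((b + 1 : ℕ) : ℤ) = q * q ^ (b : ℤ) := by
      rw [← zpow_one_add₀ h0]; congr 1; push_cast; ring
    rw [h1, h2]
    ring

lemma qInt_two_mul (h0 : q ≠ 0) (a : ℕ) :
    qInt q 2 * qInt q (a + 1) = qInt q (a + 2) + qInt q a := by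
  rw [qInt_two, qInt_succ h0 (a + 1), qInt_succ' h0 a]
  have : q ^ (-((a + 1 : ℕ) : ℤ)) = q⁻¹ * q ^ (-(a : ℤ)) := by
    rw [← zpow_neg_one, ← zpow_add₀ h0]; congr 1; push_cast; ring
  rw [this]
  have h3 := (qInt_succ h0 a).symm.trans (qInt_succ' h0 a)
  linear_combination -q⁻¹ * h3 + (qInt q a) * (mul_inv_cancel₀ h0)

/-- This identity merges the two surviving terms in `IsNested.e_smul` into a single product. -/
lemma qInt_mul_add (h0 : q ≠ 0) (a b i : ℕ) :
    qInt q (a + i) * qInt q (b + i) = qInt q a * qInt q b + qInt q i * qInt q (a + b + i) := by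
  have e1 : qInt q (b + i) = q ^ (-(i : ℤ)) * qInt q b + q ^ (b : ℤ) * qInt q i := by
    rw [add_comm b i, qInt_add h0, add_comm]
  have e2 : qInt q (a + b + i) = q ^ ((b + i : ℕ) : ℤ) * qInt q a + q ^ (-(a : ℤ)) * qInt q (b + i) := by
    rw [add_assoc, qInt_add h0]
  rw [e2, qInt_add h0 a i, e1, Nat.cast_add, zpow_add₀ h0]
  have h : q ^ (i : ℤ) * q ^ (-(i : ℤ)) = 1 := by
    rw [← zpow_add₀ h0]; simp
  linear_combination (qInt q a * qInt q b) * h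

end QInt

/-! ### Jones--Wenzl projectors -/

section JonesWenzl

variable {K A M : Type*} [Field K] [Ring A] [Algebra K A]
  [AddCommGroup M] [Module K M] [Module A M] [IsScalarTower K A M]

/-- The first `N` terms of the sequence `e` satisfy the Temperley--Lieb relations with loop value
`[2]_q`. -/
structure IsTL (q : K) (e : ℕ → A) (N : ℕ) : Prop where
  sq : ∀ s, s < N → e s * e s = qInt q 2 • e s
  up : ∀ s, s + 1 < N → e s * e (s + 1) * e s = e s
  down : ∀ s, s + 1 < N → e (s + 1) * e s * e (s + 1) = e (s + 1)
  comm : ∀ s t, s + 2 ≤ t → t < N → Commute (e s) (e t)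

/-- The Jones--Wenzl projector on the first `a` strands, built from `e 0, …, e (a - 2)`. -/
def jw (q : K) (e : ℕ → A) : ℕ → A
  | 0 => 1
  | a + 1 => jw q e a - (qInt q a / qInt q (a + 1)) • (jw q e a * e (a - 1) * jw q e a)

variable {q : K} {e : ℕ → A} {N : ℕ}

@[simp] lemma jw_zero : jw q e 0 = 1 := rfl

-- At `a = 0` the recursion mentions `e (0 - 1) = e 0`, but with coefficient `[0]_q / [1]_q = 0`.
@[simp] lemma jw_one : jw q e 1 = 1 := by simp [jw]

lemma jw_succ_succ (a : ℕ) : jw q e (a + 2) =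
    jw q e (a + 1) - (qInt q (a + 1) / qInt q (a + 2)) •
      (jw q e (a + 1) * e a * jw q e (a + 1)) := rfl

lemma IsTL.mono (h : IsTL q e N) {N' : ℕ} (hN : N' ≤ N) : IsTL q e N' :=
  ⟨fun s hs => h.sq s (by omega), fun s hs => h.up s (by omega), fun s hs => h.down s (by omega),
    fun s t hs ht => h.comm s t hs (by omega)⟩

lemma IsTL.shift (h : IsTL q e N) {l N' : ℕ} (hN : N' + l ≤ N) :
    IsTL q (fun s => e (l + s)) N' :=
  ⟨fun s hs => h.sq (l + s) (by omega), fun s hs => h.up (l + s) (by omega),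
    fun s hs => h.down (l + s) (by omega), fun s t hs ht => h.comm (l + s) (l + t) (by omega) (by omega)⟩

lemma IsTL.reverse (h : IsTL q e N) : IsTL q (fun s => e (N - 1 - s)) N := by
  refine ⟨fun s hs => h.sq _ (by omega), fun s hs => ?_, fun s hs => ?_, fun s t hs ht =>
    (h.comm _ _ (by omega) (by omega)).symm⟩
  · have := h.down (N - 1 - (s + 1)) (by omega)
    rwa [show N - 1 - (s + 1) + 1 = N - 1 - s by omega] at this
  · have := h.up (N - 1 - (s + 1)) (by omega)
    rwa [show N - 1 - (s + 1) + 1 = N - 1 - s by omega] at this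

lemma jw_congr {e' : ℕ → A} (a : ℕ) (h : ∀ s, s + 1 < a → e s = e' s) :
    jw q e a = jw q e' a := by
  induction a with
  | zero => rfl
  | succ a ih =>
    rcases a with _ | a
    · simp
    · rw [jw_succ_succ, jw_succ_succ, ih fun s hs => h s (by omega), h a (by omega)]

lemma commute_jw {x : A} (a : ℕ) (h : ∀ s, s + 1 < a → Commute x (e s)) :
    Commute x (jw q e a) := by
  induction a with
  | zero => simp
  | succ a ih =>
    rcases a with _ | a
    · simp
    · have h1 := ih fun s hs => h s (by omega)
      rw [jw_succ_succ]
      exact h1.sub_right (((h1.mul_right (h a (by omega))).mul_right h1).smul_right _)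

lemma jw_smul_eq {x : M} (a : ℕ) (h : ∀ s, s + 1 < a → e s • x = 0) : jw q e a • x = x := by
  induction a with
  | zero => simp
  | succ a ih =>
    rcases a with _ | a
    · simp
    · have h1 := ih fun s hs => h s (by omega)
      rw [jw_succ_succ, sub_smul, smul_assoc, mul_smul, mul_smul, h1, h a (by omega)]
      simp

lemma jw_mul_eq {x : A} (a : ℕ) (h : ∀ s, s + 1 < a → e s * x = 0) : jw q e a * x = x := by
  simpa only [smul_eq_mul] using jw_smul_eq (q := q) (e := e) (M := A) a (x := x) h

lemma mul_jw_eq {x : A} (a : ℕ) (h : ∀ s, s + 1 < a → x * e s = 0) : x * jw q e a = x := by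
  induction a with
  | zero => simp
  | succ a ih =>
    rcases a with _ | a
    · simp
    · have h1 := ih fun s hs => h s (by omega)
      rw [jw_succ_succ, mul_sub, mul_smul_comm, ← mul_assoc, ← mul_assoc, h1, h a (by omega)]
      simp

/-- In the recursion the new term `p e p x` equals `e p x - (e p x - p e p x)`: the first part lies
in `S` because `e` maps into `S`, the second by induction. This reduces a tensor to a symmetrized
one modulo images of the generators. -/
lemma sub_jw_smul_mem (S : Submodule K M) (a : ℕ) (h : ∀ s, s + 1 < a → ∀ y : M, e s • y ∈ S)
    (x : M) : x - jw q e a • x ∈ S := by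
  induction a generalizing x with
  | zero => simp
  | succ a ih =>
    rcases a with _ | a
    · simp
    · have h1 := ih fun s hs => h s (by omega)
      have e1 := h1 x
      have e2 := h a (by omega) (jw q e (a + 1) • x)
      have e3 := h1 (e a • jw q e (a + 1) • x)
      have e4 := S.smul_mem (qInt q (a + 1) / qInt q (a + 2)) (S.sub_mem e2 e3)
      rw [jw_succ_succ, sub_smul, smul_assoc, mul_smul, mul_smul]
      convert S.add_mem e1 e4 using 1
      rw [sub_sub_cancel]
      abel

variable (h0 : q ≠ 0) (hq : ∀ j : ℕ, 1 ≤ j → qInt q j ≠ 0)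

include h0 hq in
-- One induction carries all four facts. The last one supplies the coefficient for which `e a` kills
-- the next projector from both sides; idempotence follows, since every term of the projector but
-- `1` is then killed. The last fact at the next stage is `[2]_q - [a+1]_q / [a+2]_q = [a+3]_q /
-- [a+2]_q`.
lemma jw_main (he : IsTL q e N) (a : ℕ) (ha : a ≤ N) :
    (jw q e (a + 1) * jw q e (a + 1) = jw q e (a + 1)) ∧
    (∀ s, s < a → e s * jw q e (a + 1) = 0) ∧ (∀ s, s < a → jw q e (a + 1) * e s = 0) ∧
    (a < N → e a * jw q e (a + 1) * e a =
      (qInt q (a + 2) / qInt q (a + 1)) • (jw q e a * e a)) := by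
  induction a with
  | zero =>
    refine ⟨by simp, by simp, by simp, fun h => ?_⟩
    simp [he.sq 0 h]
  | succ a ih =>
    obtain ⟨i1, i2, i3, i4⟩ := ih (by omega)
    replace i4 := i4 (by omega)
    set p := jw q e (a + 1) with hp
    have n1 := hq (a + 1) (by omega)
    have n2 := hq (a + 2) (by omega)
    have hcomm : Commute (e a) (jw q e a) :=
      commute_jw a fun s hs => (he.comm s a (by omega) (by omega)).symm
    have hpa : jw q e a * p = p := jw_mul_eq a fun s hs => i2 s (by omega)
    have hap : p * jw q e a = p := mul_jw_eq a fun s hs => i3 s (by omega)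
    have hc : (qInt q (a + 1) / qInt q (a + 2)) * (qInt q (a + 2) / qInt q (a + 1)) = 1 := by
      field_simp
    have j2 : ∀ s, s < a + 1 → e s * jw q e (a + 2) = 0 := by
      intro s hs
      rw [jw_succ_succ, ← hp, mul_sub, mul_smul_comm]
      rcases Nat.lt_succ_iff_lt_or_eq.mp hs with hs | rfl
      · rw [← mul_assoc, ← mul_assoc, i2 s hs]; simp
      · rw [← mul_assoc, ← mul_assoc, i4, smul_mul_assoc, smul_smul, hc, one_smul, ← hcomm.eq,
          mul_assoc, hpa, sub_self]
    have j3 : ∀ s, s < a + 1 → jw q e (a + 2) * e s = 0 := by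
      intro s hs
      rw [jw_succ_succ, ← hp, sub_mul, smul_mul_assoc]
      rcases Nat.lt_succ_iff_lt_or_eq.mp hs with hs | rfl
      · rw [mul_assoc _ p, i3 s hs]; simp
      · rw [mul_assoc, mul_assoc, ← mul_assoc (e s), i4, mul_smul_comm, smul_smul, hc, one_smul,
          ← mul_assoc, hap, sub_self]
    have hpp : jw q e (a + 2) * jw q e (a + 2) = jw q e (a + 2) :=
      jw_mul_eq (a + 2) fun s hs => j2 s (by omega)
    refine ⟨hpp, j2, j3, fun hN => ?_⟩
    have hcp : Commute (e (a + 1)) p :=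
      commute_jw (a + 1) fun s hs => (he.comm s (a + 1) (by omega) (by omega)).symm
    rw [jw_succ_succ, ← hp, mul_sub, sub_mul, mul_smul_comm, smul_mul_assoc]
    have t1 : e (a + 1) * p * e (a + 1) = qInt q 2 • (p * e (a + 1)) := by
      rw [hcp.eq, mul_assoc, he.sq _ (by omega), mul_smul_comm]
    have t2 : e (a + 1) * (p * e a * p) * e (a + 1) = p * e (a + 1) := by
      calc e (a + 1) * (p * e a * p) * e (a + 1)
          = (e (a + 1) * p) * e a * (p * e (a + 1)) := by simp only [mul_assoc]
        _ = (p * e (a + 1)) * e a * (e (a + 1) * p) := by rw [hcp.eq]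
        _ = p * (e (a + 1) * e a * e (a + 1)) * p := by simp only [mul_assoc]
        _ = p * (e (a + 1) * p) := by rw [he.down a (by omega), mul_assoc]
        _ = p * e (a + 1) := by rw [hcp.eq, ← mul_assoc, i1]
    rw [t1, t2, ← sub_smul]
    congr 1
    have := qInt_two_mul h0 (a + 1)
    field_simp
    linear_combination this

section

variable (he : IsTL q e N)

include h0 hq he

lemma jw_idem {a : ℕ} (ha : a ≤ N + 1) : jw q e a * jw q e a = jw q e a := by
  rcases a with _ | a
  · simp
  · exact (jw_main h0 hq he a (by omega)).1

lemma e_mul_jw {a s : ℕ} (ha : a ≤ N + 1) (hs : s + 1 < a) : e s * jw q e a = 0 := by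
  rcases a with _ | a
  · omega
  · exact (jw_main h0 hq he a (by omega)).2.1 s (by omega)

lemma jw_mul_e {a s : ℕ} (ha : a ≤ N + 1) (hs : s + 1 < a) : jw q e a * e s = 0 := by
  rcases a with _ | a
  · omega
  · exact (jw_main h0 hq he a (by omega)).2.2.1 s (by omega)

lemma e_jw_e {a : ℕ} (ha : a < N) :
    e a * jw q e (a + 1) * e a = (qInt q (a + 2) / qInt q (a + 1)) • (jw q e a * e a) :=
  (jw_main h0 hq he a (by omega)).2.2.2 ha

lemma jw_mul_jw {a b : ℕ} (hab : b ≤ a) (ha : a ≤ N + 1) : jw q e b * jw q e a = jw q e a :=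
  jw_mul_eq b fun _ _ => e_mul_jw h0 hq he ha (by omega)

lemma jw_mul_jw' {a b : ℕ} (hab : b ≤ a) (ha : a ≤ N + 1) : jw q e a * jw q e b = jw q e a :=
  mul_jw_eq b fun _ _ => jw_mul_e h0 hq he ha (by omega)

/-- The Jones--Wenzl projector only depends on the set of generators. -/
lemma jw_eq_jw {e' : ℕ → A} {N' a : ℕ} (he' : IsTL q e' N') (ha : a ≤ N + 1) (ha' : a ≤ N' + 1)
    (h : ∀ s, s + 1 < a → ∃ t, t + 1 < a ∧ e s = e' t)
    (h' : ∀ s, s + 1 < a → ∃ t, t + 1 < a ∧ e' s = e t) : jw q e a = jw q e' a := by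
  have h1 : jw q e a * jw q e' a = jw q e' a := jw_mul_eq a fun s hs => by
    obtain ⟨t, ht, hst⟩ := h s hs
    rw [hst, e_mul_jw h0 hq he' ha' ht]
  have h2 : jw q e a * jw q e' a = jw q e a := mul_jw_eq a fun s hs => by
    obtain ⟨t, ht, hst⟩ := h' s hs
    rw [hst, jw_mul_e h0 hq he ha ht]
  rw [← h1, h2]

/-- Reversing the strands permutes the generators, and the projector depends only on their set. This
turns the right-handed recursion into the left-handed one. -/
lemma jw_reverse {a : ℕ} (ha : a ≤ N) : jw q (fun s => e (a - 1 - s)) (a + 1) = jw q e (a + 1) := by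
  refine (jw_eq_jw h0 hq he (he.mono ha).reverse (by omega) le_rfl (fun s hs => ?_)
    fun s hs => ?_).symm
  · exact ⟨a - 1 - s, by omega, by congr 1; omega⟩
  · exact ⟨a - 1 - s, by omega, by congr 1⟩

/-- The left-handed recursion for the Jones--Wenzl projectors. -/
lemma jw_left {a : ℕ} (ha : a ≤ N) : jw q e (a + 1) =
    jw q (fun s => e (1 + s)) a - (qInt q a / qInt q (a + 1)) •
      (jw q (fun s => e (1 + s)) a * e 0 * jw q (fun s => e (1 + s)) a) := by
  rcases a with _ | a
  · simp
  · rw [← jw_reverse h0 hq he ha, jw_succ_succ]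
    have : jw q (fun s => e (a + 1 - 1 - s)) (a + 1) = jw q (fun s => e (1 + s)) (a + 1) := by
      have hs := he.shift (l := 1) (N' := a) (by omega)
      rw [← jw_reverse h0 hq hs le_rfl]
      exact jw_congr _ fun s hs => by congr 1; omega
    rw [this]
    simp

end

end JonesWenzl

end BraidedIndex

namespace BraidedIndex

/-! ### Single clasp expansions and the eigenvalue of the middle generator -/

section Clasp

variable {K A M : Type*} [Field K] [Ring A] [Algebra K A]
  [AddCommGroup M] [Module K M] [Module A M] [IsScalarTower K A M]

/-- The product `e l * e (l + 1) * ⋯ * e (l + t - 1)`. -/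
def chain (e : ℕ → A) (l : ℕ) : ℕ → A
  | 0 => 1
  | t + 1 => chain e l t * e (l + t)

/-- The factor of the left-handed single clasp expansion of a Jones--Wenzl projector. -/
def claspLeft (q : K) (e : ℕ → A) : ℕ → ℕ → A
  | _, 0 => 1
  | l, a + 1 => 1 - (qInt q a / qInt q (a + 1)) • (e l * claspLeft q e (l + 1) a)

/-- The factor of the right-handed single clasp expansion of a Jones--Wenzl projector. -/
def claspRight (q : K) (e : ℕ → A) : ℕ → A
  | 0 => 1
  | a + 1 => 1 - (qInt q a / qInt q (a + 1)) • (e (a - 1) * claspRight q e a)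

variable {q : K} {e : ℕ → A} {N : ℕ}

@[simp] lemma chain_zero (l : ℕ) : chain e l 0 = 1 := rfl

lemma chain_succ (l t : ℕ) : chain e l (t + 1) = chain e l t * e (l + t) := rfl

lemma chain_add (l s t : ℕ) : chain e l (s + t) = chain e l s * chain e (l + s) t := by
  induction t with
  | zero => simp
  | succ t ih => rw [← add_assoc, chain_succ, ih, chain_succ, mul_assoc, add_assoc]

lemma chain_succ' (l t : ℕ) : chain e l (t + 1) = e l * chain e (l + 1) t := by
  rw [add_comm t 1, chain_add]
  simp [chain]

lemma commute_chain {x : A} (l t : ℕ) (h : ∀ s, s < t → Commute x (e (l + s))) :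
    Commute x (chain e l t) := by
  induction t with
  | zero => simp
  | succ t ih => exact (ih fun s hs => h s (by omega)).mul_right (h t (by omega))

lemma claspLeft_smul_eq {x : M} (l a : ℕ) (h : ∀ s, s + 1 < a → e (l + s) • x = 0) :
    claspLeft q e l a • x = x := by
  induction a generalizing l with
  | zero => simp [claspLeft]
  | succ a ih =>
    rcases a with _ | a
    · simp [claspLeft]
    · rw [claspLeft, sub_smul, smul_assoc, mul_smul, ih (l + 1) fun s hs => by
        rw [add_assoc, add_comm 1]; exact h (s + 1) (by omega)]
      have := h 0 (by omega)
      simp only [add_zero] at this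
      simp [this]

lemma claspRight_smul_eq {x : M} (a : ℕ) (h : ∀ s, s + 1 < a → e s • x = 0) :
    claspRight q e a • x = x := by
  induction a with
  | zero => simp [claspRight]
  | succ a ih =>
    rcases a with _ | a
    · simp [claspRight]
    · rw [claspRight, sub_smul, smul_assoc, mul_smul, ih fun s hs => h s (by omega)]
      simp [h a (by omega)]

section

variable (h0 : q ≠ 0) (hq : ∀ j : ℕ, 1 ≤ j → qInt q j ≠ 0) (he : IsTL q e N)

include h0 hq he

/-- In the term `P e P` of the left-handed recursion, the second `P` is expanded by induction as
`P'` times a clasp factor. Now `P'` commutes with `e l` and is absorbed by the first `P`, so only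
one projector remains. -/
lemma jw_eq_mul_claspLeft (l a : ℕ) (h : l + a ≤ N) : jw q (fun s => e (l + s)) (a + 1) =
    jw q (fun s => e (l + 1 + s)) a * claspLeft q e l (a + 1) := by
  induction a generalizing l with
  | zero => simp [claspLeft]
  | succ a ih =>
    have h1 := jw_left h0 hq (he.shift (l := l) (N' := a + 1) (by omega)) le_rfl
    simp only [← add_assoc, add_zero] at h1
    rw [h1]
    have h2 := ih (l + 1) (by omega)
    set P := jw q (fun s => e (l + 1 + s)) (a + 1)
    set P' := jw q (fun s => e (l + 1 + 1 + s)) a with hP'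
    have hc : Commute (e l) P' :=
      commute_jw _ fun s hs => he.comm _ _ (by omega) (by omega)
    have hPP : P * P' = P := mul_jw_eq _ fun s hs => by
      have : P * e (l + 1 + (s + 1)) = 0 := jw_mul_e h0 hq
        (he.shift (l := l + 1) (N' := a) (by omega)) (a := a + 1) (s := s + 1) le_rfl (by omega)
      rwa [show l + 1 + (s + 1) = l + 1 + 1 + s by omega] at this
    rw [claspLeft, mul_sub, mul_one, mul_smul_comm]
    congr 2
    calc P * e l * P = P * e l * (P' * claspLeft q e (l + 1) (a + 1)) := by rw [← h2]
      _ = P * (e l * P') * claspLeft q e (l + 1) (a + 1) := by simp only [mul_assoc]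
      _ = (P * P') * (e l * claspLeft q e (l + 1) (a + 1)) := by
        rw [hc.eq]; simp only [mul_assoc]
      _ = _ := by rw [hPP]

lemma jw_eq_mul_claspRight (a : ℕ) (h : a ≤ N) :
    jw q e (a + 1) = jw q e a * claspRight q e (a + 1) := by
  induction a with
  | zero => simp [claspRight]
  | succ a ih =>
    have h2 := ih (by omega)
    have hc : Commute (e a) (jw q e a) :=
      commute_jw a fun s hs => (he.comm s a (by omega) (by omega)).symm
    have hPP : jw q e (a + 1) * jw q e a = jw q e (a + 1) :=
      jw_mul_jw' h0 hq he (by omega) (by omega)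
    rw [jw_succ_succ, claspRight, mul_sub, mul_one, mul_smul_comm]
    congr 2
    calc jw q e (a + 1) * e a * jw q e (a + 1)
        = jw q e (a + 1) * e a * (jw q e a * claspRight q e (a + 1)) := by rw [← h2]
      _ = jw q e (a + 1) * (e a * jw q e a) * claspRight q e (a + 1) := by simp only [mul_assoc]
      _ = (jw q e (a + 1) * jw q e a) * (e a * claspRight q e (a + 1)) := by
        rw [hc.eq]; simp only [mul_assoc]
      _ = _ := by rw [hPP]; rfl

omit h0 hq he in
/-- The relations satisfied by a vector `y` obtained from a highest weight vector on `κ + r`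
strands by inserting `j + 1` nested cups after the first `κ` strands. -/
structure IsNested (q : K) (e : ℕ → A) (κ j r : ℕ) (y : M) : Prop where
  center : e (κ + j) • y = qInt q 2 • y
  mirror : ∀ s p, s + p = j → 1 ≤ s → e (κ + p) • y = e (κ + j + s) • y
  left : ∀ s, s + 1 < κ → e s • y = 0
  right : ∀ s, s + 1 < r → e (κ + 2 * j + 2 + s) • y = 0
  outer : ∀ s, s + 1 = κ → 1 ≤ r → e s • e (κ + 2 * j + 1) • y = 0

variable {κ j r : ℕ} {y : M}

omit h0 in
-- A generator left of the innermost cup commutes with the chain, reaches `y`, and can be replaced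
-- there by its mirror image on the right. Back at the chain, the relation `e e' e = e` deletes two
-- of its links.
lemma IsNested.e_smul_chain (hy : IsNested q e κ j r y) {s p w : ℕ} (hsp : s + p = j)
    (hN : κ + j + 1 + s + w < N) :
    e (κ + p) • chain e (κ + j + 1) (s + 1 + w) • y =
      chain e (κ + j + 1) s • chain e (κ + j + s + 2) w • y := by
  rcases s with _ | s
  · obtain rfl : p = j := by omega
    have h2 := hq 2 (by omega)
    have hy' : y = (qInt q 2)⁻¹ • e (κ + p) • y := by
      rw [hy.center, smul_smul, inv_mul_cancel₀ h2, one_smul]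
    have hc : Commute (e (κ + p)) (chain e (κ + p + 2) w) :=
      commute_chain _ _ fun s hs => he.comm _ _ (by omega) (by omega)
    rw [chain_add]
    simp only [zero_add, chain_succ, chain_zero, one_mul, add_zero, one_smul]
    -- On `y` a trailing `e (κ + p)` only costs the invertible factor `[2]_q`, so `e e' e = e`
    -- applies although just one such generator stands in front of the chain.
    have key : e (κ + p) * (e (κ + p + 1) * chain e (κ + p + 1 + 1) w) * e (κ + p) =
        chain e (κ + p + 2) w * e (κ + p) := by
      calc _ = e (κ + p) * e (κ + p + 1) * (chain e (κ + p + 2) w * e (κ + p)) := by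
            simp only [mul_assoc]
        _ = e (κ + p) * e (κ + p + 1) * e (κ + p) * chain e (κ + p + 2) w := by
            rw [← hc.eq]; simp only [mul_assoc]
        _ = _ := by rw [he.up _ (by omega), hc.eq]
    have e1 := congrArg (fun x => (qInt q 2)⁻¹ • (x • y)) key
    simp only [mul_smul] at e1
    rw [hy.center] at e1
    rw [mul_smul]
    simpa only [smul_comm (_ : A) (qInt q 2), smul_smul, inv_mul_cancel₀ h2, one_smul,
      smul_algebra_smul_comm] using e1
  · have hc1 : Commute (e (κ + p)) (chain e (κ + j + 1) (s + 1 + 1 + w)) :=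
      commute_chain _ _ fun u hu => he.comm _ _ (by omega) (by omega)
    have hc2 : Commute (e (κ + j + (s + 1))) (chain e (κ + j + (s + 1) + 2) w) :=
      commute_chain _ _ fun u hu => he.comm _ _ (by omega) (by omega)
    rw [← mul_smul, hc1.eq, mul_smul, hy.mirror _ _ hsp (by omega), ← mul_smul, ← mul_smul]
    congr 1
    have hch : chain e (κ + j + 1) (s + 1 + 1 + w) = chain e (κ + j + 1) s *
        (e (κ + j + (s + 1)) * e (κ + j + (s + 1) + 1)) * chain e (κ + j + (s + 1) + 2) w := by
      rw [chain_add, chain_succ, chain_succ]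
      rw [show κ + j + 1 + s = κ + j + (s + 1) by omega,
        show κ + j + 1 + (s + 1) = κ + j + (s + 1) + 1 by omega,
        show κ + j + 1 + (s + 1 + 1) = κ + j + (s + 1) + 2 by omega]
      simp only [mul_assoc]
    rw [hch, chain_succ]
    calc _ = chain e (κ + j + 1) s * (e (κ + j + (s + 1)) * e (κ + j + (s + 1) + 1)) *
          (chain e (κ + j + (s + 1) + 2) w * e (κ + j + (s + 1))) := by simp only [mul_assoc]
      _ = chain e (κ + j + 1) s * (e (κ + j + (s + 1)) * e (κ + j + (s + 1) + 1) *
          e (κ + j + (s + 1))) * chain e (κ + j + (s + 1) + 2) w := by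
        rw [← hc2.eq]; simp only [mul_assoc]
      _ = _ := by
        rw [he.up _ (by omega), show κ + j + 1 + s = κ + j + (s + 1) by omega]

/-- Expanding the clasp one generator at a time, every intermediate term contains some `e (κ + j +
s) • y`, which equals a mirror generator on `y` and is killed by the left projector. Only `y` and
the longest chain survive. -/
lemma IsNested.left_smul_claspLeft (hy : IsNested q e κ j r y) (hN : κ + 2 * j + r + 1 ≤ N)
    {d s : ℕ} (hds : s + d = j + 1) (hs : 1 ≤ s) :
    jw q e (κ + j + 1) • claspLeft q e (κ + j + s) (r + d + 1) • y =
      jw q e (κ + j + 1) • (y + ((-1) ^ (d + 1) * qInt q r / qInt q (r + d + 1)) •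
        chain e (κ + j + s) (d + 1) • y) := by
  have sc : ∀ (a : A) (c : K) (x : M), a • c • x = c • a • x := fun a c x =>
    smul_algebra_smul_comm c a x
  induction d generalizing s with
  | zero =>
    obtain rfl : s = j + 1 := by omega
    rw [claspLeft, sub_smul, one_smul, smul_assoc, mul_smul, claspLeft_smul_eq _ _ fun u hu => by
      have := hy.right u (by omega)
      rwa [show κ + 2 * j + 2 + u = κ + j + (j + 1) + 1 + u by omega] at this]
    simp [chain, sub_eq_add_neg, neg_div]
  | succ d ih =>
    have h1 := ih (s := s + 1) (by omega) (by omega)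
    have hc : Commute (jw q e (κ + j + 1)) (e (κ + j + s)) :=
      (commute_jw _ fun u hu => (he.comm _ _ (by omega) (by omega)).symm).symm
    have h2 : jw q e (κ + j + 1) • e (κ + j + s) • y = 0 := by
      rw [← hy.mirror s (j - s) (by omega) hs, ← mul_smul,
        jw_mul_e h0 hq he (by omega) (by omega), zero_smul]
    rw [claspLeft, sub_smul, one_smul, smul_assoc, mul_smul, smul_sub, smul_add]
    simp only [sc]
    rw [← mul_smul (jw q e _) (e _) (claspLeft _ _ _ _ • y), hc.eq, mul_smul,
      add_assoc (κ + j) s 1, ← add_assoc r d 1, h1, ← mul_smul (e _), ← hc.eq, mul_smul, smul_add, smul_add, h2, zero_add,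
      chain_succ' (κ + j + s), mul_smul]
    simp only [sc, smul_smul]
    rw [sub_eq_add_neg, ← neg_smul]
    congr 2
    have n1 := hq (r + d + 1) (by omega)
    have n2 := hq (r + (d + 1) + 1) (by omega)
    rw [← add_assoc] at n2
    field_simp
    ring

/-- This is the counterpart for the left projector: at each stage the term `1` of the clasp leaves a
generator that commutes out of the chain and dies on the right projector. At `p = 0` the conditions
`left` and `outer` make the rest of the clasp act trivially. -/
lemma IsNested.claspRight_smul_chain (hy : IsNested q e κ j r y) (hN : κ + 2 * j + r + 1 ≤ N)
    (hr : 1 ≤ r) {s p : ℕ} (hsp : s + p = j) :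
    jw q (fun s => e (κ + j + 2 + s)) (r + j) •
        e (κ + p) • claspRight q e (κ + p + 1) • chain e (κ + j + 1) (j + 1) • y =
      ((-1) ^ p * qInt q (κ + 1) / qInt q (κ + p + 1)) •
        jw q (fun s => e (κ + j + 2 + s)) (r + j) • chain e (κ + j + 1) s • y := by
  have sc : ∀ (a : A) (c : K) (x : M), a • c • x = c • a • x := fun a c x =>
    smul_algebra_smul_comm c a x
  induction p generalizing s with
  | zero =>
    obtain rfl : s = j := by omega
    have h1 : ∀ u, u < κ → e u • chain e (κ + s + 1) (s + 1) • y = 0 := by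
      intro u hu
      rcases Nat.lt_or_ge (u + 1) κ with h | h
      · rw [← mul_smul, (commute_chain (x := e u) _ _ fun w hw =>
          he.comm _ _ (by omega) (by omega)).eq, mul_smul, hy.left u h, smul_zero]
      · rw [chain_succ, mul_smul, ← mul_smul (e u), (commute_chain (x := e u) _ _ fun w hw =>
          he.comm _ _ (by omega) (by omega)).eq, mul_smul,
          show κ + s + 1 + s = κ + 2 * s + 1 by omega, hy.outer u (by omega) hr, smul_zero]
    rw [claspRight_smul_eq _ fun u hu => h1 u (by omega),
      show s + 1 = s + 1 + 0 by omega,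
      hy.e_smul_chain hq he (p := 0) (by omega) (by omega)]
    have n1 := hq (κ + 1) (by omega)
    simp [n1]
  | succ p ih =>
    have h1 := ih (s := s + 1) (by omega)
    set P := jw q (fun s => e (κ + j + 2 + s)) (r + j) with hP
    have hc : Commute (e (κ + (p + 1))) P :=
      commute_jw _ fun u hu => he.comm _ _ (by omega) (by omega)
    have h2 : P • e (κ + (p + 1)) • chain e (κ + j + 1) (j + 1) • y = 0 := by
      have hc2 : Commute (e (κ + j + s + 2)) (chain e (κ + j + 1) s) :=
        commute_chain _ _ fun u hu => (he.comm _ _ (by omega) (by omega)).symm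
      have hPe : P * e (κ + j + s + 2) = 0 := by
        have : P * e (κ + j + 2 + s) = 0 := jw_mul_e h0 hq
          (he.shift (l := κ + j + 2) (N' := r + j - 1) (by omega)) (a := r + j) (s := s) (by omega)
          (by omega)
        rwa [show κ + j + s + 2 = κ + j + 2 + s by omega]
      rw [show j + 1 = s + 1 + (p + 1) by omega,
        hy.e_smul_chain hq he hsp (by omega), chain_succ', mul_smul, ← mul_smul _ (e _),
        ← hc2.eq, mul_smul, ← mul_smul P, hPe, zero_smul]
    rw [claspRight, sub_smul, one_smul, smul_assoc, mul_smul, smul_sub, smul_sub, h2, zero_sub,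
      show κ + (p + 1) - 1 = κ + p by omega]
    simp only [sc]
    rw [← mul_smul P, ← hc.eq, mul_smul, ← add_assoc κ p 1, h1]
    simp only [sc]
    rw [← mul_smul (e _) P, add_assoc κ p 1, hc.eq, mul_smul]
    have h3 := hy.e_smul_chain hq he (w := 0) hsp (by omega)
    rw [add_zero, chain_zero, one_smul] at h3
    rw [h3, smul_smul, ← neg_smul, ← add_assoc κ p 1]
    congr 1
    have n1 := hq (κ + p + 1) (by omega)
    have n2 := hq (κ + p + 1 + 1) (by omega)
    field_simp
    ring

/-- The middle generator applied to `(P ⊗ P) y`. -/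
lemma IsNested.e_smul (hy : IsNested q e κ j r y) (hN : κ + 2 * j + r + 1 ≤ N) :
    e (κ + j) • jw q e (κ + j + 1) • jw q (fun s => e (κ + j + 1 + s)) (r + j + 1) • y =
      (qInt q (j + 1) * qInt q (κ + r + j + 2) / (qInt q (r + j + 1) * qInt q (κ + j + 1))) •
        jw q e (κ + j) • jw q (fun s => e (κ + j + 2 + s)) (r + j) • y := by
  have sc : ∀ (a : A) (c : K) (x : M), a • c • x = c • a • x := fun a c x =>
    smul_algebra_smul_comm c a x
  -- With `s = 1` and `d = j` the clasp expansion of the right projector leaves `y` and one chain of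
  -- length `j + 1`.
  have hcl := hy.left_smul_claspLeft h0 hq he hN (d := j) (s := 1) (by omega) le_rfl
  rw [jw_eq_mul_claspLeft h0 hq he _ _ (by omega), mul_smul]
  set L := jw q e (κ + j + 1) with hL
  set R := jw q (fun s => e (κ + j + 1 + 1 + s)) (r + j) with hR
  have hRL : Commute L R := commute_jw _ fun s hs =>
    (commute_jw _ fun t ht => (he.comm _ _ (by omega) (by omega)).symm).symm
  have hRL' : Commute (jw q e (κ + j)) R := commute_jw _ fun s hs =>
    (commute_jw _ fun t ht => (he.comm _ _ (by omega) (by omega)).symm).symm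
  have heR : Commute (e (κ + j)) R := commute_jw _ fun s hs => he.comm _ _ (by omega) (by omega)
  have heL : Commute (e (κ + j)) (jw q e (κ + j)) := commute_jw _ fun s hs =>
    (he.comm _ _ (by omega) (by omega)).symm
  have n0 := hq 2 (by omega)
  have n1 := hq (κ + j + 1) (by omega)
  have n2 := hq (r + j + 1) (by omega)
  -- Contribution of the term `y`: by `center`, `y` may be replaced by `e (κ + j) • y` up to
  -- `[2]_q`, which brings the partial trace formula `e_jw_e` into play.
  have hy1 : e (κ + j) • L • y = (qInt q (κ + j + 2) / qInt q (κ + j + 1)) • jw q e (κ + j) • y := by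
    have h1 := congrArg (fun x => x • y) (e_jw_e h0 hq he (a := κ + j) (by omega))
    simp only [smul_assoc, mul_smul, hy.center, sc] at h1
    rw [smul_comm (_ / _ : K) (qInt q 2)] at h1
    exact smul_right_injective M n0 h1
  rw [← mul_smul L R, hRL.eq, mul_smul, ← mul_smul (e _), heR.eq, mul_smul, hcl, smul_add,
    smul_add, smul_add, hy1]
  simp only [sc]
  rw [← mul_smul (jw q e _) R, hRL'.eq, mul_smul]
  -- The two contributions add up to `[κ+j+2]_q [r+j+1]_q - [r]_q [κ+1]_q` over `[r+j+1]_q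
  -- [κ+j+1]_q`, because their signs multiply to `-1`. This identity factors the numerator.
  have hid := qInt_mul_add h0 (κ + 1) r (j + 1)
  rw [show κ + 1 + (j + 1) = κ + j + 2 by omega, show r + (j + 1) = r + j + 1 by omega,
    show κ + 1 + r + (j + 1) = κ + r + j + 2 by omega] at hid
  rcases Nat.eq_zero_or_pos r with rfl | hr
  · simp only [qInt_zero, mul_zero, zero_div, zero_smul, add_zero, zero_add] at *
    congr 1
    rw [div_eq_div_iff n1 (mul_ne_zero n2 n1)]
    linear_combination qInt q (κ + j + 1) * hid
  · have hB := hy.claspRight_smul_chain h0 hq he hN hr (s := 0) (p := j) (by omega)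
    rw [chain_zero, one_smul] at hB
    have h2 : R • e (κ + j) • L • chain e (κ + j + 1) (j + 1) • y =
        ((-1) ^ j * qInt q (κ + 1) / qInt q (κ + j + 1)) • R • jw q e (κ + j) • y := by
      rw [hL, jw_eq_mul_claspRight h0 hq he _ (by omega), mul_smul, ← mul_smul (e _), heL.eq,
        mul_smul, ← mul_smul R, ← hRL'.eq, mul_smul, hB, ← mul_smul R, ← hRL'.eq, mul_smul]
      rw [sc]
    rw [h2, smul_smul (_ / qInt q (r + j + 1)) (_ : K), ← add_smul]
    congr 1
    have h1 : ((-1 : K) ^ j) ^ 2 = 1 := by rw [← pow_mul, mul_comm, pow_mul]; simp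
    field_simp
    rw [pow_succ]
    linear_combination hid - qInt q r * qInt q (κ + 1) * h1

end

end Clasp

end BraidedIndex

namespace BraidedIndex

/-! ### Cups, caps and one-site operators on infinite words -/

section Stable

/-- Functions of infinite words.  It contains all tensor powers of `V`, as functions which depend on
the first letters only. -/
abbrev Stab (K : Type*) (n : ℕ) : Type _ := (ℕ → Fin n) → K

variable {K : Type*} [Field K] {n : ℕ}

/-- Delete the letters `s` and `s + 1`. -/
def cut (s : ℕ) (c : ℕ → Fin n) : ℕ → Fin n := fun t => if t < s then c t else c (t + 2)

/-- Insert the letters `i` and `j` at the places `s` and `s + 1`. -/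
def ins (s : ℕ) (i j : Fin n) (c : ℕ → Fin n) : ℕ → Fin n := fun t =>
  if t < s then c t else if t = s then i else if t = s + 1 then j else c (t - 2)

/-- Insertion of the tensor `v` at the places `s` and `s + 1`. -/
def cupS (v : Matrix (Fin n) (Fin n) K) (s : ℕ) : Module.End K (Stab K n) where
  toFun W c := v (c s) (c (s + 1)) * W (cut s c)
  map_add' W W' := by funext c; simp [mul_add]
  map_smul' a W := by funext c; simp [mul_left_comm]

/-- Contraction of the places `s` and `s + 1` with the form `u`. -/
def capS (u : Matrix (Fin n) (Fin n) K) (s : ℕ) : Module.End K (Stab K n) where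
  toFun W c := ∑ i, ∑ j, u i j * W (ins s i j c)
  map_add' W W' := by funext c; simp [mul_add, Finset.sum_add_distrib]
  map_smul' a W := by funext c; simp [Finset.mul_sum, mul_left_comm]

/-- The operator `X` acting at the place `t`. -/
def siteS (t : ℕ) (X : Matrix (Fin n) (Fin n) K) : Module.End K (Stab K n) where
  toFun W c := ∑ i, W (Function.update c t i) * X i (c t)
  map_add' W W' := by funext c; simp [add_mul, Finset.sum_add_distrib]
  map_smul' a W := by funext c; simp [Finset.mul_sum, mul_assoc]

lemma cupS_apply (v : Matrix (Fin n) (Fin n) K) (s : ℕ) (W : Stab K n) (c : ℕ → Fin n) :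
    cupS v s W c = v (c s) (c (s + 1)) * W (cut s c) := rfl

lemma capS_apply (u : Matrix (Fin n) (Fin n) K) (s : ℕ) (W : Stab K n) (c : ℕ → Fin n) :
    capS u s W c = ∑ i, ∑ j, u i j * W (ins s i j c) := rfl

lemma siteS_apply (X : Matrix (Fin n) (Fin n) K) (t : ℕ) (W : Stab K n) (c : ℕ → Fin n) :
    siteS t X W c = ∑ i, W (Function.update c t i) * X i (c t) := rfl

@[simp] lemma ins_left (s : ℕ) (i j : Fin n) (c : ℕ → Fin n) : ins s i j c s = i := by simp [ins]

@[simp] lemma ins_right (s : ℕ) (i j : Fin n) (c : ℕ → Fin n) : ins s i j c (s + 1) = j := by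
  simp [ins]

lemma ins_of_lt {s t : ℕ} (h : t < s) (i j : Fin n) (c : ℕ → Fin n) : ins s i j c t = c t := by
  simp [ins, h]

lemma ins_add_two {s t : ℕ} (h : s ≤ t) (i j : Fin n) (c : ℕ → Fin n) :
    ins s i j c (t + 2) = c t := by
  simp only [ins]
  rw [if_neg (by omega), if_neg (by omega), if_neg (by omega)]
  simp

lemma cut_of_lt {s t : ℕ} (h : t < s) (c : ℕ → Fin n) : cut s c t = c t := by simp [cut, h]

lemma cut_of_le {s t : ℕ} (h : s ≤ t) (c : ℕ → Fin n) : cut s c t = c (t + 2) := by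
  simp [cut, h]

@[simp] lemma cut_ins (s : ℕ) (i j : Fin n) (c : ℕ → Fin n) : cut s (ins s i j c) = c := by
  funext t
  rcases lt_or_ge t s with h | h
  · rw [cut_of_lt h, ins_of_lt h]
  · rw [cut_of_le h, ins_add_two h]

lemma cut_succ_ins (s : ℕ) (i j : Fin n) (c : ℕ → Fin n) :
    cut (s + 1) (ins s i j c) = Function.update c s i := by
  funext t
  simp only [cut, ins, Function.update_apply]
  split_ifs <;> first | rfl | omega

lemma cut_ins_succ (s : ℕ) (i j : Fin n) (c : ℕ → Fin n) :
    cut s (ins (s + 1) i j c) = Function.update c s j := by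
  funext t
  simp only [cut, ins, Function.update_apply]
  split_ifs <;> first | rfl | omega

lemma ins_cut_comm {s t : ℕ} (h : s ≤ t) (i j : Fin n) (c : ℕ → Fin n) :
    cut (t + 2) (ins s i j c) = ins s i j (cut t c) := by
  funext x
  simp only [cut, ins]
  split_ifs <;> first | rfl | omega | (congr 1; omega)

lemma ins_cut_comm' {s t : ℕ} (h : s ≤ t) (i j : Fin n) (c : ℕ → Fin n) :
    cut s (ins (t + 2) i j c) = ins t i j (cut s c) := by
  funext x
  simp only [cut, ins]
  split_ifs <;> first | rfl | omega | (congr 1; omega)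

lemma cut_cut {s t : ℕ} (h : s ≤ t) (c : ℕ → Fin n) :
    cut s (cut (t + 2) c) = cut t (cut s c) := by
  funext x
  simp only [cut]
  split_ifs <;> first | rfl | omega

lemma ins_ins {s t : ℕ} (h : s ≤ t) (i j i' j' : Fin n) (c : ℕ → Fin n) :
    ins (t + 2) i' j' (ins s i j c) = ins s i j (ins t i' j' c) := by
  funext x
  simp only [ins]
  split_ifs <;> first | rfl | omega

lemma cut_update_of_lt {s t : ℕ} (h : t < s) (i : Fin n) (c : ℕ → Fin n) :
    cut s (Function.update c t i) = Function.update (cut s c) t i := by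
  funext x
  simp only [cut, Function.update_apply]
  split_ifs <;> first | rfl | omega

lemma cut_update_of_le {s t : ℕ} (h : s ≤ t) (i : Fin n) (c : ℕ → Fin n) :
    cut s (Function.update c (t + 2) i) = Function.update (cut s c) t i := by
  funext x
  simp only [cut, Function.update_apply]
  split_ifs <;> first | rfl | omega

lemma cut_update_left (s : ℕ) (i : Fin n) (c : ℕ → Fin n) :
    cut s (Function.update c s i) = cut s c := by
  funext x
  simp only [cut, Function.update_apply]
  split_ifs <;> first | rfl | omega

lemma cut_update_right (s : ℕ) (i : Fin n) (c : ℕ → Fin n) :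
    cut s (Function.update c (s + 1) i) = cut s c := by
  funext x
  simp only [cut, Function.update_apply]
  split_ifs <;> first | rfl | omega

lemma ins_update_of_lt {s t : ℕ} (h : t < s) (i j l : Fin n) (c : ℕ → Fin n) :
    Function.update (ins s i j c) t l = ins s i j (Function.update c t l) := by
  funext x
  simp only [ins, Function.update_apply]
  split_ifs <;> first | rfl | omega

lemma ins_update_of_le {s t : ℕ} (h : s ≤ t) (i j l : Fin n) (c : ℕ → Fin n) :
    Function.update (ins s i j c) (t + 2) l = ins s i j (Function.update c t l) := by
  funext x
  simp only [ins, Function.update_apply]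
  split_ifs <;> first | rfl | omega

lemma ins_update_left (s : ℕ) (i j l : Fin n) (c : ℕ → Fin n) :
    Function.update (ins s i j c) s l = ins s l j c := by
  funext x
  simp only [ins, Function.update_apply]
  split_ifs <;> first | rfl | omega

lemma ins_update_right (s : ℕ) (i j l : Fin n) (c : ℕ → Fin n) :
    Function.update (ins s i j c) (s + 1) l = ins s i l c := by
  funext x
  simp only [ins, Function.update_apply]
  split_ifs <;> first | rfl | omega

variable (u v X Y : Matrix (Fin n) (Fin n) K)

lemma siteS_smul_one (t : ℕ) (a : K) : siteS (n := n) t (a • (1 : Matrix (Fin n) (Fin n) K)) = a • 1 := by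
  ext W c
  simp [siteS_apply, Matrix.one_apply, mul_comm]

@[simp] lemma siteS_one (t : ℕ) : siteS (n := n) t (1 : Matrix (Fin n) (Fin n) K) = 1 := by
  simpa using siteS_smul_one (K := K) (n := n) t 1

lemma siteS_smul (t : ℕ) (a : K) : siteS t (a • X) = a • siteS t X := by
  ext W c
  simp [siteS_apply, Finset.mul_sum, mul_left_comm]

lemma siteS_add (t : ℕ) : siteS t (X + Y) = siteS t X + siteS t Y := by
  ext W c
  simp [siteS_apply, mul_add, Finset.sum_add_distrib]

lemma siteS_sub (t : ℕ) : siteS t (X - Y) = siteS t X - siteS t Y := by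
  ext W c
  simp [siteS_apply, mul_sub, Finset.sum_sub_distrib]

lemma siteS_sum {ι : Type*} (S : Finset ι) (f : ι → Matrix (Fin n) (Fin n) K) (t : ℕ) :
    siteS t (∑ x ∈ S, f x) = ∑ x ∈ S, siteS t (f x) :=
  map_sum (AddMonoidHom.mk' (siteS t) fun X Y => siteS_add X Y t) f S

lemma cupS_smul (s : ℕ) (a : K) : cupS (a • v) s = a • cupS v s := by
  ext W c
  simp [cupS_apply, mul_assoc]

lemma capS_smul (s : ℕ) (a : K) : capS (a • u) s = a • capS u s := by
  ext W c
  simp [capS_apply, mul_assoc, Finset.mul_sum]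

/-- The lower index of a matrix is the input, so composition of operators is the reversed matrix
product. -/
lemma siteS_mul (t : ℕ) : siteS t X * siteS t Y = siteS t (Y * X) := by
  ext W c
  simp only [Module.End.mul_apply, siteS_apply, Function.update_idem, Function.update_self,
    Matrix.mul_apply, Finset.mul_sum, Finset.sum_mul]
  rw [Finset.sum_comm]
  simp only [mul_assoc]

lemma capS_mul_cupS_self (s : ℕ) : capS u s * cupS v s = (∑ i, ∑ j, u i j * v i j) • 1 := by
  ext W c
  simp [capS_apply, cupS_apply, Finset.sum_mul, mul_assoc]

/-- A zigzag leaves one strand, on which it acts by a matrix product. It is scalar exactly when that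
product is. -/
lemma capS_mul_cupS_succ (s : ℕ) : capS u s * cupS v (s + 1) = siteS s (u * v) := by
  ext W c
  simp only [Module.End.mul_apply, capS_apply, cupS_apply, ins_right, cut_succ_ins, siteS_apply,
    Matrix.mul_apply, Finset.mul_sum]
  refine Finset.sum_congr rfl fun i _ => Finset.sum_congr rfl fun j _ => ?_
  rw [show s + 1 + 1 = s + 2 by rfl, ins_add_two le_rfl]
  ring

lemma capS_succ_mul_cupS (s : ℕ) :
    capS u (s + 1) * cupS v s = siteS s (v * u).transpose := by
  ext W c
  simp only [Module.End.mul_apply, capS_apply, cupS_apply, ins_left, cut_ins_succ, siteS_apply,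
    Matrix.mul_apply, Finset.mul_sum, Matrix.transpose_apply]
  rw [Finset.sum_comm]
  refine Finset.sum_congr rfl fun i _ => Finset.sum_congr rfl fun j _ => ?_
  rw [ins_of_lt (by omega)]
  ring

/-- A cup moves all later places by two. The same shift appears in every exchange relation below. -/
lemma cupS_mul_cupS (v' : Matrix (Fin n) (Fin n) K) {s t : ℕ} (h : s ≤ t) :
    cupS v (t + 2) * cupS v' s = cupS v' s * cupS v t := by
  ext W c
  simp only [Module.End.mul_apply, cupS_apply]
  rw [cut_of_lt (by omega), cut_of_lt (by omega), cut_of_le h, cut_of_le (by omega), cut_cut h,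
    show t + 1 + 2 = t + 2 + 1 by rfl]
  ring

lemma capS_mul_capS (u' : Matrix (Fin n) (Fin n) K) {s t : ℕ} (h : s ≤ t) :
    capS u s * capS u' (t + 2) = capS u' t * capS u s := by
  ext W c
  simp only [Module.End.mul_apply, capS_apply, Finset.mul_sum]
  have : ∀ F : Fin n → Fin n → Fin n → Fin n → K, ∑ i, ∑ j, ∑ k, ∑ l, F i j k l =
      ∑ k, ∑ l, ∑ i, ∑ j, F i j k l := fun F => by
    calc _ = ∑ i, ∑ k, ∑ j, ∑ l, F i j k l := Finset.sum_congr rfl fun i _ => Finset.sum_comm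
      _ = ∑ k, ∑ i, ∑ j, ∑ l, F i j k l := Finset.sum_comm
      _ = ∑ k, ∑ i, ∑ l, ∑ j, F i j k l := Finset.sum_congr rfl fun k _ =>
        Finset.sum_congr rfl fun i _ => Finset.sum_comm
      _ = _ := Finset.sum_congr rfl fun k _ => Finset.sum_comm
  rw [this]
  refine Finset.sum_congr rfl fun i _ => Finset.sum_congr rfl fun j _ =>
    Finset.sum_congr rfl fun k _ => Finset.sum_congr rfl fun l _ => ?_
  rw [ins_ins h]
  ring

lemma capS_mul_cupS_of_le {s t : ℕ} (h : s ≤ t) :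
    capS u s * cupS v (t + 2) = cupS v t * capS u s := by
  ext W c
  simp only [Module.End.mul_apply, capS_apply, cupS_apply, Finset.mul_sum]
  refine Finset.sum_congr rfl fun i _ => Finset.sum_congr rfl fun j _ => ?_
  rw [show t + 2 + 1 = t + 1 + 2 by rfl, ins_add_two h, ins_add_two (by omega), ins_cut_comm h]
  ring

lemma capS_mul_cupS_of_ge {s t : ℕ} (h : s ≤ t) :
    capS u (t + 2) * cupS v s = cupS v s * capS u t := by
  ext W c
  simp only [Module.End.mul_apply, capS_apply, cupS_apply, Finset.mul_sum]
  refine Finset.sum_congr rfl fun i _ => Finset.sum_congr rfl fun j _ => ?_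
  rw [ins_of_lt (by omega), ins_of_lt (by omega), ins_cut_comm' h]
  ring

lemma siteS_mul_cupS_of_lt {s t : ℕ} (h : t < s) :
    siteS t X * cupS v s = cupS v s * siteS t X := by
  ext W c
  simp only [Module.End.mul_apply, siteS_apply, cupS_apply, Finset.mul_sum]
  refine Finset.sum_congr rfl fun i _ => ?_
  rw [cut_update_of_lt h, Function.update_of_ne (by omega), Function.update_of_ne (by omega),
    cut_of_lt h]
  ring

lemma siteS_mul_cupS_of_le {s t : ℕ} (h : s ≤ t) :
    siteS (t + 2) X * cupS v s = cupS v s * siteS t X := by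
  ext W c
  simp only [Module.End.mul_apply, siteS_apply, cupS_apply, Finset.mul_sum]
  refine Finset.sum_congr rfl fun i _ => ?_
  rw [cut_update_of_le h, Function.update_of_ne (by omega), Function.update_of_ne (by omega),
    cut_of_le h]
  ring

lemma siteS_mul_cupS_left (s : ℕ) : siteS s X * cupS v s = cupS (X.transpose * v) s := by
  ext W c
  simp only [Module.End.mul_apply, siteS_apply, cupS_apply, Finset.sum_mul, Matrix.mul_apply,
    Matrix.transpose_apply]
  refine Finset.sum_congr rfl fun i _ => ?_
  rw [cut_update_left, Function.update_self, Function.update_of_ne (by omega)]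
  ring

lemma siteS_mul_cupS_right (s : ℕ) : siteS (s + 1) X * cupS v s = cupS (v * X) s := by
  ext W c
  simp only [Module.End.mul_apply, siteS_apply, cupS_apply, Finset.sum_mul, Matrix.mul_apply]
  refine Finset.sum_congr rfl fun i _ => ?_
  rw [cut_update_right, Function.update_self, Function.update_of_ne (by omega)]
  ring

lemma capS_mul_siteS_of_lt {s t : ℕ} (h : t < s) :
    capS u s * siteS t X = siteS t X * capS u s := by
  ext W c
  simp only [Module.End.mul_apply, siteS_apply, capS_apply, Finset.mul_sum, Finset.sum_mul]
  rw [Finset.sum_comm_cycle]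
  refine Finset.sum_congr rfl fun i _ => Finset.sum_congr rfl fun j _ =>
    Finset.sum_congr rfl fun k _ => ?_
  rw [ins_update_of_lt h, ins_of_lt h]
  ring

lemma capS_mul_siteS_of_le {s t : ℕ} (h : s ≤ t) :
    capS u s * siteS (t + 2) X = siteS t X * capS u s := by
  ext W c
  simp only [Module.End.mul_apply, siteS_apply, capS_apply, Finset.mul_sum, Finset.sum_mul]
  rw [Finset.sum_comm_cycle]
  refine Finset.sum_congr rfl fun i _ => Finset.sum_congr rfl fun j _ =>
    Finset.sum_congr rfl fun k _ => ?_
  rw [ins_update_of_le h, ins_add_two h]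
  ring

lemma capS_mul_siteS_left (s : ℕ) : capS u s * siteS s X = capS (X * u) s := by
  ext W c
  simp only [Module.End.mul_apply, siteS_apply, capS_apply, Finset.sum_mul, Matrix.mul_apply,
    Finset.mul_sum, ins_update_left, ins_left]
  rw [Finset.sum_comm_cycle]
  refine Finset.sum_congr rfl fun i _ => ?_
  rw [Finset.sum_comm]
  refine Finset.sum_congr rfl fun j _ => Finset.sum_congr rfl fun k _ => ?_
  ring

lemma capS_mul_siteS_right (s : ℕ) :
    capS u s * siteS (s + 1) X = capS (u * X.transpose) s := by
  ext W c
  simp only [Module.End.mul_apply, siteS_apply, capS_apply, Finset.sum_mul, Matrix.mul_apply,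
    Finset.mul_sum, ins_update_right, ins_right, Matrix.transpose_apply]
  refine Finset.sum_congr rfl fun i _ => ?_
  rw [Finset.sum_comm]
  refine Finset.sum_congr rfl fun j _ => Finset.sum_congr rfl fun k _ => ?_
  ring

end Stable

end BraidedIndex

namespace BraidedIndex

/-! ### Subalgebras generated by the Temperley--Lieb generators, and their normal form -/

section Semiconj

variable {K A : Type*} [Field K] [Ring A] [Algebra K A] {q : K}

/-- Cups renumber the generators instead of commuting with all of them, so projectors have to be
carried from one sequence of generators to another. -/
lemma semiconjBy_jw {x : A} {e e' : ℕ → A} (a : ℕ)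
    (h : ∀ s, s + 1 < a → SemiconjBy x (e s) (e' s)) :
    SemiconjBy x (jw q e a) (jw q e' a) := by
  induction a with
  | zero => simp
  | succ a ih =>
    rcases a with _ | a
    · simp
    · have h1 := ih fun s hs => h s (by omega)
      have h2 := (h1.mul_right (h a (by omega))).mul_right h1
      rw [jw_succ_succ, jw_succ_succ]
      refine h1.sub_right ?_
      rw [SemiconjBy, mul_smul_comm, h2.eq, smul_mul_assoc]

lemma map_jw {B : Type*} [Ring B] [Algebra K B] (f : A →ₐ[K] B) (e : ℕ → A) (a : ℕ) :
    f (jw q e a) = jw q (fun s => f (e s)) a := by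
  induction a with
  | zero => simp
  | succ a ih => simp [jw, ih]

/-- The subalgebra generated by `e s` for `s + 1 < a`. -/
def tlAlg (K : Type*) {A : Type*} [Field K] [Ring A] [Algebra K A] (e : ℕ → A) (a : ℕ) :
    Subalgebra K A :=
  Algebra.adjoin K {x | ∃ s, s + 1 < a ∧ x = e s}

variable {e : ℕ → A} {N : ℕ}

lemma e_mem_tlAlg {a s : ℕ} (h : s + 1 < a) : e s ∈ tlAlg K e a :=
  Algebra.subset_adjoin ⟨s, h, rfl⟩

lemma tlAlg_mono {a b : ℕ} (h : a ≤ b) : tlAlg K e a ≤ tlAlg K e b :=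
  Algebra.adjoin_mono fun _ ⟨s, hs, hx⟩ => ⟨s, by omega, hx⟩

lemma jw_mem_tlAlg {a b : ℕ} (h : a ≤ b) : jw q e a ∈ tlAlg K e b := by
  induction a with
  | zero => exact one_mem _
  | succ a ih =>
    rcases a with _ | a
    · rw [jw_one]; exact one_mem _
    · have h1 := ih (by omega)
      rw [jw_succ_succ]
      exact sub_mem h1 (Subalgebra.smul_mem _ (mul_mem (mul_mem h1 (e_mem_tlAlg (by omega))) h1) _)

lemma commute_of_mem_tlAlg {x y : A} {a : ℕ} (h : ∀ s, s + 1 < a → Commute y (e s))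
    (hx : x ∈ tlAlg K e a) : Commute y x := by
  induction hx using Algebra.adjoin_induction with
  | mem x hx => obtain ⟨s, hs, rfl⟩ := hx; exact h s hs
  | algebraMap r => exact (Algebra.commutes r y).symm
  | add x z _ _ h1 h2 => exact h1.add_right h2
  | mul x z _ _ h1 h2 => exact h1.mul_right h2

/-- The projector kills every generator, so only the constant term of an element acts on it. This
plays the role of Schur's lemma for partial traces. -/
lemma jw_mul_mem_tlAlg (h0 : q ≠ 0) (hq : ∀ j : ℕ, 1 ≤ j → qInt q j ≠ 0) (he : IsTL q e N)
    {x : A} {a : ℕ} (ha : a ≤ N + 1) (hx : x ∈ tlAlg K e a) :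
    ∃ c : K, jw q e a * x = c • jw q e a := by
  induction hx using Algebra.adjoin_induction with
  | mem x hx =>
    obtain ⟨s, hs, rfl⟩ := hx
    exact ⟨0, by rw [jw_mul_e h0 hq he ha hs, zero_smul]⟩
  | algebraMap r => exact ⟨r, by rw [← Algebra.commutes, Algebra.smul_def]⟩
  | add x z _ _ h1 h2 =>
    obtain ⟨c, hc⟩ := h1
    obtain ⟨d, hd⟩ := h2
    exact ⟨c + d, by rw [mul_add, hc, hd, add_smul]⟩
  | mul x z _ _ h1 h2 =>
    obtain ⟨c, hc⟩ := h1
    obtain ⟨d, hd⟩ := h2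
    exact ⟨c * d, by rw [← mul_assoc, hc, smul_mul_assoc, hd, smul_smul]⟩

/-- The span of `x * e (a - 1) * y` for `x` and `y` in the algebra on `a` strands. -/
def tlSpan (K : Type*) {A : Type*} [Field K] [Ring A] [Algebra K A] (e : ℕ → A) (a : ℕ) :
    Submodule K A :=
  Submodule.span K {z | ∃ x ∈ tlAlg K e (a + 1), ∃ y ∈ tlAlg K e (a + 1), z = x * e a * y}

lemma mul_tlSpan {a : ℕ} {x z : A} (hx : x ∈ tlAlg K e (a + 1)) (hz : z ∈ tlSpan K e a) :
    x * z ∈ tlSpan K e a := by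
  induction hz using Submodule.span_induction with
  | mem z hz =>
    obtain ⟨x', hx', y', hy', rfl⟩ := hz
    exact Submodule.subset_span ⟨x * x', mul_mem hx hx', y', hy', by simp only [mul_assoc]⟩
  | zero => simp
  | add z w _ _ h1 h2 => rw [mul_add]; exact add_mem h1 h2
  | smul c z _ h => rw [mul_smul_comm]; exact Submodule.smul_mem _ _ h

lemma tlSpan_mul {a : ℕ} {x z : A} (hx : x ∈ tlAlg K e (a + 1)) (hz : z ∈ tlSpan K e a) :
    z * x ∈ tlSpan K e a := by
  induction hz using Submodule.span_induction with
  | mem z hz =>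
    obtain ⟨x', hx', y', hy', rfl⟩ := hz
    exact Submodule.subset_span ⟨x', hx', y' * x, mul_mem hy' hx, by simp only [mul_assoc]⟩
  | zero => simp
  | add z w _ _ h1 h2 => rw [add_mul]; exact add_mem h1 h2
  | smul c z _ h => rw [smul_mul_assoc]; exact Submodule.smul_mem _ _ h

/-- Writing `A` for the algebra on `a + 1` strands and `e` for `e a`, the hypothesis `e A e ⊆ A e`
makes the span of `A` and `A e A` closed under multiplication, and it contains all generators. -/
lemma tlAlg_le_of_e_mul_e {a : ℕ}
    (h : ∀ y ∈ tlAlg K e (a + 1), ∃ z ∈ tlAlg K e (a + 1), e a * y * e a = z * e a) :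
    ∀ x ∈ tlAlg K e (a + 2), x ∈ (tlAlg K e (a + 1)).toSubmodule ⊔ tlSpan K e a := by
  have hsq : ∀ x ∈ tlSpan K e a, ∀ y ∈ tlSpan K e a, x * y ∈ tlSpan K e a := by
    intro x hx y hy
    induction hx using Submodule.span_induction with
    | mem x hx =>
      obtain ⟨b, hb, c, hc, rfl⟩ := hx
      induction hy using Submodule.span_induction with
      | mem y hy =>
        obtain ⟨b', hb', c', hc', rfl⟩ := hy
        obtain ⟨z, hz, hcz⟩ := h (c * b') (mul_mem hc hb')
        refine Submodule.subset_span ⟨b * z, mul_mem hb hz, c', hc', ?_⟩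
        calc b * e a * c * (b' * e a * c') = b * (e a * (c * b') * e a) * c' := by
              simp only [mul_assoc]
          _ = _ := by rw [hcz]; simp only [mul_assoc]
      | zero => simp
      | add z w _ _ h1 h2 => rw [mul_add]; exact add_mem h1 h2
      | smul c z _ h => rw [mul_smul_comm]; exact Submodule.smul_mem _ _ h
    | zero => simp
    | add z w _ _ h1 h2 => rw [add_mul]; exact add_mem h1 h2
    | smul c z _ h => rw [smul_mul_assoc]; exact Submodule.smul_mem _ _ h
  intro x hx
  induction hx using Algebra.adjoin_induction with
  | mem x hx =>
    obtain ⟨s, hs, rfl⟩ := hx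
    rcases Nat.lt_or_ge s a with h1 | h1
    · exact Submodule.mem_sup_left (e_mem_tlAlg (by omega))
    · obtain rfl : s = a := by omega
      exact Submodule.mem_sup_right
        (Submodule.subset_span ⟨1, one_mem _, 1, one_mem _, by simp⟩)
  | algebraMap r => exact Submodule.mem_sup_left (Subalgebra.algebraMap_mem _ r)
  | add x z _ _ h1 h2 => exact add_mem h1 h2
  | mul x z _ _ h1 h2 =>
    obtain ⟨x1, hx1, x2, hx2, rfl⟩ := Submodule.mem_sup.mp h1
    obtain ⟨z1, hz1, z2, hz2, rfl⟩ := Submodule.mem_sup.mp h2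
    rw [add_mul, mul_add, add_assoc]
    refine add_mem (Submodule.mem_sup_left (Subalgebra.mul_mem _ hx1 hz1)) (Submodule.mem_sup_right ?_)
    refine add_mem (mul_tlSpan hx1 hz2) ?_
    rw [mul_add]
    exact add_mem (tlSpan_mul hz1 hx2) (hsq _ hx2 _ hz2)

/-- By induction `y` has a normal form with at most one occurrence of `e a`. Everything else in it
commutes with `e (a + 1)`, so `e (a + 1)` meets itself either directly or around one `e a`, and the
Temperley--Lieb relations finish. -/
lemma e_mul_e_of_mem_tlAlg (he : IsTL q e N) (a : ℕ) (ha : a < N) :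
    ∀ y ∈ tlAlg K e (a + 1), ∃ z ∈ tlAlg K e (a + 1), e a * y * e a = z * e a := by
  induction a with
  | zero =>
    intro y hy
    have hc : Commute (e 0) y := commute_of_mem_tlAlg (fun s hs => by omega) hy
    refine ⟨qInt q 2 • y, Subalgebra.smul_mem _ hy _, ?_⟩
    rw [hc.eq, mul_assoc, he.sq 0 ha, mul_smul_comm, smul_mul_assoc]
  | succ a ih =>
    intro y hy
    have hcomm : ∀ y ∈ tlAlg K e (a + 1), Commute (e (a + 1)) y := fun y hy =>
      commute_of_mem_tlAlg (fun s hs => (he.comm s (a + 1) (by omega) ha).symm) hy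
    obtain ⟨y1, hy1, y2, hy2, rfl⟩ := Submodule.mem_sup.mp
      (tlAlg_le_of_e_mul_e (ih (by omega)) y hy)
    suffices h : ∃ z ∈ tlAlg K e (a + 1), e (a + 1) * y2 * e (a + 1) = z * e (a + 1) by
      obtain ⟨z, hz, hz2⟩ := h
      refine ⟨qInt q 2 • y1 + z, tlAlg_mono (by omega) (add_mem (Subalgebra.smul_mem _ hy1 _) hz),
        ?_⟩
      rw [mul_add, add_mul, hz2, add_mul, (hcomm y1 hy1).eq, mul_assoc, he.sq _ ha, mul_smul_comm,
        smul_mul_assoc]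
    clear hy
    induction hy2 using Submodule.span_induction with
    | mem y hy =>
      obtain ⟨x, hx, z, hz, rfl⟩ := hy
      refine ⟨x * z, mul_mem hx hz, ?_⟩
      calc e (a + 1) * (x * e a * z) * e (a + 1) =
            (e (a + 1) * x) * e a * (z * e (a + 1)) := by simp only [mul_assoc]
        _ = x * (e (a + 1) * e a * e (a + 1)) * z := by
            rw [(hcomm x hx).eq, ← (hcomm z hz).eq]; simp only [mul_assoc]
        _ = _ := by rw [he.down _ ha, mul_assoc, (hcomm z hz).eq, mul_assoc]
    | zero => exact ⟨0, zero_mem _, by simp⟩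
    | add z w _ _ h1 h2 =>
      obtain ⟨z1, hz1, e1⟩ := h1
      obtain ⟨z2, hz2, e2⟩ := h2
      exact ⟨z1 + z2, add_mem hz1 hz2, by rw [mul_add, add_mul, e1, e2, add_mul]⟩
    | smul c z _ h1 =>
      obtain ⟨z1, hz1, e1⟩ := h1
      exact ⟨c • z1, Subalgebra.smul_mem _ hz1 _, by
        rw [mul_smul_comm, smul_mul_assoc, e1, smul_mul_assoc]⟩

/-- The normal form of the elements of the Temperley--Lieb algebra. -/
lemma tlAlg_normal (he : IsTL q e N) (a : ℕ) (ha : a < N) :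
    ∀ x ∈ tlAlg K e (a + 2), x ∈ (tlAlg K e (a + 1)).toSubmodule ⊔ tlSpan K e a :=
  tlAlg_le_of_e_mul_e (e_mul_e_of_mem_tlAlg he a ha)

end Semiconj

/-! ### Temperley--Lieb relations from a cup and a cap; nested cups -/

section Snake

variable {K : Type*} [Field K] {n : ℕ}

/-- `u` and `v` are a cap and a cup which straighten up to the sign `ε`. -/
structure IsSnake (q : K) (u v : Matrix (Fin n) (Fin n) K) (ε : K) : Prop where
  loop : ∑ i, ∑ j, u i j * v i j = qInt q 2
  cap_cup : u * v = ε • 1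
  cup_cap : v * u = ε • 1
  sign : ε * ε = 1

/-- The Temperley--Lieb generator acting at the places `s` and `s + 1`. -/
def tl (u v : Matrix (Fin n) (Fin n) K) (s : ℕ) : Module.End K (Stab K n) :=
  cupS v s * capS u s

/-- Insertion of `i` nested cups after the first `κ` letters. -/
def nest (v : Matrix (Fin n) (Fin n) K) (κ : ℕ) : ℕ → Module.End K (Stab K n)
  | 0 => 1
  | i + 1 => cupS v (κ + i) * nest v κ i

/-- Contraction with `i` nested caps after the first `κ` letters. -/
def capNest (u : Matrix (Fin n) (Fin n) K) (κ : ℕ) : ℕ → Module.End K (Stab K n)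
  | 0 => 1
  | i + 1 => capNest u κ i * capS u (κ + i)

@[simp] lemma nest_zero (v : Matrix (Fin n) (Fin n) K) (κ : ℕ) : nest v κ 0 = 1 := rfl

lemma nest_succ (v : Matrix (Fin n) (Fin n) K) (κ i : ℕ) :
    nest v κ (i + 1) = cupS v (κ + i) * nest v κ i := rfl

@[simp] lemma capNest_zero (u : Matrix (Fin n) (Fin n) K) (κ : ℕ) : capNest u κ 0 = 1 := rfl

lemma capNest_succ (u : Matrix (Fin n) (Fin n) K) (κ i : ℕ) :
    capNest u κ (i + 1) = capNest u κ i * capS u (κ + i) := rfl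

variable {u v : Matrix (Fin n) (Fin n) K}

lemma tl_mul_cupS_of_le {s t : ℕ} (h : s ≤ t) :
    tl u v (t + 2) * cupS v s = cupS v s * tl u v t := by
  rw [tl, tl, mul_assoc, capS_mul_cupS_of_ge _ _ h, ← mul_assoc, cupS_mul_cupS _ _ h, mul_assoc]

lemma tl_mul_cupS_of_lt {s t : ℕ} (h : t + 2 ≤ s) :
    tl u v t * cupS v s = cupS v s * tl u v t := by
  obtain ⟨s, rfl⟩ : ∃ s', s = s' + 2 := ⟨s - 2, by omega⟩
  rw [tl, mul_assoc, capS_mul_cupS_of_le _ _ (by omega), ← mul_assoc,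
    ← cupS_mul_cupS _ _ (by omega), mul_assoc]

lemma capS_mul_tl_of_lt {s t : ℕ} (h : t + 2 ≤ s) :
    capS u s * tl u v t = tl u v t * capS u s := by
  obtain ⟨s, rfl⟩ : ∃ s', s = s' + 2 := ⟨s - 2, by omega⟩
  rw [tl, ← mul_assoc, capS_mul_cupS_of_ge _ _ (by omega), mul_assoc,
    ← capS_mul_capS _ _ (by omega), mul_assoc]

lemma tl_mul_nest_of_le {κ t : ℕ} (h : κ ≤ t) (i : ℕ) :
    tl u v (t + 2 * i) * nest v κ i = nest v κ i * tl u v t := by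
  induction i with
  | zero => simp
  | succ i ih =>
    rw [nest_succ, ← mul_assoc, show t + 2 * (i + 1) = t + 2 * i + 2 by omega,
      tl_mul_cupS_of_le (by omega), mul_assoc, ih, mul_assoc]

lemma tl_mul_nest_of_lt {κ t : ℕ} (h : t + 2 ≤ κ) (i : ℕ) :
    tl u v t * nest v κ i = nest v κ i * tl u v t := by
  induction i with
  | zero => simp
  | succ i ih =>
    rw [nest_succ, ← mul_assoc, tl_mul_cupS_of_lt (by omega), mul_assoc, ih, mul_assoc]

namespace IsSnake

variable {q ε : K} (h : IsSnake q u v ε)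

include h

lemma cap_cup_self (s : ℕ) : capS u s * cupS v s = qInt q 2 • 1 := by
  rw [capS_mul_cupS_self, h.loop]

lemma cap_cup_succ (s : ℕ) : capS u s * cupS v (s + 1) = ε • 1 := by
  rw [capS_mul_cupS_succ, h.cap_cup, siteS_smul_one]

lemma cap_succ_cup (s : ℕ) : capS u (s + 1) * cupS v s = ε • 1 := by
  rw [capS_succ_mul_cupS, h.cup_cap, Matrix.transpose_smul, Matrix.transpose_one, siteS_smul_one]

/-- Each cubic relation contains two zigzags of opposite types, contributing `ε * ε = 1`; the sign
itself never matters here. -/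
lemma isTL (N : ℕ) : IsTL q (tl u v) N := by
  refine ⟨fun s _ => ?_, fun s _ => ?_, fun s _ => ?_, fun s t hst _ => ?_⟩
  · rw [tl, mul_assoc, ← mul_assoc (capS u s), h.cap_cup_self]
    simp
  · calc tl u v s * tl u v (s + 1) * tl u v s = cupS v s * (capS u s * cupS v (s + 1)) *
          (capS u (s + 1) * cupS v s) * capS u s := by simp only [tl, mul_assoc]
      _ = _ := by
        rw [h.cap_cup_succ, h.cap_succ_cup]
        simp [smul_smul, h.sign, tl]
  · calc tl u v (s + 1) * tl u v s * tl u v (s + 1) = cupS v (s + 1) *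
          (capS u (s + 1) * cupS v s) * (capS u s * cupS v (s + 1)) * capS u (s + 1) := by
          simp only [tl, mul_assoc]
      _ = _ := by
        rw [h.cap_cup_succ, h.cap_succ_cup]
        simp [smul_smul, h.sign, tl]
  · rw [Commute, SemiconjBy]
    conv_lhs => rw [tl.eq_1 u v t]
    rw [← mul_assoc, tl_mul_cupS_of_lt hst, mul_assoc, ← capS_mul_tl_of_lt hst, ← mul_assoc, tl.eq_1 u v t]

lemma capS_eq_zero (hq2 : qInt q 2 ≠ 0) {s : ℕ} {W : Stab K n} (hW : tl u v s W = 0) :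
    capS u s W = 0 := by
  have h1 := congrArg (capS u s) hW
  rw [tl, ← Module.End.mul_apply, ← mul_assoc, h.cap_cup_self] at h1
  simpa [hq2] using h1

lemma cupS_injective (hq2 : qInt q 2 ≠ 0) (s : ℕ) : Function.Injective (cupS v s) := by
  intro W W' hW
  have h1 := congrArg (capS u s) hW
  simp only [← Module.End.mul_apply, h.cap_cup_self] at h1
  exact smul_right_injective _ hq2 h1

lemma tl_center_mul_nest (κ j : ℕ) :
    tl u v (κ + j) * nest v κ (j + 1) = qInt q 2 • nest v κ (j + 1) := by
  rw [nest_succ, ← mul_assoc, tl, mul_assoc (cupS v _), h.cap_cup_self]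
  simp

/-- Induction peels off the innermost cup. In the base case both generators straighten against that
cup with the same factor `ε`, and the two resulting positions of the cup agree after the next cup is
inserted. -/
lemma tl_mirror_mul_nest {κ j s p : ℕ} (hsp : s + p = j) (hs : 1 ≤ s) :
    tl u v (κ + p) * nest v κ (j + 1) = tl u v (κ + j + s) * nest v κ (j + 1) := by
  induction j generalizing s with
  | zero => omega
  | succ j ih =>
    rw [nest_succ, ← mul_assoc, ← mul_assoc]
    rcases Nat.lt_or_ge 1 s with h1 | h1
    · obtain ⟨s, rfl⟩ : ∃ s', s = s' + 1 := ⟨s - 1, by omega⟩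
      rw [tl_mul_cupS_of_lt (by omega), mul_assoc, ih (s := s) (by omega) (by omega),
        show κ + (j + 1) + (s + 1) = κ + j + s + 2 by omega, tl_mul_cupS_of_le (by omega),
        mul_assoc]
    · obtain rfl : s = 1 := by omega
      obtain rfl : p = j := by omega
      rw [nest_succ, ← mul_assoc, ← mul_assoc]
      congr 1
      have e1 : tl u v (κ + p) * cupS v (κ + (p + 1)) = ε • cupS v (κ + p) := by
        rw [tl, mul_assoc, ← add_assoc, h.cap_cup_succ]
        simp
      have e2 : tl u v (κ + (p + 1) + 1) * cupS v (κ + (p + 1)) =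
          ε • cupS v (κ + (p + 1) + 1) := by
        rw [tl, mul_assoc, h.cap_succ_cup]
        simp
      rw [e1, e2, smul_mul_assoc, smul_mul_assoc, show κ + (p + 1) + 1 = κ + p + 2 by omega,
        cupS_mul_cupS _ _ le_rfl]

/-- The generator at the right edge of the nest followed by the one at its left edge joins the two
strands adjacent to the nest. The composite thus begins with a cap on these strands, which kills a
symmetrized tensor. -/
lemma tl_outer_mul_nest (κ j : ℕ) : ∃ X : Module.End K (Stab K n),
    tl u v κ * (tl u v (κ + 1 + 2 * j + 1) * nest v (κ + 1) (j + 1)) = X * capS u κ := by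
  induction j with
  | zero =>
    refine ⟨ε • (cupS v κ * cupS v κ), ?_⟩
    simp only [nest_succ, nest_zero, mul_one, mul_zero, add_zero]
    conv_lhs => rw [tl.eq_1 u v (κ + 1 + 1)]
    rw [mul_assoc, h.cap_succ_cup, mul_smul_comm, mul_one, mul_smul_comm, tl, mul_assoc,
      capS_mul_cupS_of_le _ _ le_rfl, smul_mul_assoc, mul_assoc]
  | succ j ih =>
    obtain ⟨X, hX⟩ := ih
    refine ⟨cupS v (κ + 1 + (j + 1)) * X, ?_⟩
    rw [nest_succ, ← mul_assoc (tl u v (κ + 1 + _ + 1)),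
      show κ + 1 + 2 * (j + 1) + 1 = κ + 1 + 2 * j + 1 + 2 by omega,
      tl_mul_cupS_of_le (by omega), mul_assoc, ← mul_assoc, tl_mul_cupS_of_lt (by omega),
      mul_assoc, hX, mul_assoc]

lemma isNested (hq2 : qInt q 2 ≠ 0) {κ r : ℕ} (j : ℕ) {w : Stab K n}
    (hw : ∀ s, s + 1 < κ + r → tl u v s w = 0) :
    IsNested q (tl u v) κ j r (nest v κ (j + 1) w) := by
  refine ⟨?_, fun s p hsp hs => ?_, fun s hs => ?_, fun s hs => ?_, fun s hs hr => ?_⟩ <;>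
    simp only [Module.End.smul_def, ← Module.End.mul_apply]
  · rw [h.tl_center_mul_nest]; rfl
  · rw [h.tl_mirror_mul_nest hsp hs]
  · rw [tl_mul_nest_of_lt (by omega), Module.End.mul_apply, hw s (by omega), map_zero]
  · rw [show κ + 2 * j + 2 + s = κ + s + 2 * (j + 1) by omega, tl_mul_nest_of_le (by omega),
      Module.End.mul_apply, hw _ (by omega), map_zero]
  · subst hs
    obtain ⟨X, hX⟩ := h.tl_outer_mul_nest s j
    rw [hX, Module.End.mul_apply, h.capS_eq_zero hq2 (hw s (by omega)), map_zero]

/-- The element `P ⊗ P` applied to nested cups does not vanish. -/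
lemma nest_injective (h0 : q ≠ 0) (hq : ∀ j : ℕ, 1 ≤ j → qInt q j ≠ 0) {κ r : ℕ} (i : ℕ)
    {w : Stab K n} (hw : ∀ s, s + 1 < κ + r → tl u v s w = 0)
    (hz : jw q (tl u v) (κ + i) (jw q (fun s => tl u v (κ + i + s)) (r + i) (nest v κ i w)) = 0) :
    w = 0 := by
  induction i with
  | zero =>
    have e1 : jw q (fun s => tl u v (κ + 0 + s)) (r + 0) • w = w :=
      jw_smul_eq _ fun s hs => hw _ (by omega)
    have e2 : jw q (tl u v) (κ + 0) • w = w := jw_smul_eq _ fun s hs => hw _ (by omega)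
    simp only [Module.End.smul_def] at e1 e2
    rwa [nest_zero, Module.End.one_apply, e1, e2] at hz
  | succ j ih =>
    -- Applying the middle generator trades the projectors for smaller ones, with a coefficient
    -- nonzero at generic `q`.
    have h1 := (h.isNested (hq 2 (by omega)) j hw).e_smul h0 hq (h.isTL (κ + 2 * j + r + 1)) le_rfl
    simp only [Module.End.smul_def] at h1
    rw [← add_assoc, ← add_assoc] at hz
    rw [hz, map_zero] at h1
    have hc : qInt q (j + 1) * qInt q (κ + r + j + 2) /
        (qInt q (r + j + 1) * qInt q (κ + j + 1)) ≠ 0 :=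
      div_ne_zero (mul_ne_zero (hq _ (by omega)) (hq _ (by omega)))
        (mul_ne_zero (hq _ (by omega)) (hq _ (by omega)))
    have h2 := (smul_eq_zero.mp h1.symm).resolve_left hc
    -- The innermost cup slides out of the smaller projectors; cancelling it leaves the statement
    -- with one cup fewer.
    have s1 : SemiconjBy (cupS v (κ + j)) (jw q (fun s => tl u v (κ + j + s)) (r + j))
        (jw q (fun s => tl u v (κ + j + 2 + s)) (r + j)) :=
      semiconjBy_jw _ fun s hs => by
        rw [SemiconjBy, show κ + j + 2 + s = κ + j + s + 2 by omega, tl_mul_cupS_of_le (by omega)]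
    have s2 : SemiconjBy (cupS v (κ + j)) (jw q (tl u v) (κ + j)) (jw q (tl u v) (κ + j)) :=
      semiconjBy_jw _ fun s hs => by rw [SemiconjBy, tl_mul_cupS_of_lt (by omega)]
    apply ih
    apply h.cupS_injective (hq 2 (by omega)) (κ + j)
    rw [map_zero, ← h2, nest_succ]
    simp only [← Module.End.mul_apply]
    rw [← mul_assoc, s2.eq, mul_assoc, ← mul_assoc (cupS v _), s1.eq, mul_assoc]

/-! ### Partial closures -/

/-- By the normal form the last generator occurs at most once. If it is absent the closed strand is
a loop, worth `[2]_q`; if present, two zigzags straighten and the generator disappears. -/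
lemma capS_mul_mul_cupS_mem {a : ℕ} {x : Module.End K (Stab K n)}
    (hx : x ∈ tlAlg K (tl u v) (a + 1)) : capS u a * x * cupS v a ∈ tlAlg K (tl u v) a := by
  have hcap : ∀ y ∈ tlAlg K (tl u v) a, Commute (capS u a) y := fun y hy =>
    commute_of_mem_tlAlg (fun s hs => capS_mul_tl_of_lt (by omega)) hy
  have hcup : ∀ y ∈ tlAlg K (tl u v) a, Commute (cupS v a) y := fun y hy =>
    commute_of_mem_tlAlg (fun s hs => (tl_mul_cupS_of_lt (by omega)).symm) hy
  have key : ∀ y ∈ tlAlg K (tl u v) a, capS u a * y * cupS v a ∈ tlAlg K (tl u v) a := by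
    intro y hy
    rw [(hcap y hy).eq, mul_assoc, h.cap_cup_self, mul_smul_comm, mul_one]
    exact Subalgebra.smul_mem _ hy _
  rcases a with _ | a
  · have : tlAlg K (tl u v) (0 + 1) ≤ tlAlg K (tl u v) 0 :=
      Algebra.adjoin_mono fun y ⟨s, hs, _⟩ => by omega
    exact key x (this hx)
  · obtain ⟨y, hy, z, hz, rfl⟩ := Submodule.mem_sup.mp
      (tlAlg_normal (h.isTL (a + 1)) a (by omega) x hx)
    rw [mul_add, add_mul]
    refine add_mem (key y hy) ?_
    clear hx
    induction hz using Submodule.span_induction with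
    | mem z hz =>
      obtain ⟨x', hx', y', hy', rfl⟩ := hz
      have : capS u (a + 1) * (x' * tl u v a * y') * cupS v (a + 1) = x' * y' := by
        calc _ = (capS u (a + 1) * x') * tl u v a * (y' * cupS v (a + 1)) := by
              simp only [mul_assoc]
          _ = x' * (capS u (a + 1) * cupS v a) * (capS u a * cupS v (a + 1)) * y' := by
              rw [(hcap x' hx').eq, ← (hcup y' hy').eq]; simp only [tl, mul_assoc]
          _ = _ := by
              rw [h.cap_cup_succ, h.cap_succ_cup]
              simp [smul_smul, h.sign]
      rw [this]
      exact mul_mem hx' hy'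
    | zero => simp
    | add z w _ _ h1 h2 => rw [mul_add, add_mul]; exact add_mem h1 h2
    | smul c z _ h => rw [mul_smul_comm, smul_mul_assoc]; exact Subalgebra.smul_mem _ h _

lemma closure_mem {k m : ℕ} {x : Module.End K (Stab K n)}
    (hx : x ∈ tlAlg K (tl u v) (k + m)) :
    capNest u k m * x * nest v k m ∈ tlAlg K (tl u v) k := by
  induction m generalizing x with
  | zero => simpa using hx
  | succ m ih =>
    have := ih (h.capS_mul_mul_cupS_mem hx)
    rw [capNest_succ, nest_succ]
    simpa only [mul_assoc] using this

/-- In the recursion the first term closes to a loop and the second straightens to `1`, giving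
`[2]_q - [a]_q / [a+1]_q = [a+2]_q / [a+1]_q`. -/
lemma capS_mul_jw_mul_cupS (h0 : q ≠ 0) (hq : ∀ j : ℕ, 1 ≤ j → qInt q j ≠ 0) (a : ℕ) :
    capS u a * jw q (tl u v) (a + 1) * cupS v a =
      (qInt q (a + 2) / qInt q (a + 1)) • jw q (tl u v) a := by
  have hcap : Commute (capS u a) (jw q (tl u v) a) :=
    commute_jw a fun s hs => capS_mul_tl_of_lt (by omega)
  have hcup : Commute (cupS v a) (jw q (tl u v) a) :=
    commute_jw a fun s hs => (tl_mul_cupS_of_lt (by omega)).symm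
  rcases a with _ | a
  · simp [h.cap_cup_self]
  · rw [jw_succ_succ, mul_sub, sub_mul, hcap.eq, mul_assoc, h.cap_cup_self, mul_smul_comm, mul_one,
      mul_smul_comm, smul_mul_assoc]
    have : capS u (a + 1) * (jw q (tl u v) (a + 1) * tl u v a * jw q (tl u v) (a + 1)) *
        cupS v (a + 1) = jw q (tl u v) (a + 1) := by
      calc _ = (capS u (a + 1) * jw q (tl u v) (a + 1)) * tl u v a *
            (jw q (tl u v) (a + 1) * cupS v (a + 1)) := by simp only [mul_assoc]
        _ = jw q (tl u v) (a + 1) * (capS u (a + 1) * cupS v a) *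
            (capS u a * cupS v (a + 1)) * jw q (tl u v) (a + 1) := by
            rw [hcap.eq, ← hcup.eq]; simp only [tl, mul_assoc]
        _ = jw q (tl u v) (a + 1) := by
            rw [h.cap_cup_succ, h.cap_succ_cup]
            simp only [mul_smul_comm, mul_one, smul_smul, h.sign, one_smul]
            exact jw_idem h0 hq (h.isTL a) le_rfl
    rw [this]
    refine (sub_smul _ _ _).symm.trans ?_
    congr 1
    have n2 := hq (a + 2) (by omega)
    have := qInt_two_mul h0 (a + 1)
    field_simp
    linear_combination this

/-- Closing the strands one after another produces the telescoping product of `[a+2]_q / [a+1]_q`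
for `a < m`. -/
lemma closure_jw (h0 : q ≠ 0) (hq : ∀ j : ℕ, 1 ≤ j → qInt q j ≠ 0) (m : ℕ) :
    capNest u 0 m * jw q (tl u v) m * nest v 0 m = qInt q (m + 1) • 1 := by
  induction m with
  | zero => simp
  | succ m ih =>
    rw [capNest_succ, nest_succ, zero_add]
    calc _ = capNest u 0 m * (capS u m * jw q (tl u v) (m + 1) * cupS v m) * nest v 0 m := by
          simp only [mul_assoc]
      _ = _ := by
          rw [h.capS_mul_jw_mul_cupS h0 hq, mul_smul_comm, smul_mul_assoc, ih, smul_smul]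
          congr 1
          have := hq (m + 1) (by omega)
          field_simp

end IsSnake

end Snake

end BraidedIndex

open scoped TensorProduct

namespace BraidedIndex

/-! ### Finite tensors and their operators as functions of infinite words -/

section Window

variable {K : Type*} [Field K] {n : ℕ}

/-- The letters `l, …, l + m - 1` of a word. -/
def win (l m : ℕ) (c : ℕ → Fin n) : Fin m → Fin n := fun s => c (l + s)

/-- Replace the letters `l, …, l + m - 1` of a word. -/
def subst (l m : ℕ) (a : Fin m → Fin n) (c : ℕ → Fin n) : ℕ → Fin n := fun t =>
  if h : l ≤ t ∧ t < l + m then a ⟨t - l, by omega⟩ else c t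

lemma subst_add {l m : ℕ} (a : Fin m → Fin n) (c : ℕ → Fin n) (s : Fin m) :
    subst l m a c (l + s) = a s := by
  have := s.2
  simp [subst]

lemma subst_of_lt {l m t : ℕ} (h : t < l) (a : Fin m → Fin n) (c : ℕ → Fin n) :
    subst l m a c t = c t := dif_neg (by omega)

@[simp] lemma win_subst (l m : ℕ) (a : Fin m → Fin n) (c : ℕ → Fin n) :
    win l m (subst l m a c) = a := by
  funext s
  exact subst_add a c s

@[simp] lemma subst_win (l m : ℕ) (c : ℕ → Fin n) : subst l m (win l m c) c = c := by
  funext t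
  simp only [subst, win]
  split_ifs with h
  · congr 1; omega
  · rfl

@[simp] lemma subst_subst (l m : ℕ) (a a' : Fin m → Fin n) (c : ℕ → Fin n) :
    subst l m a (subst l m a' c) = subst l m a c := by
  funext t
  simp only [subst]
  split_ifs <;> rfl

lemma subst_update (l m : ℕ) (a : Fin m → Fin n) (c : ℕ → Fin n) (s : Fin m) (i : Fin n) :
    subst l m (Function.update a s i) c = Function.update (subst l m a c) (l + s) i := by
  funext t
  have := s.2
  simp only [subst, Function.update_apply, Fin.ext_iff]
  split_ifs <;> first | rfl | omega

lemma subst_snoc (l m : ℕ) (a : Fin m → Fin n) (i : Fin n) (c : ℕ → Fin n) :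
    subst l (m + 1) (Fin.snoc (α := fun _ => Fin n) a i) c =
      subst l m a (Function.update c (l + m) i) := by
  funext t
  simp only [subst, Function.update_apply, Fin.snoc, Fin.castSucc, Fin.castLT]
  split_ifs <;> first | rfl | omega

lemma win_subst_of_disjoint {l m l' m' : ℕ} (h : l + m ≤ l' ∨ l' + m' ≤ l) (a : Fin m → Fin n)
    (c : ℕ → Fin n) : win l' m' (subst l m a c) = win l' m' c := by
  funext s
  have := s.2
  simp only [win, subst]
  rw [dif_neg (by omega)]

/-- An operator on `V^{⊗ m}` acting at the places `l, …, l + m - 1`. -/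
def ext (l m : ℕ) : Module.End K (Tens K n m) →ₐ[K] Module.End K (Stab K n) :=
  AlgHom.ofLinearMap
    { toFun := fun T =>
        { toFun := fun W c => T (fun a => W (subst l m a c)) (win l m c)
          map_add' := fun W W' => by
            funext c
            exact congrFun (T.map_add _ _) _
          map_smul' := fun a W => by
            funext c
            exact congrFun (T.map_smul a _) _ }
      map_add' := fun _ _ => rfl
      map_smul' := fun _ _ => rfl }
    (by
      ext W c
      simp)
    (fun S T => by
      ext W c
      simp)

lemma ext_apply (l m : ℕ) (T : Module.End K (Tens K n m)) (W : Stab K n) (c : ℕ → Fin n) :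
    ext l m T W c = T (fun a => W (subst l m a c)) (win l m c) := rfl

/-- A tensor as a function of infinite words. -/
def emb (m : ℕ) : Tens K n m →ₗ[K] Stab K n where
  toFun w c := w (win 0 m c)
  map_add' _ _ := rfl
  map_smul' _ _ := rfl

lemma emb_apply {m : ℕ} (w : Tens K n m) (c : ℕ → Fin n) : emb m w c = w (win 0 m c) := rfl

/-- The product of two tensors as a function of infinite words. -/
def pairEmb (k m : ℕ) : Tens K n k →ₗ[K] Tens K n m →ₗ[K] Stab K n :=
  LinearMap.mk₂ K (fun g f c => g (win 0 k c) * f (win k m c))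
    (fun _ _ _ => by funext c; simp [add_mul]) (fun _ _ _ => by funext c; simp [mul_assoc])
    (fun _ _ _ => by funext c; simp [mul_add]) (fun _ _ _ => by funext c; simp [mul_left_comm])

lemma pairEmb_apply {k m : ℕ} (g : Tens K n k) (f : Tens K n m) (c : ℕ → Fin n) :
    pairEmb k m g f c = g (win 0 k c) * f (win k m c) := rfl

lemma ext_emb {m : ℕ} (T : Module.End K (Tens K n m)) (w : Tens K n m) :
    ext 0 m T (emb m w) = emb m (T w) := by
  funext c
  simp [ext_apply, emb_apply]

lemma ext_pairEmb_left {k m : ℕ} (T : Module.End K (Tens K n k)) (g : Tens K n k)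
    (f : Tens K n m) : ext 0 k T (pairEmb k m g f) = pairEmb k m (T g) f := by
  funext c
  simp only [ext_apply, pairEmb_apply, win_subst]
  have : (fun a => g a * f (win k m (subst 0 k a c))) = f (win k m c) • g := by
    funext a
    rw [win_subst_of_disjoint (by omega)]
    simp [mul_comm]
  rw [this, map_smul]
  simp [mul_comm]

lemma ext_pairEmb_right {k m : ℕ} (T : Module.End K (Tens K n m)) (g : Tens K n k)
    (f : Tens K n m) : ext k m T (pairEmb k m g f) = pairEmb k m g (T f) := by
  funext c
  simp only [ext_apply, pairEmb_apply, win_subst]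
  have : (fun a => g (win 0 k (subst k m a c)) * f a) = g (win 0 k c) • f := by
    funext a
    rw [win_subst_of_disjoint (by omega)]
    simp
  rw [this, map_smul]
  simp

lemma emb_injective [Nonempty (Fin n)] (m : ℕ) : Function.Injective (emb (K := K) (n := n) m) := by
  intro w w' h
  funext a
  have := congrFun h (subst 0 m a fun _ => Classical.arbitrary _)
  simpa [emb_apply] using this

lemma ext_injective [Nonempty (Fin n)] (m : ℕ) :
    Function.Injective (ext (K := K) (n := n) 0 m) := by
  intro S T h
  refine LinearMap.ext fun w => emb_injective m ?_
  rw [← ext_emb, ← ext_emb, h]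

/-- The operator `X` acting on the tensor factor `s`. -/
def siteAt (N : ℕ) (s : Fin N) (X : Matrix (Fin n) (Fin n) K) : Module.End K (Tens K n N) where
  toFun w b := ∑ i : Fin n, w (Function.update b s i) * X i (b s)
  map_add' w w' := by funext b; simp [add_mul, Finset.sum_add_distrib]
  map_smul' a w := by funext b; simp [Finset.mul_sum, mul_assoc]

lemma ext_siteAt (l N : ℕ) (s : Fin N) (X : Matrix (Fin n) (Fin n) K) :
    ext l N (siteAt N s X) = siteS (l + s) X := by
  ext W c
  simp only [ext_apply, siteAt, LinearMap.coe_mk, AddHom.coe_mk, siteS_apply, subst_update,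
    subst_win]
  rfl

lemma firstSite_eq_siteAt {N : ℕ} (h : 0 < N) (X : Matrix (Fin n) (Fin n) K) :
    firstSite N X = siteAt N ⟨0, h⟩ X := by
  rw [firstSite, dif_pos h]
  rfl

lemma ext_firstSite (l : ℕ) {N : ℕ} (h : 0 < N) (X : Matrix (Fin n) (Fin n) K) :
    ext l N (firstSite N X) = siteS l X := by
  rw [firstSite_eq_siteAt h, ext_siteAt]
  simp

/-- The operator `X` acting at each of the places `l, …, l + m - 1`. -/
def powS (X : Matrix (Fin n) (Fin n) K) (l : ℕ) : ℕ → Module.End K (Stab K n)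
  | 0 => 1
  | m + 1 => siteS (l + m) X * powS X l m

lemma powS_apply (X : Matrix (Fin n) (Fin n) K) (l m : ℕ) (W : Stab K n) (c : ℕ → Fin n) :
    powS X l m W c = ∑ a : Fin m → Fin n, W (subst l m a c) * ∏ s, X (a s) (c (l + s)) := by
  induction m generalizing c with
  | zero =>
    have : ∀ a : Fin 0 → Fin n, subst l 0 a c = c := fun a => by
      funext t; exact dif_neg (by omega)
    simp [powS, this]
  | succ m ih =>
    rw [← (Fin.snocEquiv fun _ : Fin (m + 1) => Fin n).sum_comp, Fintype.sum_prod_type]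
    simp only [powS, Module.End.mul_apply, siteS_apply]
    refine Finset.sum_congr rfl fun i _ => ?_
    rw [ih, Finset.sum_mul]
    refine Finset.sum_congr rfl fun a _ => ?_
    change _ = W (subst l (m + 1) (Fin.snoc (α := fun _ => Fin n) a i) c) *
      ∏ s, X (Fin.snoc (α := fun _ => Fin n) a i s) (c (l + s))
    rw [Fin.prod_univ_castSucc, subst_snoc, mul_assoc]
    congr 2
    · refine Finset.prod_congr rfl fun s _ => ?_
      have := s.2
      rw [Function.update_of_ne (by omega)]
      simp
    · simp

lemma ext_tensPow (l m : ℕ) (X : Matrix (Fin n) (Fin n) K) :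
    ext l m (tensPow m X) = powS X l m := by
  ext W c
  rw [powS_apply]
  rfl

lemma nest_apply (v : Matrix (Fin n) (Fin n) K) (κ i : ℕ) (W : Stab K n) (c : ℕ → Fin n) :
    nest v κ i W c = (∏ t ∈ Finset.range i, v (c (κ + i - 1 - t)) (c (κ + i + t))) *
      W (fun t => if t < κ then c t else c (t + 2 * i)) := by
  induction i generalizing c with
  | zero => simp
  | succ i ih =>
    rw [nest_succ, Module.End.mul_apply, cupS_apply, ih, Finset.prod_range_succ']
    have h1 : ∀ t ∈ Finset.range i, v (cut (κ + i) c (κ + i - 1 - t)) (cut (κ + i) c (κ + i + t)) =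
        v (c (κ + (i + 1) - 1 - (t + 1))) (c (κ + (i + 1) + (t + 1))) := fun t ht => by
      rw [Finset.mem_range] at ht
      rw [cut_of_lt (by omega), cut_of_le (by omega)]
      congr 2 <;> omega
    have h2 : (fun t => if t < κ then cut (κ + i) c t else cut (κ + i) c (t + 2 * i)) =
        fun t => if t < κ then c t else c (t + 2 * (i + 1)) := by
      funext t
      split_ifs with h
      · rw [cut_of_lt (by omega)]
      · rw [cut_of_le (by omega)]; rfl
    rw [Finset.prod_congr rfl h1, h2]
    rw [show κ + (i + 1) - 1 - 0 = κ + i by omega, show κ + (i + 1) + 0 = κ + i + 1 by omega]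
    ring

/-- The entries of the braiding in terms of a cup and a cap. -/
def IsTLBraiding (q : K) (R : PairMat K n) (u v : Matrix (Fin n) (Fin n) K) : Prop :=
  ∀ i j k l, R (i, j) (k, l) = (if i = k ∧ j = l then q else 0) - u i j * v k l

lemma ins_cut (s : ℕ) (i j : Fin n) (c : ℕ → Fin n) :
    ins s i j (cut s c) = Function.update (Function.update c s i) (s + 1) j := by
  funext t
  simp only [ins, cut, Function.update_apply]
  split_ifs <;> first | rfl | omega | (congr 1; omega)

variable {q : K} {R : PairMat K n} {u v : Matrix (Fin n) (Fin n) K}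

lemma ext_braidAt (hR : IsTLBraiding q R u v) (l : ℕ) {m s : ℕ} (hs : s + 1 < m) :
    ext l m (braidAt R m s) = q • 1 - tl u v (l + s) := by
  ext W c
  rw [braidAt, dif_pos hs]
  simp only [ext_apply, LinearMap.coe_mk, AddHom.coe_mk, subst_update, subst_win, win,
    LinearMap.sub_apply, LinearMap.smul_apply, Module.End.one_apply, Pi.sub_apply, Pi.smul_apply,
    tl, Module.End.mul_apply, cupS_apply, capS_apply, ins_cut, smul_eq_mul, hR _ _ _ _, mul_sub,
    Finset.sum_sub_distrib, ite_and, mul_ite, mul_zero]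
  congr 1
  · rw [Finset.sum_eq_single (c (l + s))]
    · simp [← add_assoc, mul_comm]
    · intro b _ hb
      simp [hb]
    · simp
  · simp only [Finset.mul_sum, ← add_assoc]
    refine Finset.sum_congr rfl fun i _ => Finset.sum_congr rfl fun j _ => ?_
    ring

end Window

end BraidedIndex


namespace BraidedIndex

/-! ### Cup and cap of a rank-two Hecke symmetry; the matrices `B` and `C` -/

section Structure

variable {K : Type*} [Field K] {n : ℕ} {q ε : K} {R : PairMat K n}
  {u v : Matrix (Fin n) (Fin n) K}

lemma siteS_injective (t : ℕ) : Function.Injective (siteS (K := K) (n := n) t) := by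
  intro X Y h
  ext i j
  have := congrFun (congrFun (congrArg DFunLike.coe h) fun c => if c t = i then 1 else 0)
    fun _ => j
  simpa [siteS_apply] using this

lemma braidAt_two_apply (w : Tens K n 2) (b : Fin 2 → Fin n) :
    braidAt R 2 0 w b = ∑ i, ∑ j, w ![i, j] * R (i, j) (b 0, b 1) := by
  rw [braidAt, dif_pos (by omega)]
  simp only [LinearMap.coe_mk, AddHom.coe_mk]
  refine Finset.sum_congr rfl fun i _ => Finset.sum_congr rfl fun j _ => ?_
  congr 2
  funext s
  fin_cases s <;> rfl

/-- The Hecke relation puts the image of `q - R` inside the kernel of `q⁻¹ + R`, the line `K v`; the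
coefficients of `q - R` along `v` are the entries of the cap `u`. The eigenvalue `-q⁻¹` of `R` on
`v` fixes the loop value `q + q⁻¹`. -/
lemma exists_isTLBraiding (hR : IsHeckeSymmetry q R) (hrank : IsEvenOfRank q R 2)
    (hv : IsDeterminant q R v) :
    ∃ u : Matrix (Fin n) (Fin n) K, IsTLBraiding q R u v ∧
      ∑ i, ∑ j, u i j * v i j = qInt q 2 := by
  set T := braidAt R 2 0 with hT
  set w : Tens K n 2 := fun b => v (b 0) (b 1) with hw
  obtain ⟨hv0, hv1⟩ := hv
  have hw0 : w ≠ 0 := fun h => hv0 (by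
    ext i j
    exact congrFun h ![i, j])
  have hrk : Module.finrank K (Tens K n 2 ⧸ LinearMap.range (q⁻¹ • 1 + T)) = 1 := by
    have hS : (⨆ s : Fin (2 - 1), LinearMap.range (q⁻¹ • 1 + braidAt R 2 (s : ℕ))) =
        LinearMap.range (q⁻¹ • 1 + T) := by
      refine le_antisymm (iSup_le fun s => ?_) (le_iSup_of_le ⟨0, by omega⟩ le_rfl)
      have : (s : ℕ) = 0 := by omega
      rw [this]
    have h1 : Module.finrank K (Tens K n 2 ⧸
      (⨆ s : Fin (2 - 1), LinearMap.range (q⁻¹ • 1 + braidAt R 2 (s : ℕ)))) = 1 := hrank.1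
    rwa [hS] at h1
  -- An endomorphism of a finite-dimensional space has kernel and cokernel of equal dimension, and
  -- the cokernel here is `Λ₋²(V)`.
  have hker : Module.finrank K (LinearMap.ker (q⁻¹ • 1 + T)) = 1 := by
    have h1 := Submodule.finrank_quotient_add_finrank (LinearMap.range (q⁻¹ • 1 + T))
    have h2 := LinearMap.finrank_range_add_finrank_ker (q⁻¹ • 1 + T)
    omega
  have hwker : w ∈ LinearMap.ker (q⁻¹ • 1 + T) := by
    rw [LinearMap.mem_ker, LinearMap.add_apply, hv1]
    exact add_neg_cancel _
  have hspan := (finrank_eq_one_iff_of_nonzero' (⟨w, hwker⟩ : LinearMap.ker (q⁻¹ • 1 + T))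
    (fun h => hw0 (congrArg Subtype.val h))).mp hker
  have hcomm : (q⁻¹ • 1 + T) * (q • 1 - T) = 0 := by
    have : (q • 1 - T) * (q⁻¹ • 1 + T) = 0 := hR.hecke
    rw [← this]
    simp only [add_mul, mul_sub, sub_mul, mul_add, smul_mul_assoc, mul_smul_comm, one_mul, mul_one]
    module
  have hex : ∀ i j : Fin n, ∃ c : K, (q • 1 - T) (Pi.single ![i, j] 1) = c • w := by
    intro i j
    have hmem : (q • 1 - T) (Pi.single ![i, j] 1) ∈ LinearMap.ker (q⁻¹ • 1 + T) := by
      rw [LinearMap.mem_ker, ← Module.End.mul_apply, hcomm]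
      rfl
    obtain ⟨c, hc⟩ := hspan ⟨_, hmem⟩
    exact ⟨c, (congrArg Subtype.val hc).symm⟩
  choose u hu using hex
  have hbr : IsTLBraiding q R u v := by
    intro i j k l
    have h1 := congrFun (hu i j) ![k, l]
    rw [LinearMap.sub_apply, Pi.sub_apply, hT, braidAt_two_apply] at h1
    rw [Finset.sum_eq_single i, Finset.sum_eq_single j] at h1
    · simp only [LinearMap.smul_apply, Module.End.one_apply, Pi.smul_apply, Pi.single_apply,
        smul_eq_mul, hw, Matrix.cons_val_zero, Matrix.cons_val_one, if_true, one_mul] at h1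
      have h2 : (![k, l] = ![i, j]) ↔ (i = k ∧ j = l) := by
        constructor
        · intro h
          exact ⟨(congrFun h 0).symm, (congrFun h 1).symm⟩
        · rintro ⟨rfl, rfl⟩; rfl
      simp only [h2, mul_ite, mul_one, mul_zero] at h1
      rw [← h1]
      ring
    · intro j' _ hj
      rw [Pi.single_eq_of_ne, zero_mul]
      exact fun h => hj (congrFun h 1)
    · simp
    · intro i' _ hi
      refine Finset.sum_eq_zero fun j' _ => ?_
      rw [Pi.single_eq_of_ne, zero_mul]
      exact fun h => hi (congrFun h 0)
    · simp
  refine ⟨u, hbr, ?_⟩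
  obtain ⟨k, l, hkl⟩ : ∃ k l, v k l ≠ 0 := by
    by_contra! h
    exact hv0 (by ext i j; exact h i j)
  have h1 := congrFun hv1 ![k, l]
  rw [braidAt_two_apply] at h1
  simp only [hbr _ _ _ _, Matrix.cons_val_zero, Matrix.cons_val_one, Pi.neg_apply,
    Pi.smul_apply, smul_eq_mul, mul_sub, Finset.sum_sub_distrib, ite_and, mul_ite, mul_zero] at h1
  rw [Finset.sum_eq_single k (fun b _ hb => by simp [hb]) (by simp)] at h1
  simp only [if_true, Finset.sum_ite_eq', Finset.mem_univ] at h1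
  have h2 : ∑ i, ∑ j, v i j * (u i j * v k l) = (∑ i, ∑ j, u i j * v i j) * v k l := by
    simp only [Finset.sum_mul]
    refine Finset.sum_congr rfl fun i _ => Finset.sum_congr rfl fun j _ => by ring
  rw [h2] at h1
  apply mul_right_cancel₀ hkl
  rw [qInt_two]
  linear_combination -h1

/-- The Yang--Baxter equation alone gives `e₀e₁e₀ - e₀ = e₁e₀e₁ - e₁`. This common element is shown
to vanish from `Λ₋³(V) = 0`, so the two opposite zigzags are mutually inverse. Admissibility then
makes one of them scalar, hence both, with the same scalar `ε`, and `ε² = 1`. -/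
lemma exists_isSnake (hR : IsHeckeSymmetry q R) (hrank : IsEvenOfRank q R 2)
    (hadm : IsAdmissible q R) (hq2 : qInt q 2 ≠ 0) (hv : IsDeterminant q R v) :
    ∃ (u : Matrix (Fin n) (Fin n) K) (ε : K), IsTLBraiding q R u v ∧ IsSnake q u v ε := by
  obtain ⟨u, hbr, hloop⟩ := exists_isTLBraiding hR hrank hv
  have hne : Nonempty (Fin n) := by
    by_contra h
    rw [not_nonempty_iff] at h
    exact hv.1 (by ext i; exact h.elim i)
  have hq0 := hR.ne_zero
  have hcc : ∀ s, capS u s * cupS v s = qInt q 2 • 1 := fun s => by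
    rw [capS_mul_cupS_self, hloop]
  have hsq : ∀ s, tl u v s * tl u v s = qInt q 2 • tl u v s := fun s => by
    rw [tl, mul_assoc, ← mul_assoc (capS u s), hcc]
    simp
  obtain ⟨e, he⟩ : ∃ e : ℕ → Module.End K (Tens K n 3), ∀ s, e s = q • 1 - braidAt R 3 s :=
    ⟨_, fun _ => rfl⟩
  have hext : ∀ s, s + 1 < 3 → ext 0 3 (e s) = tl u v s := fun s hs => by
    rw [he, map_sub, map_smul, map_one, ext_braidAt hbr 0 hs, zero_add]
    abel
  have hesq : ∀ s, s + 1 < 3 → e s * e s = qInt q 2 • e s := fun s hs =>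
    ext_injective 3 (by rw [map_mul, map_smul, hext s hs, hsq])
  have hbe : ∀ s, braidAt R 3 s = q • 1 - e s := fun s => by rw [he, sub_sub_cancel]
  have hyb : e 0 * e 1 * e 0 - e 0 = e 1 * e 0 * e 1 - e 1 := by
    have h1 := hR.yangBaxter
    rw [hbe 0, hbe 1] at h1
    have h2 : (q • 1 - e 0) * (q • 1 - e 1) * (q • 1 - e 0) =
        (q ^ 3) • 1 - (2 * q ^ 2) • e 0 - (q ^ 2) • e 1 + q • (e 0 * e 1) + q • (e 1 * e 0) +
          q • (e 0 * e 0) - e 0 * e 1 * e 0 := by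
      simp only [sub_mul, mul_sub, smul_mul_assoc, mul_smul_comm, one_mul, mul_one, mul_assoc]
      module
    have h3 : (q • 1 - e 1) * (q • 1 - e 0) * (q • 1 - e 1) =
        (q ^ 3) • 1 - (2 * q ^ 2) • e 1 - (q ^ 2) • e 0 + q • (e 0 * e 1) + q • (e 1 * e 0) +
          q • (e 1 * e 1) - e 1 * e 0 * e 1 := by
      simp only [sub_mul, mul_sub, smul_mul_assoc, mul_smul_comm, one_mul, mul_one, mul_assoc]
      module
    rw [h2, h3, hesq 0 (by omega), hesq 1 (by omega), qInt_two, smul_smul, smul_smul, mul_add,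
      mul_inv_cancel₀ hq0] at h1
    have h4 : e 0 * e 1 * e 0 - e 0 - (e 1 * e 0 * e 1 - e 1) = 0 := by
      rw [← sub_eq_zero] at h1
      rw [← neg_eq_zero, ← h1]
      module
    exact sub_eq_zero.mp h4
  have htop : (⨆ s : Fin (3 - 1), LinearMap.range (q⁻¹ • 1 + braidAt R 3 (s : ℕ))) = ⊤ :=
    Submodule.Quotient.subsingleton_iff.mp (hrank.2 3 (by omega))
  have hqe : ∀ s, q⁻¹ • 1 + braidAt R 3 s = qInt q 2 • 1 - e s := fun s => by
    rw [he, qInt_two, add_smul]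
    abel
  -- The common element annihilates `[2]_q - e s` from the left for both `s`, by either of its two
  -- expressions. These operators are `q⁻¹ + R` at the two places, and their images span `V^{⊗3}`
  -- because `Λ₋³(V) = 0`.
  have hG : e 0 * e 1 * e 0 - e 0 = 0 := by
    rw [← LinearMap.ker_eq_top, ← top_le_iff, ← htop]
    refine iSup_le fun s => ?_
    rw [hqe, LinearMap.range_le_ker_iff, ← Module.End.mul_eq_comp, mul_sub, mul_smul_comm, mul_one,
      sub_eq_zero]
    obtain ⟨s, hs⟩ := s
    have : s = 0 ∨ s = 1 := by omega
    rcases this with rfl | rfl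
    · rw [sub_mul, mul_assoc _ (e 0) (e 0), hesq 0 (by omega), mul_smul_comm, smul_sub]
    · simp only [hyb]
      rw [sub_mul, mul_assoc _ (e 1) (e 1), hesq 1 (by omega), mul_smul_comm, smul_sub]
  have hG' : tl u v 0 * tl u v 1 * tl u v 0 = tl u v 0 := by
    rw [← hext 0 (by omega), ← hext 1 (by omega), ← map_mul, ← map_mul, sub_eq_zero.mp hG]
  -- Sandwiching `e₀e₁e₀ = e₀` between `capS u 0` and `cupS v 0` gives two zigzags on one side, a
  -- strand on the other, and `[2]_q²` on both.
  have hzz : (v * u).transpose * (u * v) = 1 := by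
    apply siteS_injective 0
    rw [siteS_one, ← siteS_mul, ← capS_mul_cupS_succ, ← capS_succ_mul_cupS, zero_add]
    have h1 : capS u 0 * (tl u v 0 * tl u v 1 * tl u v 0) * cupS v 0 =
        (qInt q 2 * qInt q 2) • (capS u 0 * cupS v 1 * (capS u 1 * cupS v 0)) := by
      calc _ = (capS u 0 * cupS v 0) * (capS u 0 * cupS v 1 * (capS u 1 * cupS v 0)) *
            (capS u 0 * cupS v 0) := by simp only [tl, mul_assoc]
        _ = _ := by
          rw [hcc]
          simp only [smul_mul_assoc, mul_smul_comm, one_mul, mul_one, smul_smul]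
    have h2 : capS u 0 * tl u v 0 * cupS v 0 = (qInt q 2 * qInt q 2) • 1 := by
      rw [tl, ← mul_assoc, mul_assoc (_ * _), hcc]
      simp [smul_smul]
    rw [hG', h2] at h1
    exact (smul_right_injective _ (mul_ne_zero hq2 hq2) h1).symm
  have hzz' : (u * v) * (v * u).transpose = 1 := mul_eq_one_comm.mp hzz
  obtain ⟨a, ha, hadm⟩ := hadm
  have huv : ∃ ε : K, u * v = ε • 1 := by
    -- Moving `x` through `v` by `R` multiplies by `-q` and applies the zigzag `u * v` to `x`;
    -- comparison with `a` gives the scalar.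
    refine ⟨-(a / q), ?_⟩
    ext i j
    have h1 := (hadm v hv (Pi.single i 1)).1
    have h2 := congrArg (emb 3) h1
    set x : Stab K n := fun c => (Pi.single i 1 : Fin n → K) (c 0) with hx
    have e1 : emb 3 (fun b : Fin 3 → Fin n => (Pi.single i 1 : Fin n → K) (b 0) * v (b 1) (b 2)) =
        cupS v 1 x := by
      funext c
      simp [emb_apply, win, cupS_apply, hx, cut, mul_comm]
    have e2 : emb 3 (a • fun b : Fin 3 → Fin n => v (b 0) (b 1) * (Pi.single i 1 : Fin n → K) (b 2)) =
        a • cupS v 0 x := by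
      have e3 : emb 3 (fun b : Fin 3 → Fin n => v (b 0) (b 1) * (Pi.single i 1 : Fin n → K) (b 2)) =
          cupS v 0 x := by
        funext c
        simp [emb_apply, win, cupS_apply, hx, cut]
      rw [map_smul, e3]
    rw [e2, ← ext_emb, ← ext_emb, e1, ext_braidAt hbr 0 (by omega), ext_braidAt hbr 0 (by omega)] at h2
    -- In the expansion of the product, the multiples `q²`, `-q [2]_q` and `1` of `cupS v 1` cancel,
    -- and only the term `-q` times `tl u v 0 * cupS v 1` remains.
    have h3 : (q • 1 - tl u v (0 + 1)) * (q • 1 - tl u v (0 + 0)) * cupS v 1 =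
        -(q • (cupS v 0 * siteS 0 (u * v))) := by
      have t1 : tl u v 0 * cupS v 1 = cupS v 0 * siteS 0 (u * v) := by
        rw [tl, mul_assoc, ← capS_mul_cupS_succ]
      have t2 : tl u v 1 * cupS v 1 = qInt q 2 • cupS v 1 := by
        rw [tl, mul_assoc, hcc, mul_smul_comm, mul_one]
      have t3 : tl u v 1 * (cupS v 0 * siteS 0 (u * v)) = cupS v 1 := by
        rw [tl, mul_assoc, ← mul_assoc (capS u 1), ← zero_add 1, capS_succ_mul_cupS, siteS_mul,
          hzz', siteS_one, mul_one]
      simp only [zero_add, mul_assoc, sub_mul, mul_sub, smul_mul_assoc, one_mul, mul_smul_comm]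
      rw [t1, t2, t3, qInt_two]
      have t4 : q • (q + q⁻¹) • cupS (K := K) v 1 = (q * q + 1) • cupS v 1 := by
        rw [smul_smul, mul_add, mul_inv_cancel₀ hq0]
      rw [smul_sub, t4]
      module
    have h4 := congrArg (capS u 0) h2
    rw [← Module.End.mul_apply (q • 1 - _) (q • 1 - _), ← Module.End.mul_apply _ (cupS v 1), h3,
      map_smul, LinearMap.neg_apply, LinearMap.smul_apply, Module.End.mul_apply, map_neg, map_smul,
      ← Module.End.mul_apply (capS u 0), ← Module.End.mul_apply (capS u 0), hcc] at h4
    have h5 := congrFun h4 fun _ => j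
    simp only [LinearMap.smul_apply, Module.End.one_apply, Pi.neg_apply, Pi.smul_apply,
      smul_eq_mul, siteS_apply, hx, Function.update_self] at h5
    rw [Finset.sum_eq_single i (fun b _ hb => by simp [hb]) (by simp)] at h5
    rw [Pi.single_eq_same, one_mul] at h5
    have h6 : (u * v) i j = -(a / q) * (Pi.single i 1 : Fin n → K) j := by
      field_simp
      apply mul_left_cancel₀ hq2
      linear_combination -h5
    rw [h6]
    simp [Matrix.one_apply, Pi.single_apply, eq_comm]
  obtain ⟨ε, hε⟩ := huv
  have hε0 : ε ≠ 0 := by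
    rintro rfl
    rw [hε, zero_smul, mul_zero] at hzz
    obtain ⟨i⟩ := hne
    have := congrFun (congrFun hzz i) i
    simp at this
  have hvu : v * u = ε • 1 := by
    have h1 : (ε⁻¹ • u) * v = 1 := by rw [Matrix.smul_mul, hε, smul_smul, inv_mul_cancel₀ hε0, one_smul]
    have h2 := mul_eq_one_comm.mp h1
    rw [Matrix.mul_smul] at h2
    rw [← h2, smul_smul, mul_inv_cancel₀ hε0, one_smul]
  refine ⟨u, ε, hbr, hloop, hε, hvu, ?_⟩
  rw [hε, hvu, Matrix.transpose_smul, Matrix.transpose_one, Matrix.smul_mul, one_mul,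
    smul_smul] at hzz
  obtain ⟨i⟩ := hne
  have := congrFun (congrFun hzz i) i
  simpa using this

/-- With its indices regrouped by column, `R` is a rank-one matrix minus a tensor product of two
invertible matrices. Its inverse therefore has the same shape, as for any rank-one perturbation, and
the formula is confirmed by multiplication. -/
lemma columnInverse_eq (hq0 : q ≠ 0) (hbr : IsTLBraiding q R u v) (h : IsSnake q u v ε)
    (s t : Fin n × Fin n) :
    columnInverse R s t = -(v t.1 t.2 * u s.1 s.2) +
      q⁻¹ * ((u * v.transpose) s.1 t.1 * (u.transpose * v) s.2 t.2) := by
  set I : Matrix (Fin n × Fin n) (Fin n × Fin n) K := Matrix.of fun d e =>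
    -(v d.2 e.1 * u d.1 e.2) + q⁻¹ * ((u * v.transpose) d.1 d.2 * (u.transpose * v) e.2 e.1) with hI
  have hS : ∑ a, (u * v.transpose) a a = qInt q 2 := by
    simp only [Matrix.mul_apply, Matrix.transpose_apply]
    exact h.loop
  have key : (Matrix.of fun c d : Fin n × Fin n => R (c.1, d.2) (c.2, d.1)) * I = 1 := by
    ext ⟨i, j⟩ ⟨l, k⟩
    have s1 : ∑ b, ∑ a, (if i = j ∧ a = b then q else 0) * (v a l * u b k) =
        (if i = j then q else 0) * (u.transpose * v) k l := by
      simp only [ite_and, Matrix.mul_apply, Matrix.transpose_apply, Finset.mul_sum]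
      refine Finset.sum_congr rfl fun b _ => ?_
      rw [Finset.sum_eq_single b (fun a _ ha => by simp [ha]) (by simp), if_pos rfl]
      split_ifs <;> ring
    have s2 : ∑ b, ∑ a, (if i = j ∧ a = b then q else 0) * (u * v.transpose) b a =
        (if i = j then q else 0) * qInt q 2 := by
      rw [← hS, Finset.mul_sum]
      refine Finset.sum_congr rfl fun b _ => ?_
      rw [Finset.sum_eq_single b (fun a _ ha => by simp [ha]) (by simp)]
      simp
    have s3 : ∑ b, ∑ a, (u i a * v j b) * (v a l * u b k) = (u * v) i l * (v * u) j k := by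
      rw [Matrix.mul_apply, Matrix.mul_apply, Finset.sum_mul_sum, Finset.sum_comm]
      exact Finset.sum_congr rfl fun b _ => Finset.sum_congr rfl fun a _ => by ring
    have s4 : ∑ b, ∑ a, (u i a * v j b) * (u * v.transpose) b a =
        (v * (u * v.transpose) * u.transpose) j i := by
      simp only [Matrix.mul_apply (M := _ * _) (N := u.transpose), Matrix.mul_apply (M := v),
        Finset.sum_mul]
      rw [Finset.sum_comm]
      refine Finset.sum_congr rfl fun b _ => Finset.sum_congr rfl fun a _ => ?_
      rw [Matrix.transpose_apply]
      ring
    have s5 : v * (u * v.transpose) * u.transpose = 1 := by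
      rw [← mul_assoc, h.cup_cap, Matrix.smul_mul, one_mul, Matrix.smul_mul,
        ← Matrix.transpose_mul, h.cap_cup, Matrix.transpose_smul, smul_smul, h.sign,
        Matrix.transpose_one, one_smul]
    rw [Matrix.mul_apply, Fintype.sum_prod_type]
    have hterm : ∀ b a : Fin n, (Matrix.of fun c d : Fin n × Fin n => R (c.1, d.2) (c.2, d.1))
        (i, j) (b, a) * I (b, a) (l, k) =
        -((if i = j ∧ a = b then q else 0) * (v a l * u b k)) + (u i a * v j b) * (v a l * u b k) +
        (q⁻¹ * (u.transpose * v) k l) * ((if i = j ∧ a = b then q else 0) * (u * v.transpose) b a) -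
        (q⁻¹ * (u.transpose * v) k l) * ((u i a * v j b) * (u * v.transpose) b a) := by
      intro b a
      simp only [hI, Matrix.of_apply, hbr _ _ _ _]
      ring
    simp only [hterm, Finset.sum_add_distrib, Finset.sum_sub_distrib, Finset.sum_neg_distrib,
      ← Finset.mul_sum]
    rw [s1, s2, s3, s4, s5, h.cap_cup, h.cup_cap, qInt_two]
    simp only [Matrix.smul_apply, Matrix.one_apply, smul_eq_mul, Prod.mk.injEq]
    have hs := h.sign
    have h1 : (if i = l then (1 : K) else 0) * (if j = k then 1 else 0) =
        if i = l ∧ j = k then 1 else 0 := by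
      split_ifs <;> simp_all
    rcases eq_or_ne i j with rfl | hij
    · rw [if_pos rfl, if_pos rfl, ← h1]
      field_simp
      linear_combination (q * (if i = l then (1 : K) else 0) * (if i = k then 1 else 0)) * hs
    · rw [if_neg hij, if_neg hij.symm, ← h1]
      linear_combination ((if i = l then (1 : K) else 0) * (if j = k then 1 else 0)) * hs
  rw [columnInverse, Matrix.of_apply, Matrix.inv_eq_right_inv key, hI, Matrix.of_apply]

/-- Summation turns the second term of the column inverse into `q⁻¹ [2]_q = 1 + q⁻²` times `uᵀ v`,
and the first term cancels the `1`. This is the origin of the factor `q²` in the categorical traces.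
-/
lemma matB_eq (hq0 : q ≠ 0) (hbr : IsTLBraiding q R u v) (h : IsSnake q u v ε) :
    matB R = (q⁻¹ * q⁻¹) • (u.transpose * v) := by
  ext i j
  rw [matB, Matrix.of_apply]
  simp only [columnInverse_eq hq0 hbr h, Finset.sum_add_distrib, Finset.sum_neg_distrib,
    ← Finset.mul_sum, ← Finset.sum_mul]
  have hS : ∑ a, (u * v.transpose) a a = qInt q 2 := by
    simp only [Matrix.mul_apply, Matrix.transpose_apply]
    exact h.loop
  have h1 : ∑ a, v a j * u a i = (u.transpose * v) i j := by
    simp [Matrix.mul_apply, mul_comm]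
  rw [hS, h1, qInt_two, Matrix.smul_apply, smul_eq_mul]
  field_simp
  ring

lemma matC_eq (hq0 : q ≠ 0) (hbr : IsTLBraiding q R u v) (h : IsSnake q u v ε) :
    matC R = (q⁻¹ * q⁻¹) • (u * v.transpose) := by
  ext i j
  rw [matC, Matrix.of_apply]
  simp only [columnInverse_eq hq0 hbr h, Finset.sum_add_distrib, Finset.sum_neg_distrib,
    ← Finset.mul_sum]
  have hS : ∑ a, (u.transpose * v) a a = qInt q 2 := by
    simp only [Matrix.mul_apply, Matrix.transpose_apply]
    rw [Finset.sum_comm]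
    exact h.loop
  have h1 : ∑ a, v j a * u i a = (u * v.transpose) i j := by
    simp [Matrix.mul_apply, mul_comm]
  rw [hS, h1, qInt_two, Matrix.smul_apply, smul_eq_mul]
  field_simp
  ring

end Structure

end BraidedIndex


namespace BraidedIndex

/-! ### The symmetrizers as Jones--Wenzl projectors; tensor products of the `V_(m)` -/

section Projectors

variable {K : Type*} [Field K] {n : ℕ} {q ε : K} {R : PairMat K n}
  {u v : Matrix (Fin n) (Fin n) K}

/-- The braiding `R` at generic `q` is given by the cup `v` and the cap `u`. -/
structure IsCupCap (q : K) (R : PairMat K n) (u v : Matrix (Fin n) (Fin n) K) (ε : K) : Prop where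
  ne_zero : q ≠ 0
  generic : ∀ j : ℕ, 1 ≤ j → qInt q j ≠ 0
  braiding : IsTLBraiding q R u v
  snake : IsSnake q u v ε

/-- The operator on `V^{⊗ m}` which factors through an operator on `V_(m)`. -/
def inflate (q : K) (R : PairMat K n) (m : ℕ) (Y : Module.End K (SymPower q R m)) :
    Module.End K (Tens K n m) :=
  (SymPower q R m).subtype ∘ₗ Y ∘ₗ (symProj q R m).rangeRestrict

lemma inflate_add (m : ℕ) (Y Z : Module.End K (SymPower q R m)) :
    inflate q R m (Y + Z) = inflate q R m Y + inflate q R m Z := by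
  ext
  simp [inflate]

lemma inflate_smul (m : ℕ) (a : K) (Y : Module.End K (SymPower q R m)) :
    inflate q R m (a • Y) = a • inflate q R m Y := by
  ext
  simp [inflate]

lemma inflate_apply (m : ℕ) (Y : Module.End K (SymPower q R m)) (w : Tens K n m) :
    inflate q R m Y w = Y ((symProj q R m).rangeRestrict w) := rfl

lemma inflate_compress (m : ℕ) (T : Module.End K (Tens K n m)) :
    inflate q R m (compress q R m T) = symProj q R m * T * symProj q R m := rfl

lemma inflate_one (m : ℕ) : inflate q R m 1 = symProj q R m := rfl

/-- A tensor product of elements of `V_(k)` and `V_(m)`, as a function of infinite words. -/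
def pairMap (q : K) (R : PairMat K n) (k m : ℕ) :
    SymPower q R k ⊗[K] SymPower q R m →ₗ[K] Stab K n :=
  TensorProduct.lift
    ((pairEmb k m).compl₁₂ (SymPower q R k).subtype (SymPower q R m).subtype)

lemma pairMap_tmul (k m : ℕ) (g : SymPower q R k) (f : SymPower q R m) :
    pairMap q R k m (g ⊗ₜ f) = pairEmb k m (g : Tens K n k) (f : Tens K n m) := rfl

/-- The word `a` followed by the word `b`, and then by a constant word. -/
noncomputable def joinS [Nonempty (Fin n)] {k m : ℕ} (a : Fin k → Fin n) (b : Fin m → Fin n) : ℕ → Fin n :=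
  subst k m b (subst 0 k a fun _ => Classical.arbitrary _)

/-- The values of `W` at words of length `k + m`, projected to `V_(k) ⊗ V_(m)`. -/
noncomputable def pairProj (q : K) (R : PairMat K n) [Nonempty (Fin n)] (k m : ℕ) :
    Stab K n →ₗ[K] SymPower q R k ⊗[K] SymPower q R m where
  toFun W := ∑ a : Fin k → Fin n, ∑ b : Fin m → Fin n, W (joinS a b) •
    ((symProj q R k).rangeRestrict (Pi.single a 1) ⊗ₜ[K]
      (symProj q R m).rangeRestrict (Pi.single b 1))
  map_add' W W' := by simp [add_smul, Finset.sum_add_distrib]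
  map_smul' a W := by simp [Finset.smul_sum, mul_smul]

lemma map_eq_sum_single {ι M : Type*} [Fintype ι] [DecidableEq ι] [AddCommMonoid M] [Module K M]
    (T : (ι → K) →ₗ[K] M) (w : ι → K) : T w = ∑ a, w a • T (Pi.single a 1) := by
  conv_lhs => rw [LinearMap.pi_apply_eq_sum_univ T w]
  refine Finset.sum_congr rfl fun a _ => ?_
  congr 2
  funext b
  simp [Pi.single_apply, eq_comm]

/-- `W` depends on the first `N` letters only. -/
def IsLocal (N : ℕ) (W : Stab K n) : Prop :=
  ∀ c c' : ℕ → Fin n, (∀ t, t < N → c t = c' t) → W c = W c'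

lemma isLocal_emb {N : ℕ} (w : Tens K n N) : IsLocal N (emb N w) := by
  intro c c' h
  rw [emb_apply, emb_apply]
  congr 1
  funext s
  simp only [win, zero_add]
  exact h s s.2

lemma isLocal_cupS {N s : ℕ} (hs : s ≤ N) {W : Stab K n} (h : IsLocal N W) :
    IsLocal (N + 2) (cupS v s W) := by
  intro c c' hc
  rw [cupS_apply, cupS_apply, hc s (by omega), hc (s + 1) (by omega), h (cut s c) (cut s c')]
  intro t ht
  simp only [cut]
  split_ifs
  · exact hc t (by omega)
  · exact hc (t + 2) (by omega)

lemma isLocal_nest {N κ : ℕ} (hκ : κ ≤ N) (i : ℕ) {W : Stab K n} (h : IsLocal N W) :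
    IsLocal (N + 2 * i) (nest v κ i W) := by
  induction i with
  | zero => exact h
  | succ i ih => exact isLocal_cupS (s := κ + i) (N := N + 2 * i) (by omega) ih

lemma eq_of_isLocal {N : ℕ} {W : Stab K n} (h : IsLocal N W) (c' : ℕ → Fin n) :
    W = emb N fun a => W (subst 0 N a c') := by
  funext c
  rw [emb_apply]
  refine h _ _ fun t ht => ?_
  simp [subst, win, ht]

lemma ext_ext_apply (k m : ℕ) (S : Module.End K (Tens K n k)) (T : Module.End K (Tens K n m))
    (W : Stab K n) (c : ℕ → Fin n) : ext 0 k S (ext k m T W) c =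
      ∑ a, ∑ b, W (subst k m b (subst 0 k a c)) *
        (S (Pi.single a 1) (win 0 k c) * T (Pi.single b 1) (win k m c)) := by
  rw [ext_apply, map_eq_sum_single S, Finset.sum_apply]
  refine Finset.sum_congr rfl fun a _ => ?_
  rw [Pi.smul_apply, ext_apply, map_eq_sum_single T, Finset.sum_apply, smul_eq_mul, Finset.sum_mul,
    win_subst_of_disjoint (by omega)]
  refine Finset.sum_congr rfl fun b _ => ?_
  rw [Pi.smul_apply, smul_eq_mul]
  ring

lemma pairMap_map (k m : ℕ) (S : Module.End K (SymPower q R k))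
    (T : Module.End K (SymPower q R m)) (z : SymPower q R k ⊗[K] SymPower q R m)
    (hS : ∀ g : SymPower q R k, inflate q R k S g = S g)
    (hT : ∀ f : SymPower q R m, inflate q R m T f = T f) :
    pairMap q R k m (TensorProduct.map S T z) =
      ext 0 k (inflate q R k S) (ext k m (inflate q R m T) (pairMap q R k m z)) := by
  induction z with
  | zero => simp
  | add x y hx hy => simp only [map_add, hx, hy]
  | tmul g f =>
    rw [TensorProduct.map_tmul, pairMap_tmul, pairMap_tmul, ext_pairEmb_right, ext_pairEmb_left,
      hS, hT]

namespace IsCupCap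

variable (D : IsCupCap q R u v ε)

include D

lemma isTL (N : ℕ) : IsTL q (tl u v) N := D.snake.isTL N

lemma isTL_shift (l N : ℕ) : IsTL q (fun s => tl u v (l + s)) N := (D.isTL (N + l)).shift le_rfl

lemma nonempty : Nonempty (Fin n) := by
  by_contra h
  rw [not_nonempty_iff] at h
  apply D.generic 2 (by omega)
  rw [← D.snake.loop]
  simp

/-- Substituting `R = q - e` gives `q^{-a} + [a]_q R = [a+1]_q - [a]_q e`, since `[a+1]_q = q [a]_q
+ q^{-a}`. The defining recursion thus becomes that of the Jones--Wenzl projectors. -/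
lemma ext_symmetrizer (l : ℕ) {a m : ℕ} (ha : a ≤ m) :
    ext l m (symmetrizer q R m a) = jw q (fun s => tl u v (l + s)) a := by
  induction a with
  | zero => exact map_one _
  | succ a ih =>
    have ih := ih (by omega)
    rw [symmetrizer, map_smul, map_mul, map_mul, map_add, map_smul, map_smul, map_one, ih]
    rcases a with _ | a
    · simp
    · have hne := D.generic (a + 1 + 1) (by omega)
      rw [ext_braidAt D.braiding l (by omega), jw_succ_succ, Nat.add_sub_cancel]
      have h1 : (q ^ (-((a + 1 : ℕ) : ℤ)) • (1 : Module.End K (Stab K n)) +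
          qInt q (a + 1) • (q • 1 - tl u v (l + a))) =
          qInt q (a + 1 + 1) • 1 - qInt q (a + 1) • tl u v (l + a) := by
        rw [qInt_succ D.ne_zero (a + 1)]
        module
      rw [h1, mul_sub, sub_mul, mul_smul_comm, mul_one, smul_mul_assoc,
        jw_idem D.ne_zero D.generic (D.isTL_shift l (a + 1)) (by omega), mul_smul_comm,
        smul_mul_assoc, smul_sub, smul_smul, inv_mul_cancel₀ hne, one_smul, smul_smul]
      congr 2
      rw [div_eq_inv_mul]

lemma ext_symProj (l m : ℕ) :
    ext l m (symProj q R m) = jw q (fun s => tl u v (l + s)) m := D.ext_symmetrizer l le_rfl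

lemma ext_symProj_zero (m : ℕ) : ext 0 m (symProj q R m) = jw q (tl u v) m := by
  rw [D.ext_symProj]
  simp

lemma symProj_idem (m : ℕ) : symProj q R m * symProj q R m = symProj q R m := by
  have := D.nonempty
  apply ext_injective m
  rw [map_mul, D.ext_symProj_zero, jw_idem D.ne_zero D.generic (D.isTL m) (by omega)]

lemma symProj_coe {m : ℕ} (g : SymPower q R m) : symProj q R m g = g := by
  obtain ⟨_, w, rfl⟩ := g
  exact LinearMap.congr_fun (D.symProj_idem m) w

lemma rangeRestrict_coe {m : ℕ} (g : SymPower q R m) :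
    (symProj q R m).rangeRestrict (g : Tens K n m) = g := Subtype.ext (D.symProj_coe g)

lemma sub_symProj_mem {m : ℕ} (S : Submodule K (Tens K n m))
    (hS : ∀ s, s + 1 < m → ∀ y, (q • 1 - braidAt R m s) y ∈ S) (z : Tens K n m) :
    z - symProj q R m z ∈ S := by
  have := D.nonempty
  have h1 : symProj q R m = jw q (fun s => q • 1 - braidAt R m s) m := by
    apply ext_injective m
    rw [D.ext_symProj_zero, map_jw]
    refine jw_congr m fun s hs => ?_
    rw [map_sub, map_smul, map_one, ext_braidAt D.braiding 0 hs, zero_add, sub_sub_cancel]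
  rw [h1]
  exact sub_jw_smul_mem (e := fun s => q • 1 - braidAt R m s) S m hS z

lemma tl_emb {m s : ℕ} (hs : s + 1 < m) (w : SymPower q R m) :
    tl u v s (emb m (w : Tens K n m)) = 0 := by
  rw [← D.symProj_coe w, ← ext_emb, D.ext_symProj_zero, ← Module.End.mul_apply,
    e_mul_jw D.ne_zero D.generic (D.isTL m) (by omega) hs]
  rfl

lemma inflate_coe {m : ℕ} (Y : Module.End K (SymPower q R m)) (g : SymPower q R m) :
    inflate q R m Y g = Y g := by
  rw [inflate_apply, D.rangeRestrict_coe]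

lemma inflate_mul {m : ℕ} (Y Z : Module.End K (SymPower q R m)) :
    inflate q R m (Y * Z) = inflate q R m Y * inflate q R m Z := by
  refine LinearMap.ext fun w => ?_
  rw [Module.End.mul_apply, inflate_apply m Z, D.inflate_coe]
  rfl

lemma inflate_injective (m : ℕ) : Function.Injective (inflate q R m) := by
  intro Y Z h
  ext g : 1
  apply Subtype.ext
  rw [← D.inflate_coe, h, D.inflate_coe]

lemma pairMap_map' (k m : ℕ) (S : Module.End K (SymPower q R k))
    (T : Module.End K (SymPower q R m)) (z : SymPower q R k ⊗[K] SymPower q R m) :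
    pairMap q R k m (TensorProduct.map S T z) =
      ext 0 k (inflate q R k S) (ext k m (inflate q R m T) (pairMap q R k m z)) :=
  pairMap_map k m S T z (D.inflate_coe S) (D.inflate_coe T)

lemma pairProj_pairMap [Nonempty (Fin n)] (k m : ℕ) (z : SymPower q R k ⊗[K] SymPower q R m) :
    pairProj q R k m (pairMap q R k m z) = z := by
  induction z with
  | zero => simp
  | add x y hx hy => simp only [map_add, hx, hy]
  | tmul g f =>
    conv_rhs => rw [← D.rangeRestrict_coe g, ← D.rangeRestrict_coe f,
      map_eq_sum_single _ (g : Tens K n k), map_eq_sum_single _ (f : Tens K n m),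
      TensorProduct.sum_tmul]
    refine Finset.sum_congr rfl fun a _ => ?_
    rw [TensorProduct.tmul_sum]
    refine Finset.sum_congr rfl fun b _ => ?_
    rw [TensorProduct.smul_tmul_smul, pairMap_tmul, pairEmb_apply, joinS, win_subst,
      win_subst_of_disjoint (by omega), win_subst]

lemma pairMap_injective (k m : ℕ) : Function.Injective (pairMap q R k m) := by
  have := D.nonempty
  exact Function.LeftInverse.injective (g := pairProj q R k m) (D.pairProj_pairMap k m)

/-- `pairProj` samples `W` only at words of length `k + m` padded by a fixed letter; locality
ensures that nothing is lost. -/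
lemma pairMap_pairProj [Nonempty (Fin n)] {k m : ℕ} {W : Stab K n} (hW : IsLocal (k + m) W) :
    pairMap q R k m (pairProj q R k m W) =
      jw q (tl u v) k (jw q (fun s => tl u v (k + s)) m W) := by
  rw [← D.ext_symProj_zero, ← D.ext_symProj]
  funext c
  rw [ext_ext_apply]
  simp only [pairProj, LinearMap.coe_mk, AddHom.coe_mk, map_sum, map_smul, Finset.sum_apply,
    pairMap_tmul, Pi.smul_apply, pairEmb_apply, smul_eq_mul]
  refine Finset.sum_congr rfl fun a _ => Finset.sum_congr rfl fun b _ => ?_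
  congr 1
  refine hW _ _ fun t ht => ?_
  rw [joinS]
  rcases lt_or_ge t k with h | h
  · rw [subst_of_lt h, subst_of_lt h]
    simp [subst, h]
  · have : k ≤ t ∧ t < k + m := ⟨h, ht⟩
    simp [subst, this]

lemma jw_mul_pairMap (k m : ℕ) (z : SymPower q R k ⊗[K] SymPower q R m) :
    jw q (tl u v) k (jw q (fun s => tl u v (k + s)) m (pairMap q R k m z)) =
      pairMap q R k m z := by
  conv_rhs => rw [← LinearMap.id_apply (R := K) z, ← TensorProduct.map_id]
  rw [D.pairMap_map', ← D.ext_symProj_zero, ← D.ext_symProj]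
  rfl

end IsCupCap

lemma embed_eq [Nonempty (Fin n)] {k m i : ℕ} (hik : i ≤ k) (him : i ≤ m)
    (w : SymPower q R (k + m - 2 * i)) :
    embed q R v hik him w = pairProj q R k m (nest v (k - i) i (emb (k + m - 2 * i) w)) := by
  simp only [embed, pairProj, LinearMap.coe_mk, AddHom.coe_mk]
  refine Finset.sum_congr rfl fun a _ => Finset.sum_congr rfl fun b _ => ?_
  congr 1
  rw [nest_apply, mul_comm, Finset.prod_range]
  congr 1
  · refine Finset.prod_congr rfl fun t _ => ?_
    have := t.2
    congr 1
    · simp only [joinS]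
      rw [subst_of_lt (by omega), subst, dif_pos (by omega)]
      congr 1; apply Fin.ext; simp only; omega
    · simp only [joinS]
      rw [subst, dif_pos (by omega)]
      congr 1; apply Fin.ext; simp only; omega
  · rw [emb_apply]
    refine congrArg (w : Tens K n (k + m - 2 * i)) (funext fun s => ?_)
    have := s.2
    simp only [joinWord, win, zero_add, joinS]
    split_ifs with h
    · rw [subst_of_lt (by omega), subst, dif_pos (by omega)]
      congr 1
    · rw [subst, dif_pos (by omega)]

lemma IsCupCap.pairMap_embed (D : IsCupCap q R u v ε) {k m i : ℕ} (hik : i ≤ k) (him : i ≤ m)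
    (w : SymPower q R (k + m - 2 * i)) :
    pairMap q R k m (embed q R v hik him w) = jw q (tl u v) k
      (jw q (fun s => tl u v (k + s)) m (nest v (k - i) i (emb (k + m - 2 * i) w))) := by
  have := D.nonempty
  rw [embed_eq, D.pairMap_pairProj]
  have := isLocal_nest (v := v) (κ := k - i) (by omega) i
    (isLocal_emb (w : Tens K n (k + m - 2 * i)))
  rwa [show k + m - 2 * i + 2 * i = k + m by omega] at this

end Projectors

end BraidedIndex


namespace BraidedIndex

/-! ### The components of `V_(k) ⊗ V_(m)`: eigenvalue at the junction and spanning -/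

section Components

variable {K : Type*} [Field K] {n : ℕ} {q ε : K} {R : PairMat K n}
  {u v : Matrix (Fin n) (Fin n) K}

/-- The product of the projectors on the first `k` and on the following `m` places. -/
def twoJW (q : K) (u v : Matrix (Fin n) (Fin n) K) (k m : ℕ) : Module.End K (Stab K n) :=
  jw q (tl u v) k * jw q (fun s => tl u v (k + s)) m

lemma isLocal_capS {N s : ℕ} (hs : s ≤ N) {W : Stab K n} (h : IsLocal (N + 2) W) :
    IsLocal N (capS u s W) := by
  intro c c' hc
  simp only [capS_apply]
  refine Finset.sum_congr rfl fun i _ => Finset.sum_congr rfl fun j _ => ?_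
  rw [h (ins s i j c) (ins s i j c')]
  intro t ht
  simp only [ins]
  split_ifs
  · exact hc t (by omega)
  · rfl
  · rfl
  · exact hc (t - 2) (by omega)

lemma isLocal_pairMap (k m : ℕ) (z : SymPower q R k ⊗[K] SymPower q R m) :
    IsLocal (k + m) (pairMap q R k m z) := by
  intro c c' h
  induction z with
  | zero => simp
  | add x y hx hy => simp only [map_add, Pi.add_apply, hx, hy]
  | tmul g f =>
    rw [pairMap_tmul, pairEmb_apply, pairEmb_apply]
    have h1 : win 0 k c = win 0 k c' := funext fun s => h _ (by omega)
    have h2 : win k m c = win k m c' := funext fun s => h _ (by omega)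
    rw [h1, h2]

lemma nest_succ' (v : Matrix (Fin n) (Fin n) K) (κ i : ℕ) :
    nest v κ (i + 1) = nest v (κ + 1) i * cupS v κ := by
  induction i with
  | zero => simp [nest_succ]
  | succ i ih =>
    rw [nest_succ, ih, nest_succ v (κ + 1), ← mul_assoc]
    congr 3
    omega

lemma twoJW_mem (k m : ℕ) : twoJW q u v k m ∈ tlAlg K (tl u v) (k + m) := by
  refine mul_mem (jw_mem_tlAlg (by omega)) ?_
  have : ∀ x ∈ tlAlg K (fun s => tl u v (k + s)) m, x ∈ tlAlg K (tl u v) (k + m) := by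
    intro x hx
    refine Algebra.adjoin_mono ?_ hx
    rintro _ ⟨s, hs, rfl⟩
    exact ⟨k + s, by omega, rfl⟩
  exact this _ (jw_mem_tlAlg le_rfl)

namespace IsCupCap

variable (D : IsCupCap q R u v ε)

include D

lemma commute_two (k m : ℕ) :
    Commute (jw q (tl u v) k) (jw q (fun s => tl u v (k + s)) m) :=
  commute_jw _ fun s hs => (commute_jw _ fun t ht =>
    ((D.isTL (k + s + 1)).comm _ _ (by omega) (by omega)).symm).symm

lemma twoJW_eq (k m : ℕ) : twoJW q u v k m =
    jw q (fun s => tl u v (k + s)) m * jw q (tl u v) k := D.commute_two k m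

lemma twoJW_idem (k m : ℕ) : twoJW q u v k m * twoJW q u v k m = twoJW q u v k m := by
  conv_lhs => enter [1]; rw [D.twoJW_eq]
  rw [twoJW, mul_assoc, ← mul_assoc (jw q (tl u v) k),
    jw_idem D.ne_zero D.generic (D.isTL k) (by omega), (D.commute_two k m).eq, ← mul_assoc,
    jw_idem D.ne_zero D.generic (D.isTL_shift k m) (by omega)]

lemma twoJW_mul_tl {k m s : ℕ} (hs : s + 1 < k + m) (hk : s + 1 ≠ k) :
    twoJW q u v k m * tl u v s = 0 := by
  rcases Nat.lt_or_ge (s + 1) k with h | h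
  · rw [D.twoJW_eq, mul_assoc, jw_mul_e D.ne_zero D.generic (D.isTL k) (by omega) h, mul_zero]
  · obtain ⟨s, rfl⟩ : ∃ t, s = k + t := ⟨s - k, by omega⟩
    rw [twoJW, mul_assoc, jw_mul_e (e := fun s => tl u v (k + s)) D.ne_zero D.generic
      (D.isTL_shift k m) (by omega) (by omega), mul_zero]

lemma twoJW_pairMap (k m : ℕ) (z : SymPower q R k ⊗[K] SymPower q R m) :
    twoJW q u v k m (pairMap q R k m z) = pairMap q R k m z := D.jw_mul_pairMap k m z

lemma pairMap_embed' {k m i : ℕ} (hik : i ≤ k) (him : i ≤ m)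
    (w : SymPower q R (k + m - 2 * i)) : pairMap q R k m (embed q R v hik him w) =
      twoJW q u v k m (nest v (k - i) i (emb (k + m - 2 * i) w)) := D.pairMap_embed hik him w

/-- For `i = 0` a symmetrized tensor is fixed by the projectors and killed by the generator. For `i
= j + 1` this is `IsNested.e_smul`, the smaller projectors produced there being absorbed by the
larger ones. -/
lemma twoJW_center {k m i : ℕ} (hk : 1 ≤ k) (hm : 1 ≤ m) (hik : i ≤ k) (him : i ≤ m)
    (w : SymPower q R (k + m - 2 * i)) :
    (twoJW q u v k m * tl u v (k - 1) * twoJW q u v k m)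
        (nest v (k - i) i (emb (k + m - 2 * i) w)) =
      (qInt q i * qInt q (k + m + 1 - i) / (qInt q m * qInt q k)) •
        twoJW q u v k m (nest v (k - i) i (emb (k + m - 2 * i) w)) := by
  rcases i with _ | j
  · have h1 : twoJW q u v k m (emb (k + m - 2 * 0) (w : Tens K n (k + m - 2 * 0))) =
        emb (k + m - 2 * 0) (w : Tens K n (k + m - 2 * 0)) := by
      have hR : jw q (fun s => tl u v (k + s)) m •
          (emb (k + m - 2 * 0) (w : Tens K n (k + m - 2 * 0))) = _ :=
        jw_smul_eq m fun s hs => D.tl_emb (by omega) w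
      have hL : jw q (tl u v) k • (emb (k + m - 2 * 0) (w : Tens K n (k + m - 2 * 0))) = _ :=
        jw_smul_eq k fun s hs => D.tl_emb (by omega) w
      rw [twoJW, Module.End.mul_apply]
      simp only [Module.End.smul_def] at hL hR
      rw [hR, hL]
    simp only [nest_zero, Module.End.one_apply, qInt_zero, zero_mul, zero_div, zero_smul]
    rw [Module.End.mul_apply, h1, Module.End.mul_apply, D.tl_emb (by omega), map_zero]
  · obtain ⟨κ, rfl⟩ : ∃ κ, k = κ + j + 1 := ⟨k - (j + 1), by omega⟩
    obtain ⟨r, rfl⟩ : ∃ r, m = r + j + 1 := ⟨m - (j + 1), by omega⟩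
    rw [show κ + j + 1 - (j + 1) = κ by omega]
    set y := nest v κ (j + 1) (emb (κ + j + 1 + (r + j + 1) - 2 * (j + 1))
      (w : Tens K n (κ + j + 1 + (r + j + 1) - 2 * (j + 1)))) with hy
    have hn : IsNested q (tl u v) κ j r y :=
      D.snake.isNested (D.generic 2 (by omega)) j fun s hs => D.tl_emb (by omega) w
    have h1 := hn.e_smul D.ne_zero D.generic (D.isTL (κ + 2 * j + r + 1)) le_rfl
    simp only [Module.End.smul_def] at h1
    have h2 : (twoJW q u v (κ + j + 1) (r + j + 1)) (jw q (tl u v) (κ + j)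
        (jw q (fun s => tl u v (κ + j + 2 + s)) (r + j) y)) =
        twoJW q u v (κ + j + 1) (r + j + 1) y := by
      have e1 : jw q (tl u v) (κ + j + 1) * jw q (tl u v) (κ + j) = jw q (tl u v) (κ + j + 1) :=
        jw_mul_jw' D.ne_zero D.generic (D.isTL (κ + j + 1)) (by omega) (by omega)
      have e2 : jw q (fun s => tl u v (κ + j + 1 + s)) (r + j + 1) *
          jw q (fun s => tl u v (κ + j + 2 + s)) (r + j) =
          jw q (fun s => tl u v (κ + j + 1 + s)) (r + j + 1) :=
        mul_jw_eq _ fun s hs => by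
          rw [show κ + j + 2 + s = κ + j + 1 + (s + 1) by omega]
          exact jw_mul_e (e := fun s => tl u v (κ + j + 1 + s)) D.ne_zero D.generic
            (D.isTL_shift (κ + j + 1) (r + j + 1)) (by omega) (by omega)
      rw [← Module.End.mul_apply, D.twoJW_eq, mul_assoc, e1, ← D.twoJW_eq, twoJW,
        ← Module.End.mul_apply, mul_assoc, e2]
    rw [Module.End.mul_apply, Module.End.mul_apply, Nat.add_sub_cancel, twoJW,
      Module.End.mul_apply (jw q (tl u v) (κ + j + 1)) _ y, h1, map_smul, ← twoJW, h2]
    rw [show κ + j + 1 + (r + j + 1) + 1 - (j + 1) = κ + r + j + 2 by omega]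
    rfl

lemma embed_injective {k m i : ℕ} (hik : i ≤ k) (him : i ≤ m) :
    Function.Injective (embed q R v hik him) := by
  have := D.nonempty
  rw [injective_iff_map_eq_zero]
  intro w hw
  have h1 := D.pairMap_embed hik him w
  obtain ⟨κ, rfl⟩ : ∃ κ, k = κ + i := ⟨k - i, by omega⟩
  obtain ⟨r, rfl⟩ : ∃ r, m = r + i := ⟨m - i, by omega⟩
  rw [hw, map_zero, show κ + i - i = κ by omega] at h1
  have h2 := D.snake.nest_injective D.ne_zero D.generic i (r := r)
    (fun s hs => D.tl_emb (by omega) w) h1.symm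
  exact Subtype.ext (emb_injective _ (h2.trans (map_zero _).symm))

/-- Downward induction on the number of cups. The tensor between the cups is its symmetrization,
which lies in the component, plus elements in the images of generators. The latter either die on
`twoJW` or acquire one more cup. -/
lemma twoJW_nest_mem {k m : ℕ} (hmk : m ≤ k) {i : ℕ} (him : i ≤ m)
    {W : Stab K n} (hW : IsLocal (k + m - 2 * i) W) :
    twoJW q u v k m (nest v (k - i) i W) ∈ (⨆ i : Fin (m + 1), component q R v
      ((Nat.lt_succ_iff.mp i.2).trans hmk) (Nat.lt_succ_iff.mp i.2)).map (pairMap q R k m) := by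
  have := D.nonempty
  obtain ⟨d, hd⟩ : ∃ d, i + d = m := ⟨m - i, by omega⟩
  induction d using Nat.strong_induction_on generalizing i W with
  | _ d ih =>
    set S := (⨆ i : Fin (m + 1), component q R v
      ((Nat.lt_succ_iff.mp i.2).trans hmk) (Nat.lt_succ_iff.mp i.2)).map (pairMap q R k m) with hS
    set Φ : Tens K n (k + m - 2 * i) →ₗ[K] Stab K n :=
      (twoJW q u v k m * nest v (k - i) i) ∘ₗ emb (k + m - 2 * i) with hΦ
    have hmem : ∀ z, Φ (symProj q R (k + m - 2 * i) z) ∈ S := fun z => by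
      refine ⟨embed q R v (him.trans hmk) him ⟨_, z, rfl⟩, ?_, D.pairMap_embed' _ _ _⟩
      exact le_iSup (fun i : Fin (m + 1) => component q R v
        ((Nat.lt_succ_iff.mp i.2).trans hmk) (Nat.lt_succ_iff.mp i.2)) ⟨i, by omega⟩ ⟨_, rfl⟩
    have hsub : ∀ s, s + 1 < k + m - 2 * i → ∀ y,
        (q • 1 - braidAt R (k + m - 2 * i) s) y ∈ S.comap Φ := by
      intro s hs y
      have h1 : Φ ((q • 1 - braidAt R (k + m - 2 * i) s) y) =
          (twoJW q u v k m * (nest v (k - i) i * tl u v s)) (emb (k + m - 2 * i) y) := by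
        rw [hΦ, LinearMap.comp_apply, ← ext_emb, map_sub, map_smul, map_one,
          ext_braidAt D.braiding 0 hs, zero_add, sub_sub_cancel, ← mul_assoc]
        rfl
      rw [Submodule.mem_comap, h1]
      rcases Nat.lt_trichotomy (s + 1) (k - i) with h | h | h
      · rw [← tl_mul_nest_of_lt (by omega), ← mul_assoc, D.twoJW_mul_tl (by omega) (by omega),
          zero_mul]
        exact S.zero_mem
      -- The generator sits on the two strands flanking the nest: its cup becomes a new outermost
      -- cup, so the case `i + 1` applies to the capped tensor.
      · have h2 : nest v (k - i) i * tl u v s = nest v (k - (i + 1)) (i + 1) * capS u s := by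
          rw [nest_succ', tl, mul_assoc, show k - (i + 1) = s by omega, show s + 1 = k - i by omega]
        rw [h2]
        exact ih (d - 1) (by omega) (i := i + 1) (by omega) (isLocal_capS (by omega)
          fun c c' hc => isLocal_emb (K := K) y c c' fun t ht => hc t (by omega)) (by omega)
      · rw [← tl_mul_nest_of_le (by omega), ← mul_assoc, D.twoJW_mul_tl (by omega) (by omega),
          zero_mul]
        exact S.zero_mem
    obtain ⟨z, rfl⟩ : ∃ z, W = emb (k + m - 2 * i) z :=
      ⟨_, eq_of_isLocal hW fun _ => Classical.arbitrary _⟩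
    have h2 := S.add_mem (D.sub_symProj_mem (S.comap Φ) hsub z) (hmem z)
    rwa [← map_add, sub_add_cancel] at h2

/-- The case without cups of the previous lemma, applied to an arbitrary element of `V_(k) ⊗ V_(m)`,
already gives all of it; no dimension count is needed. -/
lemma iSup_component {k m : ℕ} (hmk : m ≤ k) : (⨆ i : Fin (m + 1), component q R v
    ((Nat.lt_succ_iff.mp i.2).trans hmk) (Nat.lt_succ_iff.mp i.2)) = ⊤ := by
  refine eq_top_iff.mpr fun z _ => ?_
  have h1 := D.twoJW_nest_mem hmk (Nat.zero_le m) (isLocal_pairMap (q := q) (R := R) k m z)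
  rw [nest_zero, Module.End.one_apply, D.twoJW_pairMap] at h1
  obtain ⟨y, hy, hyz⟩ := h1
  rwa [← D.pairMap_injective k m hyz]

end IsCupCap

end Components

end BraidedIndex


namespace BraidedIndex

/-! ### Categorical traces as closures by nested caps and cups -/

section Closure

variable {K : Type*} [Field K] {n : ℕ} {q ε : K} {R : PairMat K n}
  {u v : Matrix (Fin n) (Fin n) K}

/-- Insert the words `a` and `b` after the first `κ` letters of `c`. -/
def joinAt (κ i : ℕ) (a b : Fin i → Fin n) (c : ℕ → Fin n) : ℕ → Fin n := fun t =>
  if t < κ then c t else if h : t - κ < i then a ⟨t - κ, h⟩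
    else if h : t - κ - i < i then b ⟨t - κ - i, h⟩ else c (t - 2 * i)

lemma joinAt_succ (κ i : ℕ) (a b : Fin i → Fin n) (x y : Fin n) (c : ℕ → Fin n) :
    joinAt κ (i + 1) (Fin.snoc (α := fun _ => Fin n) a x) (Fin.cons (α := fun _ => Fin n) y b) c =
      ins (κ + i) x y (joinAt κ i a b c) := by
  funext t
  simp only [joinAt, ins]
  rcases lt_or_ge t κ with h1 | h1
  · rw [if_pos h1, if_pos (by omega), if_pos h1]
  obtain ⟨t, rfl⟩ : ∃ s, t = κ + s := ⟨t - κ, by omega⟩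
  rw [if_neg (by omega)]
  rcases lt_trichotomy t i with h2 | h2 | h2
  · rw [dif_pos (by omega), if_pos (by omega), if_neg (by omega), dif_pos (by omega)]
    simp [Fin.snoc, h2]
  · subst h2
    rw [dif_pos (by omega), if_neg (by omega), if_pos rfl]
    simp [Fin.snoc]
  · rw [dif_neg (by omega), if_neg (by omega), if_neg (by omega)]
    obtain ⟨t, rfl⟩ : ∃ s, t = i + 1 + s := ⟨t - (i + 1), by omega⟩
    rcases t with _ | t
    · rw [dif_pos (by omega), if_pos (by omega)]
      have : (⟨κ + (i + 1 + 0) - κ - (i + 1), by omega⟩ : Fin (i + 1)) = 0 := Fin.ext (by simp)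
      rw [this]
      rfl
    · rw [if_neg (by omega), if_neg (by omega)]
      rcases lt_or_ge t i with h3 | h3
      · rw [dif_pos (by omega), dif_neg (by omega), dif_pos (by omega)]
        have : (⟨κ + (i + 1 + (t + 1)) - κ - (i + 1), by omega⟩ : Fin (i + 1)) =
          Fin.succ ⟨t, h3⟩ := Fin.ext (by simp only [Fin.val_succ]; omega)
        rw [this, Fin.cons_succ]
        congr 1
        exact Fin.ext (by simp only; omega)
      · rw [dif_neg (by omega), dif_neg (by omega), dif_neg (by omega)]
        congr 1
        omega

lemma capNest_apply (u : Matrix (Fin n) (Fin n) K) (κ i : ℕ) (W : Stab K n) (c : ℕ → Fin n) :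
    capNest u κ i W c = ∑ a : Fin i → Fin n, ∑ b : Fin i → Fin n,
      (∏ s : Fin i, u (a s.rev) (b s)) * W (joinAt κ i a b c) := by
  induction i generalizing W with
  | zero =>
    have : ∀ a b : Fin 0 → Fin n, joinAt κ 0 a b c = c := fun a b => by
      funext t
      simp [joinAt]
    simp [this]
  | succ i ih =>
    rw [capNest_succ, Module.End.mul_apply, ih]
    conv_rhs => rw [← (Fin.snocEquiv fun _ : Fin (i + 1) => Fin n).sum_comp,
      Fintype.sum_prod_type, Finset.sum_comm]
    refine Finset.sum_congr rfl fun a _ => ?_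
    have h1 : ∀ x : Fin n, ∑ b : Fin (i + 1) → Fin n,
        (∏ s : Fin (i + 1), u ((Fin.snocEquiv fun _ : Fin (i + 1) => Fin n) (x, a) s.rev) (b s)) *
          W (joinAt κ (i + 1) ((Fin.snocEquiv fun _ : Fin (i + 1) => Fin n) (x, a)) b c) =
        ∑ b : Fin i → Fin n, ∑ y, (∏ s : Fin i, u (a s.rev) (b s)) *
          (u x y * W (ins (κ + i) x y (joinAt κ i a b c))) := by
      intro x
      rw [← (Fin.consEquiv fun _ : Fin (i + 1) => Fin n).sum_comp, Fintype.sum_prod_type,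
        Finset.sum_comm]
      refine Finset.sum_congr rfl fun b _ => Finset.sum_congr rfl fun y _ => ?_
      change (∏ s : Fin (i + 1), u (Fin.snoc (α := fun _ => Fin n) a x s.rev)
        (Fin.cons (α := fun _ => Fin n) y b s)) * W (joinAt κ (i + 1)
          (Fin.snoc (α := fun _ => Fin n) a x) (Fin.cons (α := fun _ => Fin n) y b) c) = _
      rw [joinAt_succ, Fin.prod_univ_succ]
      simp only [Fin.rev_zero, Fin.snoc_last, Fin.cons_zero, Fin.rev_succ, Fin.snoc_castSucc,
        Fin.cons_succ]
      ring
    refine Eq.trans ?_ (Finset.sum_congr rfl fun x _ => (h1 x).symm)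
    rw [Finset.sum_comm]
    refine Finset.sum_congr rfl fun b _ => ?_
    simp only [capS_apply, Finset.mul_sum]

lemma win_joinAt (κ i : ℕ) (a b : Fin i → Fin n) (c : ℕ → Fin n) :
    win κ i (joinAt κ i a b c) = a := by
  funext s
  have := s.2
  simp [win, joinAt]

lemma subst_joinAt (κ i : ℕ) (a a' b : Fin i → Fin n) (c : ℕ → Fin n) :
    subst κ i a' (joinAt κ i a b c) = joinAt κ i a' b c := by
  funext t
  simp only [subst, joinAt]
  split_ifs <;> first | rfl | omega

lemma nest_joinAt (v : Matrix (Fin n) (Fin n) K) (κ i : ℕ) (W : Stab K n) (a b : Fin i → Fin n)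
    (c : ℕ → Fin n) : nest v κ i W (joinAt κ i a b c) = (∏ s, v (a s.rev) (b s)) * W c := by
  rw [nest_apply, Finset.prod_range]
  congr 1
  · refine Finset.prod_congr rfl fun s _ => ?_
    have := s.2
    congr 1
    · simp only [joinAt]
      rw [if_neg (by omega), dif_pos (by omega)]
      congr 1
      apply Fin.ext
      simp only [Fin.val_rev]
      omega
    · simp only [joinAt]
      rw [if_neg (by omega), dif_neg (by omega), dif_pos (by omega)]
      congr 1
      apply Fin.ext
      simp only
      omega
  · congr 1
    funext t
    simp only [joinAt]
    split_ifs <;> first | rfl | omega | (congr 1; omega)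

lemma trace_tens {m : ℕ} (T : Module.End K (Tens K n m)) :
    LinearMap.trace K _ T = ∑ a, T (Pi.single a 1) a := by
  rw [LinearMap.trace_eq_matrix_trace K (Pi.basisFun K _), Matrix.trace]
  refine Finset.sum_congr rfl fun a _ => ?_
  simp

lemma sum_prod_rev {m : ℕ} (a a' : Fin m → Fin n) :
    ∑ b : Fin m → Fin n, (∏ s, u (a s.rev) (b s)) * ∏ s, v (a' s.rev) (b s) =
      ∏ s, (u * v.transpose) (a s) (a' s) := by
  rw [← Equiv.prod_comp Fin.revPerm]
  simp only [Matrix.mul_apply, Matrix.transpose_apply, Fin.revPerm_apply, ← Finset.prod_mul_distrib]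
  rw [Finset.prod_univ_sum, Fintype.piFinset_univ]

/-- The free side of the closure pairs `u` with `v` strand by strand and produces one factor `u vᵀ`
each. Closing `m` strands is therefore the trace weighted by `(q²C)^{⊗m}`. -/
lemma capNest_mul_ext_mul_nest (l m : ℕ) (T : Module.End K (Tens K n m)) :
    capNest u l m * ext l m T * nest v l m =
      LinearMap.trace K _ (tensPow m (u * v.transpose) * T) • 1 := by
  ext W c
  rw [Module.End.mul_apply, Module.End.mul_apply, capNest_apply]
  have h1 : ∀ a b, ext l m T (nest v l m W) (joinAt l m a b c) =
      ∑ a', ((∏ s, v (a' s.rev) (b s)) * T (Pi.single a' 1) a) * W c := by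
    intro a b
    rw [ext_apply, win_joinAt, map_eq_sum_single T, Finset.sum_apply]
    refine Finset.sum_congr rfl fun a' _ => ?_
    rw [Pi.smul_apply, subst_joinAt, nest_joinAt, smul_eq_mul]
    ring
  simp only [h1, ← Finset.sum_mul, ← mul_assoc]
  rw [trace_tens]
  simp only [LinearMap.smul_apply, Module.End.one_apply, Pi.smul_apply, smul_eq_mul]
  congr 1
  simp only [Module.End.mul_apply, tensPow, LinearMap.coe_mk, AddHom.coe_mk, ← sum_prod_rev,
    Finset.mul_sum]
  rw [Finset.sum_comm]
  conv_rhs => rw [Finset.sum_comm]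
  rw [Finset.sum_comm]
  refine Finset.sum_congr rfl fun a _ => ?_
  rw [Finset.sum_comm]
  refine Finset.sum_congr rfl fun a' _ => Finset.sum_congr rfl fun b _ => ?_
  ring

/-- Cyclicity of the trace for the factorization of `inflate` through `V_(m)`. -/
lemma trace_mul_compress (m : ℕ) (Z : Module.End K (Tens K n m))
    (Y : Module.End K (SymPower q R m)) :
    LinearMap.trace K _ (compress q R m Z * Y) = LinearMap.trace K _ (Z * inflate q R m Y) := by
  have h1 : Z * inflate q R m Y =
      (Z ∘ₗ (SymPower q R m).subtype ∘ₗ Y) ∘ₗ (symProj q R m).rangeRestrict := rfl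
  rw [h1, ← LinearMap.trace_comp_comm']
  rfl

namespace IsCupCap

variable (D : IsCupCap q R u v ε)

include D

lemma sq_smul_matC : q ^ 2 • matC R = u * v.transpose := by
  rw [matC_eq D.ne_zero D.braiding D.snake, smul_smul]
  have := D.ne_zero
  rw [show q ^ 2 * (q⁻¹ * q⁻¹) = 1 by field_simp, one_smul]

lemma sq_smul_matB : q ^ 2 • matB R = u.transpose * v := by
  rw [matB_eq D.ne_zero D.braiding D.snake, smul_smul]
  have := D.ne_zero
  rw [show q ^ 2 * (q⁻¹ * q⁻¹) = 1 by field_simp, one_smul]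

lemma closure_inflate (l m : ℕ) (Y : Module.End K (SymPower q R m)) :
    capNest u l m * ext l m (inflate q R m Y) * nest v l m = traceL q R m Y • 1 := by
  rw [capNest_mul_ext_mul_nest, ← trace_mul_compress, traceL, D.sq_smul_matC]
  rfl

/-- The closure of the identity of `V_(m)` is the closure of a Jones--Wenzl projector. Both sides
are scalars, compared on a nonzero constant function. -/
lemma catDim_eq (m : ℕ) : catDim q R m = qInt q (m + 1) := by
  have := D.nonempty
  have h1 := D.closure_inflate 0 m 1
  rw [inflate_one, D.ext_symProj_zero, D.snake.closure_jw D.ne_zero D.generic] at h1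
  have h2 := congrFun (congrArg (fun f : Module.End K (Stab K n) => f fun _ => 1) h1)
    fun _ => Classical.arbitrary _
  rw [catDim]
  simpa using h2.symm

end IsCupCap

end Closure

end BraidedIndex


namespace BraidedIndex

/-! ### The bilinear form as nested caps, and adjoints with respect to it -/

section Form

variable {K : Type*} [Field K] {n : ℕ} {q ε : K} {R : PairMat K n}
  {u v : Matrix (Fin n) (Fin n) K}

/-- The bilinear form on `V^{⊗ k}`. -/
noncomputable def tensForm (v : Matrix (Fin n) (Fin n) K) (k : ℕ) (g f : Tens K n k) : K :=
  ∑ a : Fin k → Fin n, ∑ b : Fin k → Fin n, g a * f b * ∏ s : Fin k, v⁻¹ (a s.rev) (b s)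

lemma tensForm_smul_left (k : ℕ) (c : K) (g f : Tens K n k) :
    tensForm v k (c • g) f = c * tensForm v k g f := by
  simp [tensForm, Finset.mul_sum, mul_assoc]

lemma tensForm_smul_right (k : ℕ) (c : K) (g f : Tens K n k) :
    tensForm v k g (c • f) = c * tensForm v k g f := by
  simp [tensForm, Finset.mul_sum, mul_assoc, mul_left_comm]

lemma tensForm_sub_left (k : ℕ) (g g' f : Tens K n k) :
    tensForm v k (g - g') f = tensForm v k g f - tensForm v k g' f := by
  simp [tensForm, sub_mul, Finset.sum_sub_distrib]

lemma tensForm_sub_right (k : ℕ) (g f f' : Tens K n k) :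
    tensForm v k g (f - f') = tensForm v k g f - tensForm v k g f' := by
  simp [tensForm, mul_sub, sub_mul, Finset.sum_sub_distrib]

lemma capS_mul_tl_of_le {s t : ℕ} (h : s ≤ t) :
    capS u s * tl u v (t + 2) = tl u v t * capS u s := by
  rw [tl, ← mul_assoc, capS_mul_cupS_of_le _ _ h, mul_assoc, capS_mul_capS _ _ h, ← mul_assoc, tl]

/-- An operator on one leg of a cap can be moved to its other leg; `p + r + 1 = 2 * i` says that the
two places are the ends of the same cap. -/
lemma capNest_mul_siteS {X Y : Matrix (Fin n) (Fin n) K} (h : X * u = u * Y.transpose) (κ : ℕ)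
    {i p r : ℕ} (hp : p + r + 1 = 2 * i) (hpi : p < i) :
    capNest u κ i * siteS (κ + p) X = capNest u κ i * siteS (κ + r) Y := by
  induction i generalizing r with
  | zero => omega
  | succ i ih =>
    rw [capNest_succ, mul_assoc, mul_assoc]
    rcases Nat.lt_or_ge p i with h1 | h1
    · obtain ⟨r, rfl⟩ : ∃ r', r = r' + 2 := ⟨r - 2, by omega⟩
      rw [capS_mul_siteS_of_lt _ _ (by omega), ← mul_assoc, ih (r := r) (by omega) h1, mul_assoc,
        ← add_assoc, capS_mul_siteS_of_le _ _ (by omega)]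
    · obtain rfl : p = i := by omega
      obtain rfl : r = p + 1 := by omega
      rw [capS_mul_siteS_left, h, ← add_assoc, capS_mul_siteS_right]

/-- Against two consecutive nested caps, a generator on the left legs and its mirror image on the
right legs both straighten, with the same `ε`, to the same pair of caps. -/
lemma IsSnake.capNest_mul_tl (h : IsSnake q u v ε) (κ : ℕ) {i p r : ℕ} (hp : p + r + 2 = 2 * i)
    (hpi : p + 1 < i) : capNest u κ i * tl u v (κ + p) = capNest u κ i * tl u v (κ + r) := by
  induction i generalizing r with
  | zero => omega
  | succ i ih =>
    rcases Nat.lt_or_ge (p + 1) i with h1 | h1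
    · obtain ⟨r, rfl⟩ : ∃ r', r = r' + 2 := ⟨r - 2, by omega⟩
      rw [capNest_succ, mul_assoc, mul_assoc, capS_mul_tl_of_lt (by omega), ← mul_assoc,
        ih (r := r) (by omega) h1, mul_assoc, ← add_assoc, capS_mul_tl_of_le (by omega)]
    · obtain rfl : i = p + 1 := by omega
      obtain rfl : r = p + 2 := by omega
      have e1 : capS u (κ + p + 1) * tl u v (κ + p) = ε • capS u (κ + p) := by
        rw [tl, ← mul_assoc, h.cap_succ_cup, smul_mul_assoc, one_mul]
      have e2 : capS u (κ + p + 1) * tl u v (κ + p + 2) = ε • capS u (κ + p + 2) := by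
        rw [tl, ← mul_assoc, h.cap_cup_succ, smul_mul_assoc, one_mul]
      rw [capNest_succ, capNest_succ, ← add_assoc, ← add_assoc, mul_assoc _ (capS u (κ + p + 1)), e1,
        mul_assoc _ (capS u (κ + p + 1)), e2, mul_smul_comm, mul_smul_comm, mul_assoc, mul_assoc,
        capS_mul_capS _ _ le_rfl]

/-- The operator `x_a ↦ u_{a i} ∑ b, v_{b j} x_b`; up to a scalar, this is the adjoint of `l_i^j`. -/
def capCup (u v : Matrix (Fin n) (Fin n) K) (i j : Fin n) : Matrix (Fin n) (Fin n) K :=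
  Matrix.of fun a b => u a i * v b j

lemma lMat_apply (i j a b : Fin n) : lMat R i j a b = if b = i then matB R a j else 0 := by
  simp only [lMat, hMat, Matrix.sum_apply, Matrix.smul_apply, Matrix.single_apply, smul_eq_mul]
  rw [Finset.sum_eq_single a (fun c _ hc => by simp [hc]) (by simp)]
  simp [eq_comm]

namespace IsCupCap

variable (D : IsCupCap q R u v ε)

include D

lemma inv_eq : v⁻¹ = ε • u :=
  Matrix.inv_eq_left_inv (by rw [Matrix.smul_mul, D.snake.cap_cup, smul_smul, D.snake.sign, one_smul])

lemma tensForm_eq (k : ℕ) (g f : Tens K n k) (c : ℕ → Fin n) :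
    tensForm v k g f = ε ^ k * capNest u 0 k (pairEmb k k g f) c := by
  rw [capNest_apply, Finset.mul_sum, tensForm]
  refine Finset.sum_congr rfl fun a _ => ?_
  rw [Finset.mul_sum]
  refine Finset.sum_congr rfl fun b _ => ?_
  have h1 : win k k (joinAt 0 k a b c) = b := by
    funext s
    simp [win, joinAt]
  rw [pairEmb_apply, win_joinAt, h1, D.inv_eq]
  simp only [Matrix.smul_apply, smul_eq_mul, Finset.prod_mul_distrib, Finset.prod_const,
    Finset.card_univ, Fintype.card_fin]
  ring

lemma tensForm_adjoint {k : ℕ} {S T : Module.End K (Tens K n k)}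
    (h : capNest u 0 k * ext 0 k S = capNest u 0 k * ext k k T) (g f : Tens K n k) :
    tensForm v k (S g) f = tensForm v k g (T f) := by
  have := D.nonempty
  have c : ℕ → Fin n := fun _ => Classical.arbitrary _
  rw [D.tensForm_eq k _ _ c, D.tensForm_eq k _ _ c, ← ext_pairEmb_left, ← ext_pairEmb_right,
    ← Module.End.mul_apply, ← Module.End.mul_apply, h]

/-- Contracting the form with the tensor power of `v` inverts it, so each coefficient of `g` is a
combination of values `tensForm v k g f`. -/
lemma tensForm_nondegenerate {k : ℕ} {g : Tens K n k} (h : ∀ f, tensForm v k g f = 0) : g = 0 := by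
  funext c
  have hv : v⁻¹ * v.transpose.transpose = 1 := by
    rw [Matrix.transpose_transpose, D.inv_eq, Matrix.smul_mul, D.snake.cap_cup, smul_smul,
      D.snake.sign, one_smul]
  have h1 : ∑ b : Fin k → Fin n, tensForm v k g (Pi.single b 1) *
      ∏ s, v.transpose (c s.rev) (b s) = g c := by
    have h2 : ∀ b : Fin k → Fin n, tensForm v k g (Pi.single b 1) =
        ∑ a : Fin k → Fin n, g a * ∏ s, v⁻¹ (a s.rev) (b s) := fun b => by
      refine Finset.sum_congr rfl fun a _ => ?_
      rw [Finset.sum_eq_single b (fun b' _ hb => by simp [hb]) (by simp)]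
      simp
    simp only [h2, Finset.sum_mul]
    rw [Finset.sum_comm]
    have h3 : ∀ a : Fin k → Fin n, ∑ b : Fin k → Fin n, g a * (∏ s, v⁻¹ (a s.rev) (b s)) *
        ∏ s, v.transpose (c s.rev) (b s) = g a * ∏ s, (if a s = c s then 1 else 0) :=
      fun a => by
        simp only [← Matrix.one_apply]
        rw [← hv, ← sum_prod_rev, Finset.mul_sum]
        exact Finset.sum_congr rfl fun b _ => mul_assoc _ _ _
    simp only [h3]
    rw [Finset.sum_eq_single c]
    · simp
    · intro a _ hac
      obtain ⟨s, hs⟩ := Function.ne_iff.mp hac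
      rw [Finset.prod_eq_zero (Finset.mem_univ s) (if_neg hs), mul_zero]
    · simp
  rw [← h1]
  simp [h]

/-- Generators slide through the caps to mirror generators, so behind the caps the left projector
absorbs the right one and conversely. The product of the two commuting projectors thus equals each
of them. -/
lemma capNest_mul_jw (k : ℕ) : capNest u 0 k * jw q (tl u v) k =
    capNest u 0 k * jw q (fun s => tl u v (k + s)) k := by
  have h1 : ∀ p, p + 1 < k → capNest u 0 k * tl u v p = capNest u 0 k * tl u v (k + (k - 2 - p)) := by
    intro p hp
    simpa using D.snake.capNest_mul_tl 0 (i := k) (p := p) (r := k + (k - 2 - p)) (by omega) hp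
  have h2 : capNest u 0 k * jw q (tl u v) k * jw q (fun s => tl u v (k + s)) k =
      capNest u 0 k * jw q (tl u v) k := mul_jw_eq k fun s hs => by
    have hc : Commute (tl u v (k + s)) (jw q (tl u v) k) := commute_jw k fun t ht =>
      ((D.isTL (k + s + 1)).comm t (k + s) (by omega) (by omega)).symm
    have h3 := h1 (k - 2 - s) (by omega)
    rw [show k - 2 - (k - 2 - s) = s by omega] at h3
    rw [mul_assoc, ← hc.eq, ← mul_assoc, ← h3, mul_assoc,
      e_mul_jw D.ne_zero D.generic (D.isTL k) (by omega) (by omega), mul_zero]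
  have h4 : capNest u 0 k * jw q (fun s => tl u v (k + s)) k * jw q (tl u v) k =
      capNest u 0 k * jw q (fun s => tl u v (k + s)) k := mul_jw_eq k fun s hs => by
    have hc : Commute (tl u v s) (jw q (fun s => tl u v (k + s)) k) := commute_jw k fun t ht =>
      (D.isTL (k + t + 1)).comm s (k + t) (by omega) (by omega)
    rw [mul_assoc, ← hc.eq, ← mul_assoc, h1 s hs, mul_assoc,
      e_mul_jw (e := fun s => tl u v (k + s)) D.ne_zero D.generic (D.isTL_shift k k) (by omega)
        (by omega), mul_zero]
  rw [← h2, mul_assoc, (D.commute_two k k).eq, ← mul_assoc, h4]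

lemma tensForm_symProj (k : ℕ) (g f : Tens K n k) :
    tensForm v k (symProj q R k g) f = tensForm v k g (symProj q R k f) :=
  D.tensForm_adjoint (by rw [D.ext_symProj_zero, D.ext_symProj, D.capNest_mul_jw]) g f

lemma form_nondegenerate {k : ℕ} {g : SymPower q R k} (h : ∀ f, form q R v k g f = 0) : g = 0 := by
  refine Subtype.ext (D.tensForm_nondegenerate fun f => ?_)
  rw [← D.symProj_coe g, D.tensForm_symProj]
  exact h ⟨_, f, rfl⟩

lemma form_compress {k : ℕ} {S T : Module.End K (Tens K n k)}
    (h : ∀ g f, tensForm v k (S g) f = tensForm v k g (T f)) (g f : SymPower q R k) :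
    form q R v k (compress q R k S g) f = form q R v k g (compress q R k T f) := by
  have h1 : form q R v k (compress q R k S g) f =
    tensForm v k (symProj q R k (S (g : Tens K n k))) f := rfl
  have h2 : form q R v k g (compress q R k T f) =
    tensForm v k g (symProj q R k (T (f : Tens K n k))) := rfl
  rw [h1, h2, D.tensForm_symProj, D.symProj_coe, ← D.tensForm_symProj, D.symProj_coe, h]

/-- The form pairs the last factor on the left with the first on the right, so the adjoint of an
operator on the first factor acts on the last one. -/
lemma tensForm_site {k : ℕ} (hk : 0 < k) {X Y : Matrix (Fin n) (Fin n) K}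
    (h : X * u = u * Y.transpose) (g f : Tens K n k) :
    tensForm v k (siteAt k ⟨k - 1, by omega⟩ X g) f = tensForm v k g (firstSite k Y f) := by
  refine D.tensForm_adjoint ?_ g f
  rw [ext_siteAt, ext_firstSite _ hk]
  have := capNest_mul_siteS h 0 (i := k) (p := k - 1) (r := k) (by omega) (by omega)
  simpa using this

lemma capCup_mul (i j : Fin n) :
    ((q⁻¹ * q⁻¹) • capCup u v i j) * u = u * (lMat R i j).transpose := by
  ext a b
  have h2 : (u * (lMat R i j).transpose) a b = u a i * matB R b j := by
    simp only [Matrix.mul_apply, Matrix.transpose_apply, lMat_apply]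
    rw [Finset.sum_eq_single i (fun c _ hc => by simp [hc]) (by simp), if_pos rfl]
  have h3 : (capCup u v i j * u) a b = u a i * (u.transpose * v) b j := by
    rw [Matrix.mul_apply, Matrix.mul_apply, Finset.mul_sum]
    refine Finset.sum_congr rfl fun c _ => ?_
    rw [capCup, Matrix.of_apply, Matrix.transpose_apply]
    ring
  rw [h2, matB_eq D.ne_zero D.braiding D.snake, Matrix.smul_mul, Matrix.smul_apply,
    Matrix.smul_apply, h3, smul_eq_mul, smul_eq_mul, mul_left_comm]

end IsCupCap

end Form

end BraidedIndex


namespace BraidedIndex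

/-! ### Partial traces, and the comparison of the `B`- and `C`-traces -/

section Trace

open MulOpposite (op unop)

variable {K : Type*} [Field K] {n : ℕ} {q ε : K} {R : PairMat K n}
  {u v : Matrix (Fin n) (Fin n) K}

lemma subst_comm {l m l' m' : ℕ} (h : l + m ≤ l' ∨ l' + m' ≤ l) (a : Fin m → Fin n)
    (a' : Fin m' → Fin n) (c : ℕ → Fin n) :
    subst l m a (subst l' m' a' c) = subst l' m' a' (subst l m a c) := by
  funext t
  simp only [subst]
  split_ifs <;> first | rfl | omega

lemma commute_ext (k m : ℕ) (S : Module.End K (Tens K n k)) (T : Module.End K (Tens K n m)) :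
    Commute (ext 0 k S) (ext k m T) := by
  refine LinearMap.ext fun W => funext fun c => ?_
  rw [Module.End.mul_apply, ext_ext_apply, Module.End.mul_apply, ext_apply k m,
    map_eq_sum_single T, Finset.sum_apply, Finset.sum_comm]
  refine Finset.sum_congr rfl fun b _ => ?_
  rw [Pi.smul_apply, ext_apply, map_eq_sum_single S, Finset.sum_apply, smul_eq_mul, Finset.sum_mul,
    win_subst_of_disjoint (by omega)]
  refine Finset.sum_congr rfl fun a _ => ?_
  rw [Pi.smul_apply, smul_eq_mul, subst_comm (by omega)]
  ring

lemma capNest_mul_ext (k m : ℕ) (S : Module.End K (Tens K n k)) :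
    capNest u k m * ext 0 k S = ext 0 k S * capNest u k m := by
  refine LinearMap.ext fun W => funext fun c => ?_
  rw [Module.End.mul_apply, Module.End.mul_apply, capNest_apply, ext_apply]
  have h1 : ∀ (a b : Fin m → Fin n), win 0 k (joinAt k m a b c) = win 0 k c := fun a b => by
    funext s
    simp [win, joinAt]
  have h2 : ∀ (a b : Fin m → Fin n) (a' : Fin k → Fin n),
      subst 0 k a' (joinAt k m a b c) = joinAt k m a b (subst 0 k a' c) := fun a b a' => by
    funext t
    simp only [subst, joinAt]
    split_ifs <;> first | rfl | omega
  have h3 : (fun a' => capNest u k m W (subst 0 k a' c)) = ∑ a : Fin m → Fin n,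
      ∑ b : Fin m → Fin n, (∏ s, u (a s.rev) (b s)) •
        fun a' => W (joinAt k m a b (subst 0 k a' c)) := by
    funext a'
    simp [capNest_apply, Finset.sum_apply]
  rw [h3]
  simp only [map_sum, map_smul, Finset.sum_apply, Pi.smul_apply, smul_eq_mul, ext_apply, h1, h2]

/-- The operator on infinite words given by an element of `End_r(V_(k)) ⊗ End(V_(m))ᵒᵖ`. -/
def stableOp (q : K) (R : PairMat K n) (k m : ℕ) :
    EndOp q R k ⊗[K] EndOp q R m →ₗ[K] Module.End K (Stab K n) :=
  TensorProduct.lift (LinearMap.mk₂ K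
    (fun S T => ext 0 k (inflate q R k (unop S)) * ext k m (inflate q R m (unop T)))
    (fun _ _ _ => by rw [MulOpposite.unop_add, inflate_add, map_add, add_mul])
    (fun _ _ _ => by rw [MulOpposite.unop_smul, inflate_smul, map_smul, smul_mul_assoc])
    (fun _ _ _ => by rw [MulOpposite.unop_add, inflate_add, map_add, mul_add])
    (fun _ _ _ => by rw [MulOpposite.unop_smul, inflate_smul, map_smul, mul_smul_comm]))

lemma stableOp_tmul (k m : ℕ) (S : EndOp q R k) (T : EndOp q R m) :
    stableOp q R k m (S ⊗ₜ T) =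
      ext 0 k (inflate q R k (unop S)) * ext k m (inflate q R m (unop T)) := rfl

/-- The operator on `V_(k) ⊗ V_(m)` given by an element of `End_r(V_(k)) ⊗ End(V_(m))ᵒᵖ`. -/
def pairOp (q : K) (R : PairMat K n) (k m : ℕ) : EndOp q R k ⊗[K] EndOp q R m →ₗ[K]
    Module.End K (SymPower q R k ⊗[K] SymPower q R m) :=
  TensorProduct.homTensorHomMap (.id K) _ _ _ _ ∘ₗ TensorProduct.map
    (MulOpposite.opLinearEquiv K).symm.toLinearMap (MulOpposite.opLinearEquiv K).symm.toLinearMap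

lemma pairOp_tmul (k m : ℕ) (S : EndOp q R k) (T : EndOp q R m) :
    pairOp q R k m (S ⊗ₜ T) = TensorProduct.map (unop S) (unop T) := rfl

lemma pairOp_injective (k m : ℕ) : Function.Injective (pairOp q R k m) := by
  have h1 : Function.Injective (TensorProduct.homTensorHomMap (.id K) (SymPower q R k)
      (SymPower q R m) (SymPower q R k) (SymPower q R m)) := by
    have := (homTensorHomEquiv K (SymPower q R k) (SymPower q R m) (SymPower q R k)
      (SymPower q R m)).injective
    rwa [← LinearEquiv.coe_coe, homTensorHomEquiv_toLinearMap] at this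
  have h2 : Function.Injective (TensorProduct.map
      (MulOpposite.opLinearEquiv K (M := Module.End K (SymPower q R k))).symm.toLinearMap
      (MulOpposite.opLinearEquiv K (M := Module.End K (SymPower q R m))).symm.toLinearMap) :=
    (TensorProduct.congr (MulOpposite.opLinearEquiv K).symm
      (MulOpposite.opLinearEquiv K).symm).injective
  exact h1.comp h2

lemma pairOp_one (k m : ℕ) : pairOp q R k m 1 = 1 := by
  rw [Algebra.TensorProduct.one_def, pairOp_tmul]
  exact TensorProduct.map_id

/-- Both factors are opposite algebras, hence the reversal; it is harmless for polynomials in a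
single element. -/
lemma pairOp_mul (k m : ℕ) (X Y : EndOp q R k ⊗[K] EndOp q R m) :
    pairOp q R k m (X * Y) = pairOp q R k m Y * pairOp q R k m X := by
  induction X with
  | zero => simp
  | add x y hx hy => rw [add_mul, map_add, map_add, hx, hy, mul_add]
  | tmul S T =>
    induction Y with
    | zero => simp
    | add x y hx hy => rw [mul_add, map_add, map_add, hx, hy, add_mul]
    | tmul S' T' =>
      rw [Algebra.TensorProduct.tmul_mul_tmul, pairOp_tmul, pairOp_tmul, pairOp_tmul]
      exact TensorProduct.map_comp (unop S') (unop T') (unop S) (unop T)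

lemma pairOp_aeval (k m : ℕ) (X : EndOp q R k ⊗[K] EndOp q R m) (p : Polynomial K) :
    pairOp q R k m (Polynomial.aeval X p) = Polynomial.aeval (pairOp q R k m X) p := by
  have h1 : ∀ N : ℕ, pairOp q R k m (X ^ N) = pairOp q R k m X ^ N := fun N => by
    induction N with
    | zero => rw [pow_zero, pow_zero, pairOp_one]
    | succ N ih => rw [pow_succ, pairOp_mul, ih, pow_succ']
  rw [Polynomial.aeval_eq_sum_range, Polynomial.aeval_eq_sum_range, map_sum]
  simp only [map_smul, h1]

lemma pairOp_extLkm (k m : ℕ) {A : Type*} [Ring A] [Algebra K A] (ρ : A →ₐ[K] EndOp q R k)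
    (l : Fin n → Fin n → A) : pairOp q R k m (extLkm q R k m ρ l) = casOp q R k m ρ l := by
  simp only [extLkm, extL, casOp, map_sum, pairOp_tmul, MulOpposite.unop_op]

/-- The partial trace over `V_(m)`. -/
noncomputable def partialTrace (q : K) (R : PairMat K n) (k m : ℕ) :
    EndOp q R k ⊗[K] EndOp q R m →ₗ[K] Module.End K (SymPower q R k) :=
  TensorProduct.lift (LinearMap.mk₂ K (fun S T => traceL q R m (unop T) • unop S)
    (fun _ _ _ => by simp) (fun _ _ _ => by rw [MulOpposite.unop_smul, smul_comm])
    (fun _ _ _ => by simp [add_smul]) (fun _ _ _ => by simp [mul_smul]))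

lemma partialTrace_tmul (k m : ℕ) (S : EndOp q R k) (T : EndOp q R m) :
    partialTrace q R k m (S ⊗ₜ T) = traceL q R m (unop T) • unop S := rfl

lemma boldTrace_eq (k m : ℕ) (X : EndOp q R k ⊗[K] EndOp q R m) :
    boldTrace q R k m X = traceR q R k (partialTrace q R k m X) := by
  induction X with
  | zero => simp
  | add x y hx hy => simp only [map_add, hx, hy]
  | tmul S T =>
    rw [partialTrace_tmul, map_smul, smul_eq_mul, mul_comm]
    rfl

lemma traceL_partialTrace (k m : ℕ) (X : EndOp q R k ⊗[K] EndOp q R m) :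
    traceL q R k (partialTrace q R k m X) = LinearMap.trace K _
      (TensorProduct.map (compress q R k (tensPow k (q ^ 2 • matC R)))
        (compress q R m (tensPow m (q ^ 2 • matC R))) * pairOp q R k m X) := by
  induction X with
  | zero => simp
  | add x y hx hy => simp only [map_add, mul_add, hx, hy]
  | tmul S T =>
    rw [partialTrace_tmul, map_smul, smul_eq_mul, pairOp_tmul, Module.End.mul_eq_comp,
      ← TensorProduct.map_comp, LinearMap.trace_tensorProduct', mul_comm]
    rfl

lemma sum_prod_mul {m : ℕ} (X Y : Matrix (Fin n) (Fin n) K) (a c : Fin m → Fin n) :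
    ∑ b : Fin m → Fin n, (∏ s, X (a s) (b s)) * ∏ s, Y (b s) (c s) =
      ∏ s, (X * Y) (a s) (c s) := by
  simp only [Matrix.mul_apply, ← Finset.prod_mul_distrib]
  rw [Finset.prod_univ_sum, Fintype.piFinset_univ]

lemma prod_rev {m : ℕ} (X : Matrix (Fin n) (Fin n) K) (a c : Fin m → Fin n) :
    ∏ s : Fin m, X (a s.rev) (c s) = ∏ s : Fin m, X (a s) (c s.rev) := by
  rw [← Equiv.prod_comp Fin.revPerm]
  simp

lemma tensForm_tensPow {X Y : Matrix (Fin n) (Fin n) K} (h : X * v⁻¹ = v⁻¹ * Y.transpose) (k : ℕ)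
    (g f : Tens K n k) : tensForm v k (tensPow k X g) f = tensForm v k g (tensPow k Y f) := by
  have e1 : tensForm v k (tensPow k X g) f = ∑ a : Fin k → Fin n, ∑ b : Fin k → Fin n,
      g a * f b * ∏ s : Fin k, (X * v⁻¹) (a s) (b s.rev) := by
    simp only [tensForm, tensPow, LinearMap.coe_mk, AddHom.coe_mk, Finset.sum_mul]
    rw [Finset.sum_comm_cycle]
    refine Finset.sum_congr rfl fun a _ => ?_
    rw [Finset.sum_comm]
    refine Finset.sum_congr rfl fun b _ => ?_
    rw [← sum_prod_mul X v⁻¹ a fun s => b s.rev, Finset.mul_sum]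
    refine Finset.sum_congr rfl fun c _ => ?_
    rw [prod_rev]
    ring
  have e2 : tensForm v k g (tensPow k Y f) = ∑ a : Fin k → Fin n, ∑ b : Fin k → Fin n,
      g a * f b * ∏ s : Fin k, (v⁻¹ * Y.transpose) (a s) (b s.rev) := by
    simp only [tensForm, tensPow, LinearMap.coe_mk, AddHom.coe_mk, Finset.mul_sum, Finset.sum_mul]
    refine Finset.sum_congr rfl fun a _ => ?_
    rw [Finset.sum_comm]
    refine Finset.sum_congr rfl fun b _ => ?_
    rw [← prod_rev, ← sum_prod_mul v⁻¹ Y.transpose (fun s => a s.rev) b, Finset.mul_sum]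
    refine Finset.sum_congr rfl fun c _ => ?_
    simp only [Matrix.transpose_apply]
    ring
  rw [e1, e2, h]

namespace IsCupCap

variable (D : IsCupCap q R u v ε)

include D

lemma stableOp_mul (k m : ℕ) (X Y : EndOp q R k ⊗[K] EndOp q R m) :
    stableOp q R k m (X * Y) = stableOp q R k m Y * stableOp q R k m X := by
  induction X with
  | zero => simp
  | add x y hx hy => rw [add_mul, map_add, map_add, hx, hy, mul_add]
  | tmul S T =>
    induction Y with
    | zero => simp
    | add x y hx hy => rw [mul_add, map_add, map_add, hx, hy, add_mul]
    | tmul S' T' =>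
      rw [Algebra.TensorProduct.tmul_mul_tmul, stableOp_tmul, stableOp_tmul, stableOp_tmul,
        MulOpposite.unop_mul, MulOpposite.unop_mul, D.inflate_mul, D.inflate_mul, map_mul, map_mul,
        mul_assoc, mul_assoc, ← mul_assoc (ext 0 k (inflate q R k (unop S))),
        (commute_ext k m _ _).eq]
      simp only [mul_assoc]

lemma stableOp_one (k m : ℕ) : stableOp q R k m 1 = twoJW q u v k m := by
  rw [Algebra.TensorProduct.one_def, stableOp_tmul, MulOpposite.unop_one, MulOpposite.unop_one,
    inflate_one, inflate_one, D.ext_symProj_zero, D.ext_symProj, twoJW]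

lemma stableOp_aeval_mem {k m : ℕ} {X : EndOp q R k ⊗[K] EndOp q R m}
    (hX : stableOp q R k m X ∈ tlAlg K (tl u v) (k + m)) (p : Polynomial K) :
    stableOp q R k m (Polynomial.aeval X p) ∈ tlAlg K (tl u v) (k + m) := by
  have h1 : ∀ N : ℕ, stableOp q R k m (X ^ N) ∈ tlAlg K (tl u v) (k + m) := fun N => by
    induction N with
    | zero => rw [pow_zero, D.stableOp_one]; exact twoJW_mem k m
    | succ N ih => rw [pow_succ, D.stableOp_mul]; exact mul_mem hX ih
  rw [Polynomial.aeval_eq_sum_range, map_sum]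
  refine sum_mem fun N _ => ?_
  rw [map_smul]
  exact Subalgebra.smul_mem _ (h1 N) _

lemma pairMap_pairOp (k m : ℕ) (X : EndOp q R k ⊗[K] EndOp q R m)
    (z : SymPower q R k ⊗[K] SymPower q R m) :
    pairMap q R k m (pairOp q R k m X z) = stableOp q R k m X (pairMap q R k m z) := by
  induction X with
  | zero => simp
  | add x y hx hy => simp only [map_add, LinearMap.add_apply, hx, hy]
  | tmul S T => rw [pairOp_tmul, stableOp_tmul, D.pairMap_map', Module.End.mul_apply]

/-- The caps commute with operators on the first `k` places, so closing the last `m` strands only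
affects the second tensor factor, where it yields `traceL`. -/
lemma closure_stableOp (k m : ℕ) (X : EndOp q R k ⊗[K] EndOp q R m) :
    capNest u k m * stableOp q R k m X * nest v k m =
      ext 0 k (inflate q R k (partialTrace q R k m X)) := by
  induction X with
  | zero =>
    rw [map_zero, map_zero, mul_zero, zero_mul]
    have : inflate q R k 0 = 0 := by ext; simp [inflate]
    rw [this, map_zero]
  | add x y hx hy => rw [map_add, map_add, mul_add, add_mul, hx, hy, inflate_add, map_add]
  | tmul S T =>
    rw [stableOp_tmul, partialTrace_tmul, ← mul_assoc, capNest_mul_ext, mul_assoc, mul_assoc,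
      ← mul_assoc (capNest u k m), D.closure_inflate, inflate_smul, map_smul, mul_smul_comm, mul_one]

/-- The closure of a Temperley--Lieb element on `k + m` strands is a Temperley--Lieb element on `k`
strands, and the projector on `V_(k)` reduces it to a scalar. -/
lemma partialTrace_eq {k m : ℕ} {X : EndOp q R k ⊗[K] EndOp q R m}
    (hX : stableOp q R k m X ∈ tlAlg K (tl u v) (k + m)) :
    ∃ c : K, partialTrace q R k m X = c • 1 := by
  have := D.nonempty
  have h1 := D.snake.closure_mem hX
  rw [D.closure_stableOp] at h1
  obtain ⟨c, hc⟩ := jw_mul_mem_tlAlg D.ne_zero D.generic (D.isTL k) (by omega) h1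
  refine ⟨c, D.inflate_injective k (ext_injective k ?_)⟩
  rw [inflate_smul, inflate_one, map_smul, D.ext_symProj_zero, ← hc, ← D.ext_symProj_zero,
    ← map_mul, ← inflate_one, ← D.inflate_mul, one_mul]

/-- The nondegenerate form identifies the space with its dual and conjugates `S` into the transpose
of `T`. -/
lemma trace_eq_of_tensForm {k : ℕ} {S T : Module.End K (Tens K n k)}
    (h : ∀ g f, tensForm v k (S g) f = tensForm v k g (T f)) :
    LinearMap.trace K _ S = LinearMap.trace K _ T := by
  let b : Tens K n k →ₗ[K] Module.Dual K (Tens K n k) := LinearMap.mk₂ K (tensForm v k)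
    (fun _ _ _ => by simp [tensForm, add_mul, Finset.sum_add_distrib])
    (fun _ _ _ => by rw [tensForm_smul_left, smul_eq_mul])
    (fun _ _ _ => by simp [tensForm, mul_add, add_mul, Finset.sum_add_distrib])
    (fun _ _ _ => by rw [tensForm_smul_right, smul_eq_mul])
  have hb : Function.Injective b := by
    rw [injective_iff_map_eq_zero]
    exact fun g hg => D.tensForm_nondegenerate fun f => LinearMap.congr_fun hg f
  let e : Tens K n k ≃ₗ[K] Module.Dual K (Tens K n k) :=
    LinearEquiv.ofInjectiveOfFinrankEq b hb (Subspace.dual_finrank_eq).symm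
  rw [← LinearMap.trace_transpose' T, ← LinearMap.trace_conj' S e]
  congr 1
  refine LinearMap.ext fun φ => ?_
  obtain ⟨g, rfl⟩ := e.surjective φ
  rw [LinearEquiv.conj_apply_apply, LinearEquiv.symm_apply_apply]
  exact LinearMap.ext fun f => h g f

/-- The form makes `(q²C)^{⊗k}` adjoint to `(q²B)^{⊗k}` and the symmetrizer self-adjoint, and
adjoint operators have equal traces. -/
lemma traceR_one (k : ℕ) : traceR q R k 1 = traceL q R k 1 := by
  have h1 : traceR q R k 1 = LinearMap.trace K _ (tensPow k (u.transpose * v) * symProj q R k) := by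
    rw [← inflate_one, ← trace_mul_compress, ← D.sq_smul_matB]
    rfl
  have h2 : traceL q R k 1 = LinearMap.trace K _ (tensPow k (u * v.transpose) * symProj q R k) := by
    rw [← inflate_one, ← trace_mul_compress, ← D.sq_smul_matC]
    rfl
  rw [h1, h2, LinearMap.trace_mul_comm]
  refine (D.trace_eq_of_tensForm fun g f => ?_).symm
  rw [Module.End.mul_apply, Module.End.mul_apply, ← D.tensForm_symProj]
  refine tensForm_tensPow ?_ k _ f
  rw [D.inv_eq, Matrix.mul_smul, Matrix.smul_mul, Matrix.transpose_mul, Matrix.transpose_transpose,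
    mul_assoc]

/-- `traceR` and `traceL` need not agree in general, but the partial trace is a scalar, so `traceR`
may be replaced by `traceL`. Both tensor factors are then weighted by `C`. -/
lemma boldTrace_eq_trace {k m : ℕ} {X : EndOp q R k ⊗[K] EndOp q R m}
    (hX : stableOp q R k m X ∈ tlAlg K (tl u v) (k + m)) :
    boldTrace q R k m X = LinearMap.trace K _
      (TensorProduct.map (compress q R k (tensPow k (q ^ 2 • matC R)))
        (compress q R m (tensPow m (q ^ 2 • matC R))) * pairOp q R k m X) := by
  obtain ⟨c, hc⟩ := D.partialTrace_eq hX
  rw [← traceL_partialTrace, boldTrace_eq, hc, map_smul, map_smul, D.traceR_one]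

end IsCupCap

end Trace

end BraidedIndex


namespace BraidedIndex

/-! ### Compatibility of the weights `C` with the embeddings of the components -/

section Decomposition

open MulOpposite (op unop)

variable {K : Type*} [Field K] {n : ℕ} {q ε : K} {R : PairMat K n}
  {u v X : Matrix (Fin n) (Fin n) K}

lemma commute_siteS_tl {s t : ℕ} (h : t < s ∨ s + 2 ≤ t) : Commute (siteS t X) (tl u v s) := by
  rcases h with h | h
  · rw [Commute, SemiconjBy, tl, ← mul_assoc, siteS_mul_cupS_of_lt _ _ h, mul_assoc,
      ← capS_mul_siteS_of_lt _ _ h, ← mul_assoc]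
  · obtain ⟨t, rfl⟩ : ∃ t', t = t' + 2 := ⟨t - 2, by omega⟩
    rw [Commute, SemiconjBy, tl, ← mul_assoc, siteS_mul_cupS_of_le _ _ (by omega), mul_assoc,
      ← capS_mul_siteS_of_le _ _ (by omega), ← mul_assoc]

lemma powS_add (l k m : ℕ) : powS X l (k + m) = powS X (l + k) m * powS X l k := by
  induction m with
  | zero => simp [powS]
  | succ m ih => rw [← add_assoc, powS, ih, powS, mul_assoc, add_assoc l]

lemma powS_mul_cupS_of_le {l m s : ℕ} (h : l + m ≤ s) :
    powS X l m * cupS v s = cupS v s * powS X l m := by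
  induction m with
  | zero => simp [powS]
  | succ m ih =>
    rw [powS, mul_assoc, ih (by omega), ← mul_assoc, siteS_mul_cupS_of_lt _ _ (by omega), mul_assoc]

lemma commute_powS_tl_of_le {l m s : ℕ} (h : l + m ≤ s) : Commute (powS X l m) (tl u v s) := by
  induction m with
  | zero => exact Commute.one_left _
  | succ m ih => exact (commute_siteS_tl (by omega)).mul_left (ih (by omega))

lemma commute_powS_tl_of_ge {l m s : ℕ} (h : s + 2 ≤ l) : Commute (powS X l m) (tl u v s) := by
  induction m with
  | zero => exact Commute.one_left _
  | succ m ih => exact (commute_siteS_tl (by omega)).mul_left ih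

lemma powS_emb (N : ℕ) (w : Tens K n N) : powS X 0 N (emb N w) = emb N (tensPow N X w) := by
  rw [← ext_tensPow, ext_emb]

lemma aeval_apply_of_eq_smul {M : Type*} [AddCommMonoid M] [Module K M] {f : Module.End K M}
    {x : M} {c : K} (h : f x = c • x) (p : Polynomial K) :
    Polynomial.aeval f p x = p.eval c • x := by
  induction p using Polynomial.induction_on' with
  | add p r hp hr => rw [map_add, LinearMap.add_apply, hp, hr, Polynomial.eval_add, add_smul]
  | monomial N a =>
    have h1 : (f ^ N) x = c ^ N • x := by
      induction N with
      | zero => simp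
      | succ N ih => rw [pow_succ', Module.End.mul_apply, ih, map_smul, h, smul_smul, pow_succ]
    rw [Polynomial.aeval_monomial, Module.End.mul_apply, h1, Polynomial.eval_monomial,
      Module.algebraMap_end_apply, smul_smul]

namespace IsSnake

variable (h : IsSnake q u v ε)

include h

/-- On `v` the two factors `u vᵀ` combine to two zigzags, so `v` is fixed by `(q²C)^{⊗2}`. -/
lemma powS_two_mul_cupS (s : ℕ) : siteS (s + 1) (u * v.transpose) *
    (siteS s (u * v.transpose) * cupS v s) = cupS v s := by
  rw [siteS_mul_cupS_left, siteS_mul_cupS_right]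
  congr 1
  rw [Matrix.transpose_mul, Matrix.transpose_transpose, mul_assoc v, mul_assoc v,
    ← Matrix.mul_assoc _ u, mul_assoc u.transpose, h.cup_cap, Matrix.mul_smul, mul_one,
    Matrix.smul_mul, ← Matrix.transpose_mul, h.cup_cap, Matrix.transpose_smul,
    Matrix.transpose_one, smul_smul, h.sign, one_smul, mul_one]

lemma capS_mul_powS_two (s : ℕ) : capS u s * (siteS (s + 1) (u * v.transpose) *
    siteS s (u * v.transpose)) = capS u s := by
  rw [← mul_assoc, capS_mul_siteS_right, capS_mul_siteS_left]
  congr 1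
  rw [Matrix.transpose_mul, Matrix.transpose_transpose, ← Matrix.mul_assoc u v, h.cap_cup,
    Matrix.smul_mul, one_mul, Matrix.mul_smul, mul_assoc, ← Matrix.transpose_mul, h.cap_cup,
    Matrix.transpose_smul, Matrix.transpose_one, Matrix.mul_smul, mul_one, smul_smul, h.sign,
    one_smul]

lemma commute_powS_tl (l : ℕ) {a s : ℕ} (hs : s + 1 < a) :
    Commute (powS (u * v.transpose) l a) (tl u v (l + s)) := by
  induction a with
  | zero => omega
  | succ a ih =>
    rcases Nat.lt_or_ge (s + 1) a with h1 | h1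
    · exact (commute_siteS_tl (by omega)).mul_left (ih h1)
    · obtain rfl : a = s + 1 := by omega
      rw [powS, powS, ← mul_assoc]
      refine Commute.mul_left ?_ (commute_powS_tl_of_le le_rfl)
      rw [Commute, SemiconjBy, tl, mul_assoc (cupS v _), ← add_assoc, h.capS_mul_powS_two,
        ← mul_assoc, mul_assoc (siteS _ _), h.powS_two_mul_cupS]

lemma powS_mul_cupS {s N : ℕ} (hs : s ≤ N) :
    powS (u * v.transpose) 0 (N + 2) * cupS v s = cupS v s * powS (u * v.transpose) 0 N := by
  induction N, hs using Nat.le_induction with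
  | base =>
    rw [powS, powS, ← mul_assoc, mul_assoc (_ * _), powS_mul_cupS_of_le (by omega),
      ← mul_assoc (_ * _), mul_assoc (siteS _ _) _ (cupS v s), zero_add, zero_add,
      h.powS_two_mul_cupS]
  | succ N hN ih =>
    rw [powS, mul_assoc, ih, ← mul_assoc, zero_add, siteS_mul_cupS_of_le _ _ hN, mul_assoc, powS,
      zero_add]

lemma powS_mul_nest {κ N : ℕ} (hκ : κ ≤ N) (i : ℕ) :
    powS (u * v.transpose) 0 (N + 2 * i) * nest v κ i =
      nest v κ i * powS (u * v.transpose) 0 N := by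
  induction i with
  | zero => simp
  | succ i ih =>
    rw [nest_succ, ← mul_assoc, show N + 2 * (i + 1) = N + 2 * i + 2 by ring,
      h.powS_mul_cupS (by omega), mul_assoc, ih, mul_assoc]

end IsSnake

namespace IsCupCap

variable (D : IsCupCap q R u v ε)

include D

/-- The tensor powers of `u vᵀ` commute with the generators, hence with all projectors, and pass
through nested cups unchanged. The weight on `V_(k) ⊗ V_(m)` therefore restricts to the weight of
each component. -/
lemma embed_compress {k m i : ℕ} (hik : i ≤ k) (him : i ≤ m) (w : SymPower q R (k + m - 2 * i)) :
    TensorProduct.map (compress q R k (tensPow k (q ^ 2 • matC R)))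
        (compress q R m (tensPow m (q ^ 2 • matC R))) (embed q R v hik him w) =
      embed q R v hik him (compress q R _ (tensPow _ (q ^ 2 • matC R)) w) := by
  apply D.pairMap_injective
  rw [D.pairMap_map', D.pairMap_embed', D.pairMap_embed', inflate_compress, inflate_compress,
    map_mul, map_mul, map_mul, map_mul, D.ext_symProj_zero, D.ext_symProj, ext_tensPow, ext_tensPow,
    D.sq_smul_matC]
  set x := u * v.transpose with hx
  have hL : Commute (powS x 0 k) (jw q (tl u v) k) := commute_jw k fun s hs => by
    simpa using D.snake.commute_powS_tl 0 hs
  have hR : Commute (powS x k m) (jw q (fun s => tl u v (k + s)) m) := commute_jw m fun s hs =>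
    D.snake.commute_powS_tl k hs
  have hLR : Commute (powS x 0 k) (jw q (fun s => tl u v (k + s)) m) := commute_jw m fun s hs =>
    commute_powS_tl_of_le (by omega)
  have hL2 := jw_idem D.ne_zero D.generic (D.isTL k) (a := k) (by omega)
  have hR2 := jw_idem (e := fun s => tl u v (k + s)) D.ne_zero D.generic (D.isTL_shift k m) (a := m)
    (by omega)
  have h1 : jw q (tl u v) k * powS x 0 k * jw q (tl u v) k *
      (jw q (fun s => tl u v (k + s)) m * powS x k m * jw q (fun s => tl u v (k + s)) m) *
      twoJW q u v k m = twoJW q u v k m * powS x 0 (k + m) := by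
    have hLZ : Commute (powS x k m) (jw q (tl u v) k) := commute_jw k fun s hs =>
      commute_powS_tl_of_ge (by omega)
    have hZ : Commute (powS x 0 k) (powS x k m) := by
      rw [← ext_tensPow, ← ext_tensPow]
      exact commute_ext k m _ _
    have hT : Commute (powS x 0 (k + m)) (twoJW q u v k m) := by
      rw [powS_add, zero_add, twoJW]
      exact (hLZ.mul_right hR).mul_left (hL.mul_right hLR)
    rw [← hT.eq, ← hL.eq, mul_assoc _ _ (jw q (tl u v) k), hL2, ← hR.eq, mul_assoc _ _ (jw q _ m),
      hR2]
    calc _ = powS x 0 k * (jw q (tl u v) k * powS x k m) * jw q (fun s => tl u v (k + s)) m *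
          twoJW q u v k m := by simp only [mul_assoc]
      _ = powS x 0 k * powS x k m * (twoJW q u v k m * twoJW q u v k m) := by
          rw [← hLZ.eq]
          simp only [mul_assoc, twoJW]
      _ = _ := by rw [D.twoJW_idem, hZ.eq, powS_add, zero_add]
  have h2 : (compress q R _ (tensPow (k + m - 2 * i) x) w : Tens K n (k + m - 2 * i)) =
      tensPow (k + m - 2 * i) x w := by
    have := D.nonempty
    have h3 : symProj q R (k + m - 2 * i) * tensPow (k + m - 2 * i) x =
        tensPow (k + m - 2 * i) x * symProj q R (k + m - 2 * i) := by
      apply ext_injective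
      rw [map_mul, map_mul, D.ext_symProj_zero, ext_tensPow]
      exact (commute_jw _ fun s hs => by simpa using D.snake.commute_powS_tl 0 hs).symm
    conv_rhs => rw [← D.symProj_coe w]
    exact (LinearMap.congr_fun h3 (w : Tens K n (k + m - 2 * i))).trans rfl
  have h4 : powS x 0 (k + m) * nest v (k - i) i =
      nest v (k - i) i * powS x 0 (k + m - 2 * i) := by
    have := D.snake.powS_mul_nest (κ := k - i) (N := k + m - 2 * i) (by omega) i
    rwa [show k + m - 2 * i + 2 * i = k + m by omega] at this
  rw [h2, ← powS_emb]
  simp only [← Module.End.mul_apply]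
  have h5 := congrArg (· * nest v (k - i) i) h1
  simp only [mul_assoc, h4] at h5 ⊢
  rw [h5]

end IsCupCap

end Decomposition

end BraidedIndex


namespace BraidedIndex

/-! ### Spectral decomposition of `L_(k,m)`, multiplicities and index -/

section Conclusions

open MulOpposite (op unop)

variable {K : Type*} [Field K] {n : ℕ} {q ε : K} {R : PairMat K n}
  {u v : Matrix (Fin n) (Fin n) K} {A : Type*} [Ring A] [Algebra K A] {k m : ℕ}
  {ρ : A →ₐ[K] EndOp q R k} {l : Fin n → Fin n → A} {μ : Fin (m + 1) → K}

/-- The ranges lie in eigenspaces of `g` for distinct eigenvalues, which makes their sum direct. The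
operator `f` is only required to preserve these ranges. -/
lemma trace_eq_sum_of_eq_smul {M ι : Type*} [AddCommGroup M] [Module K M]
    [FiniteDimensional K M] [Fintype ι] [DecidableEq ι] {W : ι → Type*} [∀ i, AddCommGroup (W i)]
    [∀ i, Module K (W i)] {e : ∀ i, W i →ₗ[K] M} (he : ∀ i, Function.Injective (e i))
    {μ : ι → K} (hinj : Function.Injective μ) {g : Module.End K M}
    (hg : ∀ i w, g (e i w) = μ i • e i w) (htop : ⨆ i, LinearMap.range (e i) = ⊤)
    {f : Module.End K M} {d : ∀ i, Module.End K (W i)} (hf : ∀ i w, f (e i w) = e i (d i w)) :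
    LinearMap.trace K M f = ∑ i, LinearMap.trace K (W i) (d i) := by
  have h : DirectSum.IsInternal fun i => LinearMap.range (e i) :=
    DirectSum.isInternal_submodule_of_iSupIndep_of_iSup_eq_top
      (((Module.End.eigenspaces_iSupIndep g).comp hinj).mono (by
        rintro i _ ⟨w, rfl⟩
        exact Module.End.mem_eigenspace_iff.mpr (hg i w))) htop
  have hmaps : ∀ i, Set.MapsTo f (LinearMap.range (e i)) (LinearMap.range (e i)) := by
    rintro i _ ⟨w, rfl⟩
    rw [hf]
    exact ⟨_, rfl⟩
  rw [LinearMap.trace_eq_sum_trace_restrict h hmaps]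
  refine Finset.sum_congr rfl fun i _ => ?_
  rw [← LinearMap.trace_conj' (d i) (LinearEquiv.ofInjective (e i) (he i))]
  congr 1
  refine LinearMap.ext fun x => ?_
  obtain ⟨w, rfl⟩ := (LinearEquiv.ofInjective (e i) (he i)).surjective x
  rw [LinearEquiv.conj_apply_apply, LinearEquiv.symm_apply_apply]
  exact Subtype.ext (hf i w)

lemma map_descend_extL (ρ : A →ₐ[K] EndOp q R k) (l : Fin n → Fin n → A) :
    Algebra.TensorProduct.map (descend ρ) (AlgHom.id K (EndOp q R m))
      (extL q R m fun a b => toCentralQuot ρ (l a b)) = extLkm q R k m ρ l := by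
  have h1 : ∀ x, descend ρ (toCentralQuot ρ x) = ρ x := fun x =>
    RingQuot.liftAlgHom_mkAlgHom_apply K ρ _ x
  simp only [extLkm, extL, map_sum, Algebra.TensorProduct.map_tmul, h1, AlgHom.coe_id, id_eq]

lemma qIndex_idem (i : Fin (m + 1)) : qIndex q R k m ρ (idem q R m ρ l μ i) =
    boldTrace q R k m (Polynomial.aeval (extLkm q R k m ρ l) (Lagrange.basis Finset.univ μ i)) := by
  rw [qIndex, idem, ← Polynomial.aeval_algHom_apply, map_descend_extL]

lemma twoJW_center_mem (hm : 1 ≤ m) (hmk : m ≤ k) {a b : K}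
    (hL : stableOp q R k m (extLkm q R k m ρ l) =
      a • (twoJW q u v k m * tl u v (k - 1) * twoJW q u v k m) + b • twoJW q u v k m) :
    stableOp q R k m (extLkm q R k m ρ l) ∈ tlAlg K (tl u v) (k + m) := by
  rw [hL]
  have h1 := twoJW_mem (q := q) (u := u) (v := v) k m
  exact add_mem (Subalgebra.smul_mem _ (mul_mem (mul_mem h1 (e_mem_tlAlg (by omega))) h1) _)
    (Subalgebra.smul_mem _ h1 _)

namespace IsCupCap

variable (D : IsCupCap q R u v ε)

include D

/-- The product annihilates every component, and the components span. -/
lemma aeval_eq_zero (hmk : m ≤ k) (hμ : AreEigenvalues q R v hmk ρ l μ) :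
    Polynomial.aeval (extLkm q R k m ρ l) (∏ i, (Polynomial.X - Polynomial.C (μ i))) = 0 := by
  apply pairOp_injective k m
  rw [pairOp_aeval, pairOp_extLkm, map_zero, ← LinearMap.ker_eq_top, ← top_le_iff,
    ← D.iSup_component hmk]
  refine iSup_le fun i x hx => ?_
  rw [LinearMap.mem_ker, aeval_apply_of_eq_smul (hμ i x hx), Polynomial.eval_prod,
    Finset.prod_eq_zero (Finset.mem_univ i) (by simp), zero_smul]

/-- On the `i`-th component `p(L_(k,m))` is the scalar `p(μ i)`, so the weighted ordinary trace
there is `p(μ i)` times the trace of the weight, which is the categorical dimension. -/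
lemma boldTrace_aeval (hmk : m ≤ k)
    (hL : stableOp q R k m (extLkm q R k m ρ l) ∈ tlAlg K (tl u v) (k + m))
    (hμ : AreEigenvalues q R v hmk ρ l μ) (hinj : Function.Injective μ) (p : Polynomial K) :
    boldTrace q R k m (Polynomial.aeval (extLkm q R k m ρ l) p) =
      ∑ i : Fin (m + 1), p.eval (μ i) * catDim q R (k + m - 2 * (i : ℕ)) := by
  rw [D.boldTrace_eq_trace (D.stableOp_aeval_mem hL p), pairOp_aeval, pairOp_extLkm]
  set c := TensorProduct.map (compress q R k (tensPow k (q ^ 2 • matC R)))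
    (compress q R m (tensPow m (q ^ 2 • matC R))) with hc
  have hmap : ∀ (i : Fin (m + 1)) (w : SymPower q R (k + m - 2 * (i : ℕ))),
      (c * Polynomial.aeval (casOp q R k m ρ l) p) (embed q R v
        ((Nat.lt_succ_iff.mp i.2).trans hmk) (Nat.lt_succ_iff.mp i.2) w) =
      embed q R v ((Nat.lt_succ_iff.mp i.2).trans hmk) (Nat.lt_succ_iff.mp i.2)
        ((p.eval (μ i) • compress q R _ (tensPow _ (q ^ 2 • matC R))) w) := by
    intro i w
    rw [Module.End.mul_apply, aeval_apply_of_eq_smul (hμ i _ ⟨w, rfl⟩), map_smul, hc,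
      D.embed_compress, LinearMap.smul_apply, map_smul]
  have key := trace_eq_sum_of_eq_smul (K := K) (M := SymPower q R k ⊗[K] SymPower q R m)
    (W := fun i : Fin (m + 1) => SymPower q R (k + m - 2 * (i : ℕ))) (μ := μ)
    (e := fun i : Fin (m + 1) => embed q R v ((Nat.lt_succ_iff.mp i.2).trans hmk)
      (Nat.lt_succ_iff.mp i.2)) (g := casOp q R k m ρ l)
    (f := c * Polynomial.aeval (casOp q R k m ρ l) p)
    (d := fun i => p.eval (μ i) • compress q R _ (tensPow _ (q ^ 2 • matC R)))
  refine (key ?_ hinj ?_ ?_ hmap).trans (Finset.sum_congr rfl fun i _ => ?_)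
  · exact fun i => D.embed_injective _ _
  · exact fun i w => hμ i _ ⟨w, rfl⟩
  · exact D.iSup_component hmk
  · rw [map_smul, smul_eq_mul, catDim, traceL, LinearMap.comp_apply, LinearMap.mulLeft_apply,
      mul_one]

lemma conclusions (hmk : m ≤ k)
    (hL : stableOp q R k m (extLkm q R k m ρ l) ∈ tlAlg K (tl u v) (k + m))
    (hμ : AreEigenvalues q R v hmk ρ l μ) (hinj : Function.Injective μ) :
    Polynomial.aeval (extLkm q R k m ρ l) (∏ i, (Polynomial.X - Polynomial.C (μ i))) = 0 ∧
      (∀ N : ℕ, boldTrace q R k m (extLkm q R k m ρ l ^ N) =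
        ∑ i : Fin (m + 1), μ i ^ N * catDim q R (k + m - 2 * (i : ℕ))) ∧
      ∀ i : Fin (m + 1),
        qIndex q R k m ρ (idem q R m ρ l μ i) = catDim q R (k + m - 2 * (i : ℕ)) ∧
        qIndex q R k m ρ (idem q R m ρ l μ i) = qInt q (m + k - 2 * (i : ℕ) + 1) := by
  have h1 : ∀ i, qIndex q R k m ρ (idem q R m ρ l μ i) = catDim q R (k + m - 2 * (i : ℕ)) := by
    intro i
    rw [qIndex_idem, D.boldTrace_aeval hmk hL hμ hinj, Finset.sum_eq_single i]
    · rw [Lagrange.eval_basis_self hinj.injOn (Finset.mem_univ i), one_mul]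
    · intro j _ hj
      rw [Lagrange.eval_basis_of_ne hj.symm (Finset.mem_univ j), zero_mul]
    · simp
  refine ⟨D.aeval_eq_zero hmk hμ, fun N => ?_, fun i => ⟨h1 i, ?_⟩⟩
  · have := D.boldTrace_aeval hmk hL hμ hinj (Polynomial.X ^ N)
    simpa using this
  · rw [h1, D.catDim_eq, add_comm k m]

lemma exists_areEigenvalues (hm : 1 ≤ m) (hmk : m ≤ k) {a b : K}
    (hL : stableOp q R k m (extLkm q R k m ρ l) =
      a • (twoJW q u v k m * tl u v (k - 1) * twoJW q u v k m) + b • twoJW q u v k m) :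
    ∃ μ : Fin (m + 1) → K, AreEigenvalues q R v hmk ρ l μ := by
  -- The fraction is the value of the junction generator between the projectors, from
  -- `twoJW_center`.
  refine ⟨fun i => a * (qInt q i * qInt q (k + m + 1 - i) / (qInt q m * qInt q k)) + b, ?_⟩
  rintro i _ ⟨w, rfl⟩
  apply D.pairMap_injective
  have hk : 1 ≤ k := hm.trans hmk
  rw [← pairOp_extLkm, D.pairMap_pairOp, hL, map_smul, D.pairMap_embed']
  set y := nest v (k - i) i (emb (k + m - 2 * i) (w : Tens K n (k + m - 2 * i))) with hy
  have h1 := D.twoJW_center hk hm ((Nat.lt_succ_iff.mp i.2).trans hmk) (Nat.lt_succ_iff.mp i.2) w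
  have h2 : (twoJW q u v k m * tl u v (k - 1) * twoJW q u v k m) (twoJW q u v k m y) =
      (twoJW q u v k m * tl u v (k - 1) * twoJW q u v k m) y := by
    rw [← Module.End.mul_apply, mul_assoc, D.twoJW_idem]
  have h3 : twoJW q u v k m (twoJW q u v k m y) = twoJW q u v k m y := by
    rw [← Module.End.mul_apply, D.twoJW_idem]
  rw [LinearMap.add_apply, LinearMap.smul_apply, LinearMap.smul_apply, h2, h3, h1, smul_smul,
    add_smul]

end IsCupCap

end Conclusions

end BraidedIndex


namespace BraidedIndex

/-! ### The adjoint generators: quadratic relation, quantum trace, and `L_(k,m)` -/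

section Generators

open MulOpposite (op unop)

variable {K : Type*} [Field K] {n : ℕ} {q ε : K} {R : PairMat K n}
  {u v : Matrix (Fin n) (Fin n) K} {k m : ℕ}

/-- The adjoint of the operator `(l_i^j)_(k)`. -/
noncomputable def adjGen (q : K) (R : PairMat K n) (u v : Matrix (Fin n) (Fin n) K) {k : ℕ}
    (hk : 0 < k) (i j : Fin n) : Module.End K (SymPower q R k) :=
  (q ^ (1 - (k : ℤ)) * qInt q k) •
    compress q R k (siteAt k ⟨k - 1, by omega⟩ ((q⁻¹ * q⁻¹) • capCup u v i j))

/-- A multiple of a shift of the operators `adjGen`. -/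
noncomputable def shiftedGen (q : K) (R : PairMat K n) (u v : Matrix (Fin n) (Fin n) K) {k : ℕ}
    (hk : 0 < k) (t c : K) (i j : Fin n) : Module.End K (SymPower q R k) :=
  t • (adjGen q R u v hk i j - (if i = j then c else 0) • 1)

lemma form_smul_left (c : K) (g f : SymPower q R k) :
    form q R v k (c • g) f = c * form q R v k g f := tensForm_smul_left k c _ _

lemma form_smul_right (c : K) (g f : SymPower q R k) :
    form q R v k g (c • f) = c * form q R v k g f := tensForm_smul_right k c _ _

lemma form_sub_left (g g' f : SymPower q R k) :
    form q R v k (g - g') f = form q R v k g f - form q R v k g' f := tensForm_sub_left k _ _ _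

lemma form_sub_right (g f f' : SymPower q R k) :
    form q R v k g (f - f') = form q R v k g f - form q R v k g f' := tensForm_sub_right k _ _ _

lemma sum_capCup_mul_capCup (h : IsSnake q u v ε) (i l : Fin n) :
    ∑ j, capCup u v i j * capCup u v j l = qInt q 2 • capCup u v i l := by
  ext a b
  simp only [Matrix.sum_apply, Matrix.mul_apply, capCup, Matrix.of_apply, Matrix.smul_apply,
    smul_eq_mul, ← h.loop, Finset.sum_mul]
  rw [Finset.sum_comm]
  exact Finset.sum_congr rfl fun c _ => Finset.sum_congr rfl fun d _ => by ring

/-- The matrices straighten the cup and the cap of the generator, at the cost of `ε² = 1`. The index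
`j` then runs through the strand `s` as the identity, and a rank-one operator remains on the strand
`s + 1`. -/
lemma sum_siteS_capCup_mul_tl_mul (h : IsSnake q u v ε) (s : ℕ) (i l : Fin n) :
    ∑ j, siteS (s + 1) (capCup u v j l) * tl u v s * siteS (s + 1) (capCup u v i j) =
      siteS (s + 1) (capCup u v i l) := by
  have h1 : ∀ j, v * capCup u v j l = ε • Matrix.of fun a b => if a = j then v b l else 0 :=
    fun j => by
      ext a b
      have : (v * u) a j = (ε • (1 : Matrix (Fin n) (Fin n) K)) a j := by rw [h.cup_cap]
      simp only [Matrix.mul_apply, Matrix.smul_apply, Matrix.one_apply, smul_eq_mul] at this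
      simp only [Matrix.mul_apply, capCup, Matrix.of_apply, ← mul_assoc, ← Finset.sum_mul, this,
        Matrix.smul_apply, smul_eq_mul]
      split_ifs <;> simp
  have h2 : ∀ j, u * (capCup u v i j).transpose =
      ε • Matrix.of fun a b => if a = j then u b i else 0 := fun j => by
      ext a b
      have : (u * v) a j = (ε • (1 : Matrix (Fin n) (Fin n) K)) a j := by rw [h.cap_cup]
      simp only [Matrix.mul_apply, Matrix.smul_apply, Matrix.one_apply, smul_eq_mul] at this
      have h' : ∑ x, u a x * (u b i * v x j) = u b i * ∑ x, u a x * v x j := by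
        rw [Finset.mul_sum]
        exact Finset.sum_congr rfl fun x _ => by ring
      simp only [Matrix.mul_apply, capCup, Matrix.transpose_apply, Matrix.of_apply, h', this,
        Matrix.smul_apply, smul_eq_mul]
      split_ifs <;> ring
  have h3 : ∀ j, siteS (s + 1) (capCup u v j l) * tl u v s * siteS (s + 1) (capCup u v i j) =
      cupS (Matrix.of fun a b => if a = j then v b l else 0) s *
        capS (Matrix.of fun a b => if a = j then u b i else 0) s := fun j => by
    rw [tl, ← mul_assoc, siteS_mul_cupS_right, mul_assoc, capS_mul_siteS_right, h1, h2, cupS_smul,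
      capS_smul, smul_mul_assoc, mul_smul_comm, smul_smul, h.sign, one_smul]
  simp only [h3]
  ext W c
  simp only [LinearMap.sum_apply, Finset.sum_apply, Module.End.mul_apply, cupS_apply, capS_apply,
    Matrix.of_apply, siteS_apply, capCup]
  rw [Finset.sum_eq_single (c s) (fun j _ hj => by simp [hj.symm]) (by simp), if_pos rfl,
    Finset.sum_eq_single (c s) (fun j _ hj => by simp [hj]) (by simp), Finset.mul_sum]
  refine Finset.sum_congr rfl fun a _ => ?_
  rw [ins_cut, Function.update_eq_self, if_pos rfl]
  ring

lemma sum_smul_capCup (h : IsSnake q u v ε) :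
    ∑ i, ∑ j, (u * v.transpose) i j • capCup u v j i = 1 := by
  have h1 : ∑ i, ∑ j, (u * v.transpose) i j • capCup u v j i =
      u * (u * v.transpose).transpose * v.transpose := by
    ext a b
    simp only [Matrix.sum_apply, Matrix.smul_apply, capCup, Matrix.of_apply, smul_eq_mul,
      Matrix.mul_apply (M := _ * _) (N := v.transpose), Matrix.mul_apply (M := u)
        (N := (u * v.transpose).transpose), Matrix.transpose_apply, Finset.sum_mul]
    exact Finset.sum_congr rfl fun c _ => Finset.sum_congr rfl fun d _ => by ring
  rw [h1, Matrix.transpose_mul, Matrix.transpose_transpose, ← mul_assoc, h.cap_cup,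
    Matrix.smul_mul, one_mul, Matrix.smul_mul, ← Matrix.transpose_mul, h.cup_cap,
    Matrix.transpose_smul, smul_smul, h.sign, one_smul, Matrix.transpose_one]

/-- The operator `h_j^i` reads the letter `i` and writes `j`; the first factor supplies `u`
contracted with `i` and `v` ending in `j`. Together they form a cap followed by a cup. -/
lemma sum_siteS_capCup_mul_siteS_hMat (s : ℕ) :
    ∑ i, ∑ j, siteS s (capCup u v i j) * siteS (s + 1) (hMat j i) = tl u v s := by
  ext W c
  simp only [LinearMap.sum_apply, Finset.sum_apply, Module.End.mul_apply, siteS_apply, tl,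
    cupS_apply, capS_apply, capCup, Matrix.of_apply, ins_cut, Finset.mul_sum, Finset.sum_mul, hMat,
    Matrix.single_apply]
  have h : ∀ i, Function.update c s i (s + 1) = c (s + 1) := fun i =>
    Function.update_of_ne (by omega) _ _
  simp only [h]
  rw [Finset.sum_comm, Finset.sum_eq_single (c (s + 1)) (fun j _ hj => by simp [hj]) (by simp),
    Finset.sum_comm]
  refine Finset.sum_congr rfl fun i _ => ?_
  refine Finset.sum_congr rfl fun j _ => ?_
  rw [Finset.sum_eq_single j (fun x _ hx => by simp [hx.symm]) (by simp), if_pos ⟨rfl, rfl⟩]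
  ring

lemma sum_hMat : ∑ i : Fin n, (hMat i i : Matrix (Fin n) (Fin n) K) = 1 := by
  ext a b
  simp only [hMat, Matrix.sum_apply, Matrix.single_apply, Matrix.one_apply]
  split_ifs with h
  · subst h; simp
  · refine Finset.sum_eq_zero fun i _ => if_neg ?_
    rintro ⟨rfl, rfl⟩; exact h rfl

lemma inflate_truncCoprod (X : Matrix (Fin n) (Fin n) K) :
    inflate q R m (truncCoprod q R m X) = (q ^ (1 - (m : ℤ)) * qInt q m) •
      (symProj q R m * firstSite m X * symProj q R m) := by
  rw [truncCoprod, inflate_smul, inflate_compress]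

lemma ext_inflate_sum {ι : Type*} (S : Finset ι) (Y : ι → Module.End K (SymPower q R k)) :
    ext 0 k (inflate q R k (∑ i ∈ S, Y i)) = ∑ i ∈ S, ext 0 k (inflate q R k (Y i)) :=
  map_sum ((ext 0 k).toLinearMap.toAddMonoidHom.comp
    (AddMonoidHom.mk' (inflate q R k) (inflate_add k))) Y S

namespace IsCupCap

variable (D : IsCupCap q R u v ε)

include D

lemma form_adjGen (hk : 0 < k) (i j : Fin n) (g f : SymPower q R k) :
    form q R v k (adjGen q R u v hk i j g) f =
      form q R v k g (truncCoprod q R k (lMat R i j) f) := by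
  rw [adjGen, truncCoprod, LinearMap.smul_apply, LinearMap.smul_apply, form_smul_left,
    form_smul_right, D.form_compress fun g f => D.tensForm_site hk (D.capCup_mul i j) g f]

lemma ext_inflate_adjGen (hk : 0 < k) (i j : Fin n) :
    ext 0 k (inflate q R k (adjGen q R u v hk i j)) =
      (q ^ (1 - (k : ℤ)) * qInt q k * (q⁻¹ * q⁻¹)) •
        (jw q (tl u v) k * siteS (k - 1) (capCup u v i j) * jw q (tl u v) k) := by
  rw [adjGen, inflate_smul, inflate_compress, map_smul, map_mul, map_mul, D.ext_symProj_zero,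
    ext_siteAt, siteS_smul, mul_smul_comm, smul_mul_assoc, smul_smul, zero_add]

lemma inflate_one_sub (c : K) (Y : Module.End K (SymPower q R k)) :
    ext 0 k (inflate q R k (Y - c • 1)) = ext 0 k (inflate q R k Y) - c • jw q (tl u v) k := by
  have h : Y - c • 1 = Y + (-c) • (1 : Module.End K (SymPower q R k)) := by module
  rw [h, inflate_add, inflate_smul, inflate_one, map_add, map_smul, D.ext_symProj_zero]
  module

lemma ext_inflate_injective (k : ℕ) {Y Z : Module.End K (SymPower q R k)}
    (h : ext 0 k (inflate q R k Y) = ext 0 k (inflate q R k Z)) : Y = Z := by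
  have := D.nonempty
  exact D.inflate_injective k (ext_injective k h)

/-- Of the projectors in the product only the middle one matters, and it is expanded by the
Jones--Wenzl recursion. Its two terms contribute `[2]_q` and `-[k-1]_q / [k]_q`, altogether `[k+1]_q
/ [k]_q`. The factors are in the order of the opposite algebra. -/
lemma sum_adjGen_mul (hk : 0 < k) (i l : Fin n) :
    ∑ j, adjGen q R u v hk j l * adjGen q R u v hk i j =
      (q ^ (-1 - (k : ℤ)) * qInt q (k + 1)) • adjGen q R u v hk i l := by
  apply D.ext_inflate_injective
  rw [ext_inflate_sum, inflate_smul, map_smul]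
  simp only [D.inflate_mul, map_mul, D.ext_inflate_adjGen]
  obtain ⟨s, rfl⟩ : ∃ s, k = s + 1 := ⟨k - 1, by omega⟩
  simp only [Nat.add_sub_cancel]
  set L := jw q (tl u v) (s + 1) with hL
  set J := jw q (tl u v) s with hJ
  have hLL : L * L = L := jw_idem D.ne_zero D.generic (D.isTL (s + 1)) (by omega)
  have hLJ : L * J = L := jw_mul_jw' D.ne_zero D.generic (D.isTL (s + 1)) (by omega) (by omega)
  have hJL : J * L = L := jw_mul_jw D.ne_zero D.generic (D.isTL (s + 1)) (by omega) (by omega)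
  have hJS : ∀ X : Matrix (Fin n) (Fin n) K, Commute (siteS s X) J := fun X =>
    commute_jw s fun t ht => commute_siteS_tl (by omega)
  -- This holds also for `s = 0`, where the generator occurs with coefficient zero.
  have hrec : L = J - (qInt q s / qInt q (s + 1)) • (J * tl u v (s - 1) * J) := rfl
  have h1 : ∀ X Y : Matrix (Fin n) (Fin n) K, L * siteS s X * L * (L * siteS s Y * L) =
      L * (siteS s X * siteS s Y - (qInt q s / qInt q (s + 1)) •
        (siteS s X * tl u v (s - 1) * siteS s Y)) * L := fun X Y => by
    calc _ = L * siteS s X * (L * L) * siteS s Y * L := by simp only [mul_assoc]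
      _ = L * siteS s X * (J - (qInt q s / qInt q (s + 1)) • (J * tl u v (s - 1) * J)) *
          siteS s Y * L := by rw [hLL, ← hrec]
      _ = (L * (siteS s X * J)) * siteS s Y * L - (qInt q s / qInt q (s + 1)) •
          ((L * (siteS s X * J)) * tl u v (s - 1) * (J * siteS s Y * L)) := by
          simp only [mul_sub, sub_mul, mul_smul_comm, smul_mul_assoc, mul_assoc]
      _ = _ := by
          rw [(hJS X).eq, ← (hJS Y).eq, ← mul_assoc L, hLJ, mul_assoc _ J L, hJL]
          simp only [mul_sub, sub_mul, mul_smul_comm, smul_mul_assoc, mul_assoc]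
  have h2 : ∑ j, siteS s (capCup u v j l) * siteS s (capCup u v i j) =
      qInt q 2 • siteS s (capCup u v i l) := by
    simp only [siteS_mul]
    rw [← siteS_sum, sum_capCup_mul_capCup D.snake, siteS_smul]
  have h3 : (qInt q s / qInt q (s + 1)) • ∑ j, siteS s (capCup u v j l) * tl u v (s - 1) *
      siteS s (capCup u v i j) = (qInt q s / qInt q (s + 1)) • siteS s (capCup u v i l) := by
    rcases s with _ | s
    · simp
    · rw [Nat.add_sub_cancel, sum_siteS_capCup_mul_tl_mul D.snake]
  have h4 : ∑ j, L * siteS s (capCup u v j l) * L * (L * siteS s (capCup u v i j) * L) =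
      (qInt q 2 - qInt q s / qInt q (s + 1)) • (L * siteS s (capCup u v i l) * L) := by
    simp only [h1]
    rw [← Finset.sum_mul, ← Finset.mul_sum, Finset.sum_sub_distrib, ← Finset.smul_sum, h2, h3]
    simp only [mul_sub, sub_mul, mul_smul_comm, smul_mul_assoc]
    module
  simp only [smul_mul_assoc, mul_smul_comm, smul_smul, ← Finset.smul_sum]
  rw [h4, smul_smul]
  congr 1
  have hne := D.generic (s + 1) (by omega)
  have h5 := qInt_two_mul D.ne_zero s
  have h6 : q ^ (-1 - ((s + 1 : ℕ) : ℤ)) = q⁻¹ * q⁻¹ * q ^ (1 - ((s + 1 : ℕ) : ℤ)) := by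
    rw [← zpow_neg_one, ← zpow_add₀ D.ne_zero, ← zpow_add₀ D.ne_zero]
    congr 1
    push_cast
    ring
  rw [h6]
  field_simp
  linear_combination (q ^ (1 - ((s + 1 : ℕ) : ℤ))) ^ 2 * q⁻¹ ^ 4 * h5

/-- The rank-one matrices, weighted by `q²C`, add up to the identity, so only the normalisation of
the coproduct and of `B` is left. -/
lemma sum_smul_adjGen (hk : 0 < k) :
    ∑ i, ∑ j, (u * v.transpose) i j • adjGen q R u v hk j i =
      (q ^ (-1 - (k : ℤ)) * qInt q k) • 1 := by
  apply D.ext_inflate_injective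
  simp only [ext_inflate_sum, inflate_smul, map_smul, D.ext_inflate_adjGen, inflate_one,
    D.ext_symProj_zero]
  have h1 : ∑ i, ∑ j, (u * v.transpose) i j • (jw q (tl u v) k * siteS (k - 1) (capCup u v j i) *
      jw q (tl u v) k) = jw q (tl u v) k := by
    have h2 := congrArg (fun X => jw q (tl u v) k * siteS (k - 1) X * jw q (tl u v) k)
      (sum_smul_capCup D.snake)
    simp only [siteS_sum, siteS_smul, siteS_one, mul_one, Finset.mul_sum, Finset.sum_mul,
      mul_smul_comm, smul_mul_assoc, jw_idem D.ne_zero D.generic (D.isTL k) (a := k) (by omega)] at h2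
    exact h2
  simp only [smul_comm _ (q ^ (1 - (k : ℤ)) * qInt q k * (q⁻¹ * q⁻¹)), ← Finset.smul_sum]
  rw [h1]
  congr 1
  have h6 : q ^ (-1 - (k : ℤ)) = q⁻¹ * q⁻¹ * q ^ (1 - (k : ℤ)) := by
    rw [← zpow_neg_one, ← zpow_add₀ D.ne_zero, ← zpow_add₀ D.ne_zero]
    congr 1
    ring
  rw [h6]
  ring

/-- The rank-one parts of the generators sum to the generator at the junction, between the
projectors; the shift by `c` contributes a multiple of `∑ h_i^i = id`. -/
lemma stableOp_extLkm {A : Type*} [Ring A] [Algebra K A] {ρ : A →ₐ[K] EndOp q R k}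
    {l : Fin n → Fin n → A} (hk : 0 < k) (hm : 0 < m) {t c : K}
    (hρ : ∀ i j, unop (ρ (l i j)) = shiftedGen q R u v hk t c i j) :
    ∃ a b : K, stableOp q R k m (extLkm q R k m ρ l) =
      a • (twoJW q u v k m * tl u v (k - 1) * twoJW q u v k m) + b • twoJW q u v k m := by
  set L := jw q (tl u v) k with hL
  set P := jw q (fun s => tl u v (k + s)) m with hP
  set b' := q ^ (1 - (m : ℤ)) * qInt q m with hb'
  set a' := q ^ (1 - (k : ℤ)) * qInt q k * (q⁻¹ * q⁻¹) with ha'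
  have hLP : Commute L P := D.commute_two k m
  have hPP : P * P = P := jw_idem (e := fun s => tl u v (k + s)) D.ne_zero D.generic
    (D.isTL_shift k m) (by omega)
  have hS : ∀ X : Matrix (Fin n) (Fin n) K, Commute (siteS (k - 1) X) P := fun X =>
    commute_jw m fun t ht => commute_siteS_tl (by omega)
  have hH : ∀ X : Matrix (Fin n) (Fin n) K, Commute (siteS k X) L := fun X =>
    commute_jw k fun t ht => commute_siteS_tl (by omega)
  have h1 : ∀ i j, stableOp q R k m (ρ (l i j) ⊗ₜ op (truncCoprod q R m (hMat j i))) =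
      (t * a' * b') • (twoJW q u v k m * (siteS (k - 1) (capCup u v i j) *
        siteS (k - 1 + 1) (hMat j i)) * twoJW q u v k m) -
      (t * b' * if i = j then c else 0) • (L * P * siteS k (hMat j i) * P) := by
    intro i j
    rw [stableOp_tmul, hρ, MulOpposite.unop_op, shiftedGen, inflate_smul, map_smul,
      D.inflate_one_sub, D.ext_inflate_adjGen, inflate_truncCoprod, map_smul, map_mul, map_mul,
      ext_firstSite _ hm, D.ext_symProj, ← hL, ← hP, ← hb', ← ha', Nat.sub_add_cancel hk]
    have h2 : L * siteS (k - 1) (capCup u v i j) * L * (P * siteS k (hMat j i) * P) =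
        twoJW q u v k m * (siteS (k - 1) (capCup u v i j) * siteS k (hMat j i)) *
          twoJW q u v k m := by
      calc _ = L * siteS (k - 1) (capCup u v i j) * (L * P) * siteS k (hMat j i) * P := by
            simp only [mul_assoc]
        _ = L * (siteS (k - 1) (capCup u v i j) * P) * (L * siteS k (hMat j i)) * P := by
            rw [hLP.eq]; simp only [mul_assoc]
        _ = _ := by rw [(hS _).eq, ← (hH _).eq, twoJW, ← hL, ← hP]; simp only [mul_assoc]
    have h3 : L * (P * siteS k (hMat j i) * P) = L * P * siteS k (hMat j i) * P := by
      simp only [mul_assoc]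
    rw [smul_sub, sub_mul, smul_mul_assoc, smul_mul_assoc, smul_mul_assoc, smul_mul_assoc,
      mul_smul_comm, mul_smul_comm, h2, h3, smul_smul, smul_smul, smul_smul, smul_smul]
    congr 2
    ring
  refine ⟨t * a' * b', -(t * b' * c), ?_⟩
  simp only [extLkm, extL, map_sum, h1, Finset.sum_sub_distrib, ← Finset.smul_sum,
    ← Finset.mul_sum, ← Finset.sum_mul, sum_siteS_capCup_mul_siteS_hMat]
  have h4 : ∑ i : Fin n, ∑ j, (t * b' * if i = j then c else 0) • (L * P * siteS k (hMat j i) * P) =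
      (t * b' * c) • (L * P) := by
    have h5 : ∀ i : Fin n, ∑ j, (t * b' * if i = j then c else 0) •
        (L * P * siteS k (hMat j i) * P) = (t * b' * c) • (L * P * siteS k (hMat i i) * P) := by
      intro i
      rw [Finset.sum_eq_single i (fun j _ hj => by simp [hj.symm]) (by simp), if_pos rfl]
    simp only [h5, ← Finset.smul_sum, ← Finset.mul_sum, ← Finset.sum_mul]
    rw [← siteS_sum, sum_hMat, siteS_one, mul_one, mul_assoc L P P, hPP]
  rw [h4, show L * P = twoJW q u v k m from rfl]
  module

end IsCupCap

end Generators

end BraidedIndex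


namespace BraidedIndex

/-! ### Representations of the modified reflection equation algebra from a quadratic relation -/

section Reflection

/-- A solution of the reflection equation from an element `L` with quadratic minimal polynomial
and an element `e` with `e L e` proportional to `e`. -/
lemma reflection_of_quadratic {K M : Type*} [Field K] [Ring M] [Algebra K M] {q α β lam ħ : K}
    {e L : M} (hsq : L * L = α • L + β • 1) (htr : e * L * e = lam • e) (hħ : q * α - lam = ħ) :
    (q • 1 - e) * L * (q • 1 - e) * L - L * (q • 1 - e) * L * (q • 1 - e) -
      ħ • ((q • 1 - e) * L - L * (q • 1 - e)) = 0 := by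
  have h1 : e * L * e * L = lam • (e * L) := by rw [htr, smul_mul_assoc]
  have h2 : L * e * L * e = lam • (L * e) := by
    rw [mul_assoc L, mul_assoc L, htr, mul_smul_comm]
  have h3 : e * L * L = α • (e * L) + β • e := by
    rw [mul_assoc, hsq, mul_add, mul_smul_comm, mul_smul_comm, mul_one]
  have h4 : L * L * e = α • (L * e) + β • e := by
    rw [hsq, add_mul, smul_mul_assoc, smul_mul_assoc, one_mul]
  simp only [sub_mul, mul_sub, smul_mul_assoc, mul_smul_comm, one_mul, mul_one, h1, h2, h3, h4,
    ← hħ]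
  module

variable {K : Type*} [Field K] {n : ℕ} {q : K} {R : PairMat K n} {u v : Matrix (Fin n) (Fin n) K}

/-- Over the matrices with entries in `E` the first hypothesis is the quadratic equation for `L₁`.
Since `e` has rank one, the second says `e L₁ e = lam • e`. Such a pair solves the reflection
equation with `ħ = q α - lam`. -/
lemma exists_algHom_MREA (hbr : IsTLBraiding q R u v) {E : Type*} [Ring E] [Algebra K E]
    {l : Fin n → Fin n → E} {α β lam ħ : K}
    (hsq : ∀ i k, ∑ j, l i j * l j k = α • l i k + (if i = k then β else 0) • 1)
    (htr : ∑ i, ∑ j, (u * v.transpose) i j • l j i = lam • 1) (hħ : q * α - lam = ħ) :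
    ∃ ρ : MREA R ħ →ₐ[K] E, ∀ i j, ρ (genL R ħ i j) = l i j := by
  set F : FreeAlgebra K (Fin n × Fin n) →ₐ[K] E := FreeAlgebra.lift K fun p => l p.1 p.2 with hF
  set L : Matrix (Fin n × Fin n) (Fin n × Fin n) E :=
    Matrix.of fun s t => if s.2 = t.2 then l s.1 t.1 else 0 with hL
  set e : Matrix (Fin n × Fin n) (Fin n × Fin n) E :=
    Matrix.of fun s t => algebraMap K E (u s.1 s.2 * v t.1 t.2) with he
  have hFL : F.mapMatrix (freeL K n) = L := by
    ext s t
    simp only [AlgHom.mapMatrix_apply, Matrix.map_apply, freeL, hL, Matrix.of_apply]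
    split_ifs <;> simp [hF]
  have hFR : F.mapMatrix (freeR R) = q • 1 - e := by
    ext ⟨a, b⟩ ⟨c, d⟩
    simp only [AlgHom.mapMatrix_apply, Matrix.map_apply, freeR, hbr a b c d, he,
      Matrix.sub_apply, Matrix.smul_apply, Matrix.one_apply, Matrix.of_apply, map_sub,
      Prod.mk.injEq, Algebra.algebraMap_eq_smul_one]
    split_ifs <;> simp
  have hsq' : L * L = α • L + β • 1 := by
    ext ⟨a, b⟩ ⟨c, d⟩
    simp only [hL, Matrix.mul_apply, Matrix.of_apply, Matrix.add_apply, Matrix.smul_apply,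
      Matrix.one_apply, Fintype.sum_prod_type, Prod.mk.injEq]
    have h1 : ∀ x, ∑ y, (if b = y then l a x else 0) * (if y = d then l x c else 0) =
        if b = d then l a x * l x c else 0 := fun x => by
      rw [Finset.sum_eq_single b (fun y _ hy => by simp [hy.symm]) (by simp), if_pos rfl]
      split_ifs <;> simp
    simp only [h1]
    by_cases hbd : b = d
    · simp only [hbd, if_true, hsq, and_true]
      split_ifs <;> simp
    · simp [hbd]
  have htr' : e * L * e = lam • e := by
    ext ⟨a, b⟩ ⟨c, d⟩
    have h1 : ∑ x, ∑ y, ∑ z, (v z y * u x y) • l z x = lam • (1 : E) := by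
      rw [← htr]
      simp only [Matrix.mul_apply, Matrix.transpose_apply, Finset.sum_smul]
      refine Finset.sum_congr rfl fun x _ => ?_
      rw [Finset.sum_comm]
      exact Finset.sum_congr rfl fun z _ => Finset.sum_congr rfl fun y _ => by rw [mul_comm]
    have h2 : ∀ x y, (e * L) (a, b) (x, y) = ∑ z, (u a b * v z y) • l z x := fun x y => by
      simp only [Matrix.mul_apply, Fintype.sum_prod_type, he, hL, Matrix.of_apply]
      refine Finset.sum_congr rfl fun z _ => ?_
      rw [Finset.sum_eq_single y (fun w _ hw => by simp [hw]) (by simp), if_pos rfl,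
        Algebra.smul_def]
    rw [Matrix.mul_apply, Fintype.sum_prod_type]
    simp only [h2, Matrix.smul_apply]
    have h3 : ∀ x y, (∑ z, (u a b * v z y) • l z x) * e (x, y) (c, d) =
        (u a b * v c d) • ∑ z, (v z y * u x y) • l z x := fun x y => by
      rw [he, Matrix.of_apply, ← Algebra.commutes, ← Algebra.smul_def, Finset.smul_sum,
        Finset.smul_sum]
      refine Finset.sum_congr rfl fun z _ => ?_
      rw [smul_smul, smul_smul]
      congr 1
      ring
    simp only [h3, ← Finset.smul_sum]
    rw [h1, he, Matrix.of_apply, Algebra.algebraMap_eq_smul_one, smul_comm]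
  have hrel : ∀ ⦃x y⦄, mreRel R ħ x y → F x = F y := by
    rintro _ _ ⟨s, t⟩
    have h := reflection_of_quadratic hsq' htr' hħ
    rw [← hFL, ← hFR] at h
    simp only [← map_mul, ← map_sub, ← map_smul] at h
    rw [map_zero]
    exact congrFun (congrFun h s) t
  refine ⟨RingQuot.liftAlgHom K ⟨F, hrel⟩, fun i j => ?_⟩
  rw [genL]
  refine (RingQuot.liftAlgHom_mkAlgHom_apply K F hrel _).trans ?_
  rw [hF, FreeAlgebra.lift_ι_apply]

lemma exists_algHom_SMREA {E : Type*} [Ring E] [Algebra K E] {ħ : K} (ρ : MREA R ħ →ₐ[K] E)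
    (h : ∑ i, ∑ j, matC R i j • ρ (genL R ħ j i) = 0) :
    ∃ σ : SMREA R ħ →ₐ[K] E, ∀ i j, σ (genSL R ħ i j) = ρ (genL R ħ i j) := by
  have hrel : ∀ ⦃x y⦄, slRel R ħ x y → ρ x = ρ y := by
    rintro _ _ ⟨⟩
    simpa only [map_sum, map_smul, map_zero] using h
  exact ⟨RingQuot.liftAlgHom K ⟨ρ, hrel⟩,
    fun i j => RingQuot.liftAlgHom_mkAlgHom_apply K ρ hrel _⟩

end Reflection

/-! ### Existence and uniqueness of the representations `π̄_k` -/

section Representations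

open MulOpposite (op unop)

variable {K : Type*} [Field K] {n : ℕ} {q ε : K} {R : PairMat K n}
  {u v : Matrix (Fin n) (Fin n) K} {k m : ℕ}

lemma sum_smul_ite_smul_one {A : Type*} [Ring A] [Algebra K A] (M : Matrix (Fin n) (Fin n) K)
    (c : K) : ∑ i, ∑ j, M i j • (if j = i then c else 0) • (1 : A) = (c * M.trace) • 1 := by
  have h : ∀ i, ∑ j, M i j • (if j = i then c else 0) • (1 : A) = (c * M i i) • 1 := fun i => by
    rw [Finset.sum_eq_single i (fun j _ hj => by simp [hj]) (by simp), if_pos rfl, smul_smul,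
      mul_comm]
  simp only [h, ← Finset.sum_smul, ← Finset.mul_sum, Matrix.trace, Matrix.diag_apply]

/-- With `X² = α X` and `Y = t (X - c)` one has `Y² = t (α - 2c) Y + t² c (α - c)`, written in
entries. -/
lemma sum_shift_mul {A : Type*} [Ring A] [Algebra K A] {x y : Fin n → Fin n → A} {α t c : K}
    (hx : ∀ i l, ∑ j, x j l * x i j = α • x i l)
    (hy : ∀ i j, y i j = t • (x i j - (if i = j then c else 0) • 1)) (i l : Fin n) :
    ∑ j, y j l * y i j = (t * (α - 2 * c)) • y i l +
        (if i = l then t ^ 2 * (c * (α - c)) else 0) • 1 := by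
  have h : ∀ j, y j l * y i j =
      t ^ 2 • (x j l * x i j) - (if j = l then t ^ 2 * c else 0) • x i j -
        (if i = j then t ^ 2 * c else 0) • x j l +
        (if j = l then (if i = j then t ^ 2 * c ^ 2 else 0) else 0) • 1 := fun j => by
    simp only [hy, smul_mul_assoc, mul_smul_comm, sub_mul, mul_sub, one_mul, mul_one]
    split_ifs <;> module
  rw [Finset.sum_congr rfl fun j _ => h j, hy]
  simp only [Finset.sum_add_distrib, Finset.sum_sub_distrib, ← Finset.smul_sum, hx, ite_smul,
    zero_smul, Finset.sum_ite_eq, Finset.sum_ite_eq', Finset.mem_univ, if_true]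
  split_ifs <;> module

lemma sum_smul_shift {A : Type*} [Ring A] [Algebra K A] {M : Matrix (Fin n) (Fin n) K}
    {x y : Fin n → Fin n → A} {α t c : K} (hx : ∑ i, ∑ j, M i j • x j i = α • 1)
    (hy : ∀ i j, y i j = t • (x i j - (if i = j then c else 0) • 1)) :
    ∑ i, ∑ j, M i j • y j i = (t * (α - c * M.trace)) • 1 := by
  have h : ∀ i j, M i j • y j i =
      t • (M i j • x j i - M i j • (if j = i then c else 0) • 1) := fun i j => by
    rw [hy]
    module
  simp only [h, ← Finset.smul_sum, Finset.sum_sub_distrib]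
  rw [hx, sum_smul_ite_smul_one]
  module

namespace IsCupCap

variable (D : IsCupCap q R u v ε)

include D

lemma sum_shiftedGen_mul (hk : 0 < k) (t c : K) (i l : Fin n) :
    ∑ j, shiftedGen q R u v hk t c j l * shiftedGen q R u v hk t c i j =
      (t * (q ^ (-1 - (k : ℤ)) * qInt q (k + 1) - 2 * c)) • shiftedGen q R u v hk t c i l +
        (if i = l then t ^ 2 * (c * (q ^ (-1 - (k : ℤ)) * qInt q (k + 1) - c)) else 0) • 1 :=
  sum_shift_mul (A := Module.End K (SymPower q R k)) (x := adjGen q R u v hk)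
    (y := shiftedGen q R u v hk t c) (D.sum_adjGen_mul hk) (fun _ _ => rfl) i l

lemma trace_mul_transpose : (u * v.transpose).trace = qInt q 2 := by
  simp only [Matrix.trace, Matrix.diag_apply, Matrix.mul_apply, Matrix.transpose_apply]
  exact D.snake.loop

lemma sum_smul_shiftedGen (hk : 0 < k) (t c : K) :
    ∑ i, ∑ j, (u * v.transpose) i j • shiftedGen q R u v hk t c j i =
      (t * (q ^ (-1 - (k : ℤ)) * qInt q k - c * qInt q 2)) • 1 := by
  rw [← D.trace_mul_transpose]
  exact sum_smul_shift (A := Module.End K (SymPower q R k)) (x := adjGen q R u v hk)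
    (y := shiftedGen q R u v hk t c) (D.sum_smul_adjGen hk) fun _ _ => rfl

lemma exists_algHom_shiftedGen (hk : 0 < k) {t c ħ : K}
    (h : t * (q * (q ^ (-1 - (k : ℤ)) * qInt q (k + 1) - 2 * c) -
      (q ^ (-1 - (k : ℤ)) * qInt q k - c * qInt q 2)) = ħ) :
    ∃ ρ : MREA R ħ →ₐ[K] EndOp q R k,
      ∀ i j, ρ (genL R ħ i j) = op (shiftedGen q R u v hk t c i j) := by
  refine exists_algHom_MREA (E := EndOp q R k) D.braiding
    (l := fun i j => op (shiftedGen q R u v hk t c i j))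
    (α := t * (q ^ (-1 - (k : ℤ)) * qInt q (k + 1) - 2 * c))
    (β := t ^ 2 * (c * (q ^ (-1 - (k : ℤ)) * qInt q (k + 1) - c)))
    (lam := t * (q ^ (-1 - (k : ℤ)) * qInt q k - c * qInt q 2)) (fun i l => ?_) ?_ ?_
  · have := congrArg op (D.sum_shiftedGen_mul hk t c i l)
    simpa only [Finset.op_sum, MulOpposite.op_mul, MulOpposite.op_add, MulOpposite.op_smul,
      MulOpposite.op_one] using this
  · have := congrArg op (D.sum_smul_shiftedGen hk t c)
    simpa only [Finset.op_sum, MulOpposite.op_smul, MulOpposite.op_one] using this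
  · rw [← h]
    ring

lemma form_shiftedGen (hk : 0 < k) (t c : K) (i j : Fin n) (g f : SymPower q R k) :
    form q R v k (shiftedGen q R u v hk t c i j g) f =
      form q R v k g (t • (truncCoprod q R k (lMat R i j) f - (if i = j then c else 0) • f)) := by
  rw [shiftedGen, LinearMap.smul_apply, form_smul_left, LinearMap.sub_apply, form_sub_left,
    D.form_adjGen, LinearMap.smul_apply, form_smul_left, form_smul_right, form_sub_right,
    form_smul_right]
  rfl

/-- Nondegeneracy on `V_(k)` makes adjoints unique, so the defining condition of `π̄_k` determines
it on generators. -/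
lemma ext_of_form {Y Z : Module.End K (SymPower q R k)}
    (h : ∀ g f, form q R v k (Y g) f = form q R v k (Z g) f) : Y = Z :=
  LinearMap.ext fun g => sub_eq_zero.mp <| D.form_nondegenerate fun f => by
    rw [form_sub_left, h, sub_self]

lemma truncCoprod_sub_smul_one (hk : 0 < k) (X : Matrix (Fin n) (Fin n) K) (c : K)
    (f : SymPower q R k) : truncCoprod q R k (X - c • 1) f =
      truncCoprod q R k X f - (q ^ (1 - (k : ℤ)) * qInt q k * c) • f := by
  have h1 : firstSite k (X - c • (1 : Matrix (Fin n) (Fin n) K)) = firstSite k X - c • 1 := by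
    have := D.nonempty
    apply ext_injective k
    rw [map_sub, map_smul, map_one, ext_firstSite _ hk, ext_firstSite _ hk, siteS_sub, siteS_smul_one]
  have h2 : compress q R k (firstSite k X - c • 1) f = compress q R k (firstSite k X) f - c • f := by
    apply Subtype.ext
    change symProj q R k (firstSite k X f - c • (f : Tens K n k)) =
      symProj q R k (firstSite k X f) - c • (f : Tens K n k)
    rw [map_sub, map_smul, D.symProj_coe]
  rw [truncCoprod, truncCoprod, LinearMap.smul_apply, LinearMap.smul_apply, h1, h2]
  module

lemma matC_mul_matB : matC R * matB R = (q⁻¹ * q⁻¹ * (q⁻¹ * q⁻¹)) • 1 := by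
  have h : (q ^ 2 • matC R) * (q ^ 2 • matB R) = 1 := by
    rw [D.sq_smul_matC, D.sq_smul_matB, ← mul_assoc, mul_assoc u, ← Matrix.transpose_mul,
      D.snake.cap_cup, Matrix.transpose_smul, Matrix.transpose_one, Matrix.mul_smul, mul_one,
      Matrix.smul_mul, D.snake.cap_cup, smul_smul, D.snake.sign, one_smul]
  rw [← h, Matrix.smul_mul, Matrix.mul_smul, smul_smul, smul_smul]
  have := D.ne_zero
  rw [show q⁻¹ * q⁻¹ * (q⁻¹ * q⁻¹) * q ^ 2 * q ^ 2 = 1 by field_simp, one_smul]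

lemma trace_matC : (matC R).trace = q⁻¹ * q⁻¹ * qInt q 2 := by
  have h := D.trace_mul_transpose
  rw [← D.sq_smul_matC, Matrix.trace_smul, smul_eq_mul] at h
  have := D.ne_zero
  rw [← h]
  field_simp

/-- Here `tr (C l_i^j)` is the entry `(C B)_i^j`, and `C B = q⁻⁴` while `tr C = q⁻² [2]_q`. Hence
only the diagonal generators are shifted. -/
lemma slPart_lMat (i j : Fin n) :
    slPart R (lMat R i j) = lMat R i j - (if i = j then q⁻¹ * q⁻¹ / qInt q 2 else 0) • 1 := by
  have h1 : (matC R * lMat R i j).trace = (matC R * matB R) i j := by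
    simp only [Matrix.trace, Matrix.diag_apply, Matrix.mul_apply, lMat_apply]
    rw [Finset.sum_eq_single i (fun a _ ha => by simp [ha]) (by simp)]
    simp
  rw [slPart, h1, D.matC_mul_matB, D.trace_matC, Matrix.smul_apply, Matrix.one_apply]
  have := D.ne_zero
  have := D.generic 2 (by omega)
  congr 2
  split_ifs
  · rw [smul_eq_mul]
    field_simp
  · simp

lemma isPiBar_iff (hk : 0 < k) {ħ : K} (ρ : MREA R ħ →ₐ[K] EndOp q R k) :
    IsPiBar q R v ħ k ρ ↔
      ∀ i j, unop (ρ (genL R ħ i j)) = shiftedGen q R u v hk ħ 0 i j := by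
  have h : ∀ i j g f, form q R v k (shiftedGen q R u v hk ħ 0 i j g) f =
      form q R v k g (ħ • truncCoprod q R k (lMat R i j) f) := fun i j g f => by
    rw [D.form_shiftedGen, ite_self, zero_smul, sub_zero]
  exact ⟨fun H i j => D.ext_of_form fun g f => (H i j g f).trans (h i j g f).symm,
    fun H i j g f => by rw [H, h]⟩

lemma isSlPiBar_iff (hk : 0 < k) {ħ : K} (ρ : SMREA R ħ →ₐ[K] EndOp q R k) :
    IsSlPiBar q R v ħ k ρ ↔ ∃ t : K, t ≠ 0 ∧ ∀ i j, unop (ρ (genSL R ħ i j)) =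
      shiftedGen q R u v hk t (q ^ (-1 - (k : ℤ)) * qInt q k / qInt q 2) i j := by
  have h : ∀ t i j g f, form q R v k (shiftedGen q R u v hk t
      (q ^ (-1 - (k : ℤ)) * qInt q k / qInt q 2) i j g) f =
      form q R v k g (t • truncCoprod q R k (slPart R (lMat R i j)) f) := fun t i j g f => by
    have h6 : q ^ (-1 - (k : ℤ)) = q⁻¹ * q⁻¹ * q ^ (1 - (k : ℤ)) := by
      rw [← zpow_neg_one, ← zpow_add₀ D.ne_zero, ← zpow_add₀ D.ne_zero]
      congr 1
      ring
    rw [D.form_shiftedGen, D.slPart_lMat, D.truncCoprod_sub_smul_one hk]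
    have h7 : (if i = j then q ^ (-1 - (k : ℤ)) * qInt q k / qInt q 2 else 0) =
        q ^ (1 - (k : ℤ)) * qInt q k * if i = j then q⁻¹ * q⁻¹ / qInt q 2 else 0 := by
      rw [h6]
      split_ifs <;> ring
    rw [h7]
  exact ⟨fun ⟨t, ht, H⟩ => ⟨t, ht, fun i j =>
      D.ext_of_form fun g f => (H i j g f).trans (h t i j g f).symm⟩,
    fun ⟨t, ht, H⟩ => ⟨t, ht, fun i j g f => by rw [H, h]⟩⟩

lemma exists_isPiBar (hk : 0 < k) (ħ : K) :
    ∃ ρ : MREA R ħ →ₐ[K] EndOp q R k, IsPiBar q R v ħ k ρ := by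
  have h0 := D.ne_zero
  obtain ⟨ρ, hρ⟩ := D.exists_algHom_shiftedGen hk (t := ħ) (c := 0) (ħ := ħ) (by
    have h : q * q ^ (-1 - (k : ℤ)) * q ^ (k : ℤ) = 1 := by
      rw [← zpow_one_add₀ h0, ← zpow_add₀ h0, show 1 + (-1 - (k : ℤ)) + k = 0 by ring, zpow_zero]
    have h1 : q * qInt q (k + 1) = qInt q k + q * q ^ (k : ℤ) := by
      rw [qInt_succ' h0]
      field_simp
    linear_combination ħ * h + ħ * q ^ (-1 - (k : ℤ)) * h1)
  exact ⟨ρ, (D.isPiBar_iff hk ρ).mpr fun i j => by rw [hρ, MulOpposite.unop_op]⟩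

lemma exists_isSlPiBar (hk : 0 < k) {ħ : K} (hħ : ħ ≠ 0) :
    ∃ ρ : SMREA R ħ →ₐ[K] EndOp q R k, IsSlPiBar q R v ħ k ρ := by
  have h0 := D.ne_zero
  have h2 := D.generic 2 (by omega)
  set c := q ^ (-1 - (k : ℤ)) * qInt q k / qInt q 2 with hc
  have hc2 : c * qInt q 2 = q ^ (-1 - (k : ℤ)) * qInt q k := div_mul_cancel₀ _ h2
  -- If this vanished, `[2]_q [k+1]_q = 2 [k]_q` would give `[k+2]_q = [k]_q`, that is `q^{k+1} +
  -- q^{-k-1} = 0`. Then `[2k+2]_q = 0`, against genericity.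
  have hne : q ^ (-1 - (k : ℤ)) * qInt q (k + 1) - 2 * c ≠ 0 := by
    intro h
    have h3 := qInt_two_mul h0 k
    have h4 := qInt_succ h0 (k + 1)
    have h5 := qInt_succ' h0 k
    have h8 := qInt_add h0 (k + 1) (k + 1)
    have h9 : qInt q (k + 2) = qInt q k + q ^ ((k + 1 : ℕ) : ℤ) + q ^ (-((k + 1 : ℕ) : ℤ)) := by
      have h6 : q ^ ((k + 1 : ℕ) : ℤ) = q * q ^ (k : ℤ) := by
        rw [← zpow_one_add₀ h0]
        congr 1
        push_cast
        ring
      rw [h4, h5, h6]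
      field_simp
    have h10 : q ^ (-1 - (k : ℤ)) * (qInt q (k + 2) - qInt q k) = 0 := by
      linear_combination qInt q 2 * h + 2 * hc2 - q ^ (-1 - (k : ℤ)) * h3
    have h11 : qInt q (k + 2) - qInt q k = 0 :=
      (mul_eq_zero.mp h10).resolve_left (zpow_ne_zero _ h0)
    refine D.generic (k + 1 + (k + 1)) (by omega) ?_
    rw [h8]
    linear_combination qInt q (k + 1) * (h11 - h9)
  obtain ⟨ρ, hρ⟩ := D.exists_algHom_shiftedGen hk
    -- This `c` makes the quantum trace of the generators vanish, so `lam = 0` and `t` is found from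
    -- `q α = ħ`; the same vanishing lets the representation descend to `𝓢𝓛_{ħ,q}`.
    (t := ħ / (q * (q ^ (-1 - (k : ℤ)) * qInt q (k + 1) - 2 * c))) (c := c) (ħ := ħ) (by
      rw [hc2, sub_self, sub_zero]
      exact div_mul_cancel₀ _ (mul_ne_zero h0 hne))
  obtain ⟨σ, hσ⟩ := exists_algHom_SMREA (E := EndOp q R k) ρ (by
    have h := congrArg op (D.sum_smul_shiftedGen hk
      (ħ / (q * (q ^ (-1 - (k : ℤ)) * qInt q (k + 1) - 2 * c))) c)
    rw [hc2, sub_self, mul_zero, zero_smul] at h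
    rw [← D.sq_smul_matC] at h
    simp only [Matrix.smul_apply, smul_assoc, ← Finset.smul_sum, MulOpposite.op_smul,
      Finset.op_sum, MulOpposite.op_zero, ← hρ] at h
    exact (smul_eq_zero.mp h).resolve_left (pow_ne_zero 2 h0))
  exact ⟨σ, (D.isSlPiBar_iff hk σ).mpr ⟨_, div_ne_zero hħ (mul_ne_zero h0 hne), fun i j => by
    rw [hσ, hρ, MulOpposite.unop_op]⟩⟩

end IsCupCap

end Representations

end BraidedIndex

theorem mainTheorem1 {K : Type*} [Field K] {n : ℕ} (q : K) (R : PairMat K n)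
    (hR : IsHeckeSymmetry q R) (hrank : IsEvenOfRank q R 2) (hadm : IsAdmissible q R)
    (hq : ∀ j : ℕ, 1 ≤ j → qInt q j ≠ 0)
    (v : Matrix (Fin n) (Fin n) K) (hv : IsDeterminant q R v)
    (ħ : K) (hħ : ħ ≠ 0) (k m : ℕ) (hm : 1 ≤ m) (hmk : m ≤ k) :
    ((∃ ρ : MREA R ħ →ₐ[K] EndOp q R k, IsPiBar q R v ħ k ρ) ∧
      ∀ ρ : MREA R ħ →ₐ[K] EndOp q R k, IsPiBar q R v ħ k ρ →
        (∃ μ : Fin (m + 1) → K, AreEigenvalues q R v hmk ρ (genL R ħ) μ) ∧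
        ∀ μ : Fin (m + 1) → K, AreEigenvalues q R v hmk ρ (genL R ħ) μ → Function.Injective μ →
          Polynomial.aeval (extLkm q R k m ρ (genL R ħ))
            (∏ i, (Polynomial.X - Polynomial.C (μ i))) = 0 ∧
          (∀ N : ℕ, boldTrace q R k m (extLkm q R k m ρ (genL R ħ) ^ N) =
            ∑ i : Fin (m + 1), μ i ^ N * catDim q R (k + m - 2 * (i : ℕ))) ∧
          ∀ i : Fin (m + 1),
            qIndex q R k m ρ (idem q R m ρ (genL R ħ) μ i) = catDim q R (k + m - 2 * (i : ℕ)) ∧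
            qIndex q R k m ρ (idem q R m ρ (genL R ħ) μ i) = qInt q (m + k - 2 * (i : ℕ) + 1)) ∧
    ((∃ ρ : SMREA R ħ →ₐ[K] EndOp q R k, IsSlPiBar q R v ħ k ρ) ∧
      ∀ ρ : SMREA R ħ →ₐ[K] EndOp q R k, IsSlPiBar q R v ħ k ρ →
        (∃ μ : Fin (m + 1) → K, AreEigenvalues q R v hmk ρ (genSL R ħ) μ) ∧
        ∀ μ : Fin (m + 1) → K, AreEigenvalues q R v hmk ρ (genSL R ħ) μ → Function.Injective μ →
          Polynomial.aeval (extLkm q R k m ρ (genSL R ħ))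
            (∏ i, (Polynomial.X - Polynomial.C (μ i))) = 0 ∧
          (∀ N : ℕ, boldTrace q R k m (extLkm q R k m ρ (genSL R ħ) ^ N) =
            ∑ i : Fin (m + 1), μ i ^ N * catDim q R (k + m - 2 * (i : ℕ))) ∧
          ∀ i : Fin (m + 1),
            qIndex q R k m ρ (idem q R m ρ (genSL R ħ) μ i) = catDim q R (k + m - 2 * (i : ℕ)) ∧
            qIndex q R k m ρ (idem q R m ρ (genSL R ħ) μ i) = qInt q (m + k - 2 * (i : ℕ) + 1)) := by
  obtain ⟨u, ε, hbr, hs⟩ := exists_isSnake hR hrank hadm (hq 2 (by omega)) hv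
  have D : IsCupCap q R u v ε := ⟨hR.ne_zero, hq, hbr, hs⟩
  have hk : 0 < k := hm.trans hmk
  -- Both kinds of representations send the generators to some `shiftedGen`, so a single argument
  -- covers their eigenvalues, multiplicities and indices.
  refine ⟨⟨D.exists_isPiBar hk ħ, fun ρ hρ => ?_⟩, D.exists_isSlPiBar hk hħ, fun ρ hρ => ?_⟩
  · obtain ⟨a, b, hL⟩ := D.stableOp_extLkm hk hm ((D.isPiBar_iff hk ρ).mp hρ)
    exact ⟨D.exists_areEigenvalues hm hmk hL,
      fun μ hμ hinj => D.conclusions hmk (twoJW_center_mem hm hmk hL) hμ hinj⟩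
  · obtain ⟨t, -, ht⟩ := (D.isSlPiBar_iff hk ρ).mp hρ
    obtain ⟨a, b, hL⟩ := D.stableOp_extLkm hk hm ht
    exact ⟨D.exists_areEigenvalues hm hmk hL,
      fun μ hμ hinj => D.conclusions hmk (twoJW_center_mem hm hmk hL) hμ hinj⟩
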